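/- Let $\mathrm{GF}(q)$ be a finite field with $q\neq 2$, and let $D,N$ be integers with $N>2D\geq 6$. Let $\Gamma$ be the bilinear forms graph $H_q(D,N-D)$: its vertex set $X$ consists of the $D\times(N-D)$ matrices over $\mathrm{GF}(q)$ (so $|X|=q^{D(N-D)}$), and two matrices are adjacent when their difference has rank one. Let $\partial$ be the path-length distance, and put $\Gamma_i(z)=\{w\in X:\partial(z,w)=i\}$ and $\Gamma(z)=\Gamma_1(z)$. Let $V=\mathbb R^X$, with standard basis $\{\hat z: z\in X\}$ and entrywise product $\circ$. Let $\theta_0>\theta_1>\cdots$ be the distinct eigenvalues of the adjacency matrix $A$ of $\Gamma$, and let $E$ be the primitive idempotent associated with $\theta_1$, that is, the real matrix acting as the identity on the $\theta_1$-eigenspace of $A$ and as $0$ on every other eigenspace of $A$. The Norton product on $EV$ is $u\star v=E(u\circ v)$. For $0\le i\le D$ let $\theta_i^*$ be the common value of $|X|E_{z,w}$ over all $z,w\in X$ with $\partial(z,w)=i$. Fix $x,y\in X$ with $k=\partial(x,y)$ satisfying $2\leq k\leq D-1$. Define $O_1=\Gamma(x)\cap\Gamma_{k-1}(y)$ and $O_6=\Gamma(x)\cap\Gamma_{k+1}(y)$,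 and let $O_2,O_3,O_4,O_5$ be the sets of those $z\in\Gamma(x)\cap\Gamma_k(y)$ for which the pair $$\bigl(|\Gamma(x)\cap\Gamma(z)\cap\Gamma_{k-1}(y)|,\ |\Gamma(x)\cap\Gamma(z)\cap\Gamma_{k+1}(y)|\bigr)$$ equals $(2q^{k-1},0)$, $(2q^{k-1}-1,0)$, $(q^{k-1},q^D-q^k)$, $(q^{k-1},q^{N-D}-q^k)$, respectively. For $1\leq i\leq 6$ let $$\lambda_i=|O_i|\,\frac{\theta_1^*-\theta_{k+\varepsilon(i)}^*}{\theta_0^*-\theta_k^*},\qquad O_i^\vee=\Bigl(\sum_{z\in O_i}\hat z\Bigr)-\lambda_i\hat x,$$ where $\varepsilon(1)=-1$, $\varepsilon(2)=\cdots=\varepsilon(5)=0$, $\varepsilon(6)=1$. Let $$\mathrm{Sym}(S)=\mathrm{Span}\{EO_i^\vee: 1\leq i\leq 6\},\qquad \mathrm{ASym}(S)=\mathrm{Span}\{E\hat x-E\hat y\}$$ (these are subspaces of $S=\mathrm{Span}\{E\sum_{z\in O_i}\hat z : 1\le i\le 6\}$). Then the following hold. (i) For $1\leq j\leq 6$, $EO_j^\vee\star(E\hat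 x-E\hat y)=\frac{c_j}{|X|}(E\hat x-E\hat y)$, where $$c_1=q^{k-1}(q^D+q^{N-D}-2q^{k-1}-q),\quad c_2=-2q^{k-1}(q^{k-1}-1),\quad c_3=-(q-2)q^{k-1}(2q^{k-1}-1),$$ $$c_4=\frac{(q^D-2q^k)(q^{N-D}-q^k)}{q},\quad c_5=\frac{(q^D-q^k)(q^{N-D}-2q^k)}{q},\quad c_6=-\frac{2(q^D-q^k)(q^{N-D}-q^k)}{q}.$$ (ii) $\mathrm{Sym}(S)\star\mathrm{ASym}(S)\subseteq\mathrm{ASym}(S)$. (iii) $\mathrm{ASym}(S)\star\mathrm{ASym}(S)\subseteq\mathrm{Sym}(S)$. (iv) $(E\hat x+E\hat y)\star\mathrm{Sym}(S)\subseteq\mathrm{Sym}(S)$. -/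

import Mathlib

noncomputable section

open Matrix

namespace NortonBilinear

/-! ### Generalities on a finite graph with vertex set `X` and standard module `X → ℝ` -/

section General

variable {X : Type*} [Fintype X] [DecidableEq X]

/-- `E` acts as the identity on the `θ`-eigenspace of `A`, and as `0` on every other
eigenspace of `A`. -/
def IsPrimitiveIdempotent (A : Matrix X X ℝ) (θ : ℝ) (E : Matrix X X ℝ) : Prop :=
  (∀ v : X → ℝ, A *ᵥ v = θ • v → E *ᵥ v = v) ∧
    ∀ η : ℝ, η ≠ θ → ∀ v : X → ℝ, A *ᵥ v = η • v → E *ᵥ v = 0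

/-- The matrix of the orthogonal projection of `ℝ^X` onto the `θ`-eigenspace of `A`. For symmetric
`A` this is the unique matrix `E` with `IsPrimitiveIdempotent A θ E`; see
`isPrimitiveIdempotent_primitiveIdempotent` and `IsPrimitiveIdempotent.eq` below. -/
def primitiveIdempotent (A : Matrix X X ℝ) (θ : ℝ) : Matrix X X ℝ :=
  (Matrix.toEuclideanLin (𝕜 := ℝ) (m := X) (n := X)).symm
    (Module.End.eigenspace (Matrix.toEuclideanLin A) θ).starProjection.toLinearMap

theorem primitiveIdempotent_mulVec (A : Matrix X X ℝ) (θ : ℝ) (v : X → ℝ) :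
    primitiveIdempotent A θ *ᵥ v = WithLp.ofLp
      ((Module.End.eigenspace (Matrix.toEuclideanLin A) θ).starProjection (WithLp.toLp 2 v)) := by
  have h : Matrix.toEuclideanLin (primitiveIdempotent A θ) =
      (Module.End.eigenspace (Matrix.toEuclideanLin A) θ).starProjection.toLinearMap := by
    simp [primitiveIdempotent]
  have h2 := congrArg WithLp.ofLp (LinearMap.congr_fun h (WithLp.toLp 2 v))
  simpa [Matrix.toEuclideanLin] using h2

theorem mem_eigenspace_iff (A : Matrix X X ℝ) (θ : ℝ) (v : X → ℝ) :
    WithLp.toLp 2 v ∈ Module.End.eigenspace (Matrix.toEuclideanLin A) θ ↔ A *ᵥ v = θ • v := by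
  rw [Module.End.mem_eigenspace_iff]
  constructor
  · intro h
    have := congrArg WithLp.ofLp h
    simpa [Matrix.toEuclideanLin] using this
  · intro h
    apply WithLp.ofLp_injective 2
    simpa [Matrix.toEuclideanLin] using h

theorem isPrimitiveIdempotent_primitiveIdempotent {A : Matrix X X ℝ} (hA : A.IsSymm) (θ : ℝ) :
    IsPrimitiveIdempotent A θ (primitiveIdempotent A θ) := by
  have hH : A.IsHermitian := by
    rw [Matrix.IsHermitian, Matrix.conjTranspose_eq_transpose_of_trivial]; exact hA
  have hsymm : (Matrix.toEuclideanLin A).IsSymmetric := Matrix.isSymmetric_toEuclideanLin_iff.mpr hH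
  refine ⟨fun v hv => ?_, fun η hη v hv => ?_⟩
  · rw [primitiveIdempotent_mulVec,
      Submodule.starProjection_eq_self_iff.mpr ((mem_eigenspace_iff A θ v).mpr hv)]
  · rw [primitiveIdempotent_mulVec]
    have : WithLp.toLp 2 v ∈ (Module.End.eigenspace (Matrix.toEuclideanLin A) θ)ᗮ := by
      rw [Submodule.mem_orthogonal]
      intro u hu
      exact hsymm.orthogonalFamily_eigenspaces.pairwise hη
        ((mem_eigenspace_iff A η v).mpr hv) _ hu
    rw [Submodule.starProjection_apply,
      Submodule.orthogonalProjectionOnto_apply_of_mem_orthogonal this]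
    rfl

theorem IsPrimitiveIdempotent.eq {A : Matrix X X ℝ} (hA : A.IsSymm) {θ : ℝ} {E E' : Matrix X X ℝ}
    (hE : IsPrimitiveIdempotent A θ E) (hE' : IsPrimitiveIdempotent A θ E') : E = E' := by
  have hH : A.IsHermitian := by
    rw [Matrix.IsHermitian, Matrix.conjTranspose_eq_transpose_of_trivial]; exact hA
  have hsymm : (Matrix.toEuclideanLin A).IsSymmetric := Matrix.isSymmetric_toEuclideanLin_iff.mpr hH
  have key : Matrix.toEuclideanLin E = Matrix.toEuclideanLin E' := by
    have htop := hsymm.orthogonalComplement_iSup_eigenspaces_eq_bot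
    rw [Submodule.orthogonal_eq_bot_iff] at htop
    ext1 w
    have hw : w ∈ ⨆ μ, Module.End.eigenspace (Matrix.toEuclideanLin A) μ := by
      rw [htop]; trivial
    induction hw using Submodule.iSup_induction' with
    | mem μ w hw =>
      have hv := (mem_eigenspace_iff A μ w.ofLp).mp hw
      apply WithLp.ofLp_injective 2
      by_cases hμ : μ = θ
      · subst hμ
        simp [Matrix.toEuclideanLin, hE.1 _ hv, hE'.1 _ hv]
      · simp [Matrix.toEuclideanLin, hE.2 μ hμ _ hv, hE'.2 μ hμ _ hv]
    | zero => simp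
    | add a b _ _ ha hb => rw [map_add, map_add, ha, hb]
  exact Matrix.toEuclideanLin.injective key

/-- The second largest element `θ₁` of the set `θ₀ > θ₁ > ⋯` of eigenvalues of `A`, where the
eigenvalues are the real roots of the minimal polynomial of `A`. -/
def secondEigenvalue (A : Matrix X X ℝ) : ℝ :=
  sSup {θ : ℝ | (minpoly ℝ A).IsRoot θ ∧ ∃ η : ℝ, (minpoly ℝ A).IsRoot η ∧ θ < η}

/-- The `i`-th dual eigenvalue of the graph `G` with respect to `E`: the scalar `c` such that
`c = |X| * E u v` for all vertices `u`, `v` at distance `i`. -/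
def dualEigenvalue (G : SimpleGraph X) (E : Matrix X X ℝ) (i : ℕ) : ℝ :=
  Classical.epsilon fun c : ℝ => ∀ u v : X, G.dist u v = i → c = (Fintype.card X : ℝ) * E u v

/-- The characteristic vector of a set of vertices. -/
def hat (Ω : Finset X) : X → ℝ := ∑ z ∈ Ω, Pi.single z 1

end General

/-! ### The bilinear forms graph -/

section Bilinear

variable (F : Type*) [Field F] (D N : ℕ)

/-- The vertex set of the bilinear forms graph `H_q(D, N - D)`. -/
abbrev Vert : Type _ := Matrix (Fin D) (Fin (N - D)) F

/-- The bilinear forms graph: two matrices are adjacent when their difference has rank one. -/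
def graph : SimpleGraph (Vert F D N) where
  Adj u v := (u - v).rank = 1
  symm := ⟨fun u v h => by
    have hn : (v - u).rank = (u - v).rank := by
      have hl : (-(u - v)).mulVecLin = -(u - v).mulVecLin := by
        ext w i; simp
      rw [← neg_sub u v, Matrix.rank, Matrix.rank, hl, LinearMap.range_neg]
    exact hn.trans h⟩
  loopless := ⟨fun u h => by simp at h⟩

instance : DecidableRel (graph F D N).Adj := Classical.decRel _

variable [Fintype F] [DecidableEq F]

/-- The primitive idempotent `E` of the bilinear forms graph associated with its second largest
eigenvalue `θ₁`. -/
def idem : Matrix (Vert F D N) (Vert F D N) ℝ :=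
  primitiveIdempotent ((graph F D N).adjMatrix ℝ) (secondEigenvalue ((graph F D N).adjMatrix ℝ))

variable {F D N}

/-- `Γ_i(x)`, the set of vertices at distance `i` from `x`. -/
def sphere (i : ℕ) (x : Vert F D N) : Finset (Vert F D N) :=
  Finset.univ.filter fun z => (graph F D N).dist x z = i

/-- For the vertex `z`, the number of common neighbours of `x` and `z` at distance `i`
from `y`. -/
def common (x y : Vert F D N) (i : ℕ) (z : Vert F D N) : ℕ :=
  (sphere 1 x ∩ sphere 1 z ∩ sphere i y).card

/-- The `y`-partition `O_1, …, O_6` of the local graph `Γ(x)`; the index `i : Fin 6` stands for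
`i + 1`. Here `q = |F|` and `k` is the distance between `x` and `y`, with `2 ≤ k ≤ D - 1`. -/
def part (x y : Vert F D N) : Fin 6 → Finset (Vert F D N) :=
  let q : ℕ := Fintype.card F
  let k : ℕ := (graph F D N).dist x y
  let mid : Finset (Vert F D N) := sphere 1 x ∩ sphere k y
  ![sphere 1 x ∩ sphere (k - 1) y,
    mid.filter fun z =>
      common x y (k - 1) z = 2 * q ^ (k - 1) ∧ common x y (k + 1) z = 0,
    mid.filter fun z =>
      common x y (k - 1) z = 2 * q ^ (k - 1) - 1 ∧ common x y (k + 1) z = 0,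
    mid.filter fun z =>
      common x y (k - 1) z = q ^ (k - 1) ∧ common x y (k + 1) z = q ^ D - q ^ k,
    mid.filter fun z =>
      common x y (k - 1) z = q ^ (k - 1) ∧ common x y (k + 1) z = q ^ (N - D) - q ^ k,
    sphere 1 x ∩ sphere (k + 1) y]

/-- The distance from `y` to the vertices of `O_1, …, O_6`, where `k` is the distance between
`x` and `y`. -/
def partDist (k : ℕ) : Fin 6 → ℕ := ![k - 1, k, k, k, k, k + 1]

/-- `λ_i = |O_i| (θ*_1 - θ*_{k + ε(i)}) / (θ*_0 - θ*_k)`, with `ε = (-1, 0, 0, 0, 0, 1)`. -/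
def lam (x y : Vert F D N) (i : Fin 6) : ℝ :=
  let θs : ℕ → ℝ := dualEigenvalue (graph F D N) (idem F D N)
  let k : ℕ := (graph F D N).dist x y
  ((part x y i).card : ℝ) * (θs 1 - θs (partDist k i)) / (θs 0 - θs k)

/-- The vector `E x̂`. -/
def Ehat (x : Vert F D N) : Vert F D N → ℝ := idem F D N *ᵥ Pi.single x 1

/-- The vector `E O^∨_i`, where `O^∨_i = Ô_i - λ_i x̂`. -/
def EOcheck (x y : Vert F D N) (i : Fin 6) : Vert F D N → ℝ :=
  idem F D N *ᵥ (hat (part x y i) - lam x y i • Pi.single x 1)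

/-- The symmetric part `Sym(S)`. -/
def symPart (x y : Vert F D N) : Submodule ℝ (Vert F D N → ℝ) :=
  Submodule.span ℝ (Set.range (EOcheck x y))

/-- The antisymmetric part `ASym(S)`. -/
def asymPart (x y : Vert F D N) : Submodule ℝ (Vert F D N → ℝ) :=
  Submodule.span ℝ {Ehat x - Ehat y}

/-- The Norton product `u ⋆ v = E (u ∘ v)`, where `∘` is the entrywise product. -/
def norton (u v : Vert F D N → ℝ) : Vert F D N → ℝ := idem F D N *ᵥ (u * v)

end Bilinear

end NortonBilinear

end

open NortonBilinear

/-! The proof is Fourier analysis on the additive group of matrices. Put w = x - y, of rank k, let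
χ_B be the additive character attached to a matrix B, and take transforms with y as origin.
Adjacency depends only on differences, so A acts on transforms by multiplication; the multiplier at
B is θ_r with r = rank B, and it strictly decreases in r. Hence E multiplies by the indicator of
rank B = 1 (`transform_rankIdem`), distance is the rank of the difference, and the dual eigenvalues
coincide with the eigenvalues (`dualEigenvalue_eq_theta`).

On transforms, |X| times the Norton product is a convolution over those C for which C and B - C both
have rank one (`HasRankOneTransform.norton`). If B = ab^T, these C are the matrices ab'^T and a'b^T
other than 0 and B, the multiples of B being of both kinds (`sum_rankOneNbrs`). Every product thus
reduces to elementary sums over vectors.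

The vectors E x̂ and E ŷ have transforms χ_B(w) and 1. For the O_j, factor w = LR through F^k. A
neighbour x + ab^T of x is classified by whether a lies in the column space of L and b in the row
space of R and, if a = Lc and b = dR, by whether c ⬝ d is -1, 0 or something else (`mem_part_in_in`
and its companions). Character sums over these families, with λ_j subtracted, show that the
transform of E O_j^∨ is a real combination of five functions of B: χ_B(w) + 1, the indicators of ⟨B,
w⟩ = 0, wB^T = 0 and w^T B = 0, and the product of the last two (`chi_mul_partSum_sub_lam`). The six
coefficient vectors span ℝ^5 (`exists_sum_smul_partCoeff`), so Sym(S) consists exactly of the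
vectors whose transform is such a combination.

It remains to convolve. Each indicator J satisfies J(C)χ_C(w) = J(C), whence J(C)χ_{B-C}(w) =
J(C)χ_B(w), and χ_B(w) ± 1 comes out of the sum. What is left, the sum of J(C) over C, is a constant
plus multiples of indicators at B. Against χ_B(w) - 1 the indicators at B die and only an eigenvalue
c_j survives, which gives (i) and (ii). Against χ_B(w) + 1 they are doubled, so the result stays in
the five-function space, which gives (iv). The square of χ - 1 is expanded directly for (iii). -/

set_option linter.unusedSectionVars false

open Matrix

namespace NortonBilinear

/-! ### Rank of a matrix after a rank-one perturbation. -/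

section RankFacts

variable {F : Type*} [Field F] {m n κ : Type*} [Fintype m] [Fintype n] [Fintype κ]
  [DecidableEq m] [DecidableEq n] [DecidableEq κ]

theorem rank_add_le (A B : Matrix m n F) : (A + B).rank ≤ A.rank + B.rank := by
  have h : LinearMap.range (A + B).mulVecLin ≤
      LinearMap.range A.mulVecLin ⊔ LinearMap.range B.mulVecLin := by
    rintro _ ⟨v, rfl⟩
    rw [mulVecLin_apply, add_mulVec]
    exact Submodule.add_mem_sup ⟨v, rfl⟩ ⟨v, rfl⟩
  exact (Submodule.finrank_mono h).trans (Submodule.finrank_add_le_finrank_add_finrank _ _)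

theorem rank_neg (A : Matrix m n F) : (-A).rank = A.rank := by
  have hl : (-A).mulVecLin = -A.mulVecLin := by ext w i; simp
  rw [Matrix.rank, Matrix.rank, hl, LinearMap.range_neg]

theorem rank_sub_comm (A B : Matrix m n F) : (A - B).rank = (B - A).rank := by
  rw [← rank_neg, neg_sub]

theorem rank_eq_zero_iff {A : Matrix m n F} : A.rank = 0 ↔ A = 0 := by
  constructor
  · intro h
    have h1 : LinearMap.range A.mulVecLin = ⊥ := Submodule.finrank_eq_zero.mp h
    have h2 : A.mulVecLin = 0 := LinearMap.range_eq_bot.mp h1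
    ext i j
    have := congrFun (LinearMap.congr_fun h2 (Pi.single j 1)) i
    simpa using this
  · rintro rfl; exact rank_zero

/-- Full rank factorization. -/
theorem exists_full_rank_factorization (w : Matrix m n F) :
    ∃ (L : Matrix m (Fin w.rank) F) (R : Matrix (Fin w.rank) n F) (L' : Matrix (Fin w.rank) m F)
      (R' : Matrix n (Fin w.rank) F), w = L * R ∧ L' * L = 1 ∧ R * R' = 1 := by
  let b : Module.Basis (Fin w.rank) F (LinearMap.range w.mulVecLin) := Module.finBasis F _
  let L : Matrix m (Fin w.rank) F := Matrix.of fun i s => (b s : m → F) i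
  let R : Matrix (Fin w.rank) n F := Matrix.of fun s j =>
    b.repr ⟨w.mulVecLin (Pi.single j 1), LinearMap.mem_range_self _ _⟩ s
  have hLv : ∀ v, L *ᵥ v = ((∑ s, v s • b s : LinearMap.range w.mulVecLin) : m → F) := by
    intro v
    ext i
    simp [L, mulVec, dotProduct, mul_comm]
  have hinj : LinearMap.ker L.mulVecLin = ⊥ := by
    rw [LinearMap.ker_eq_bot']
    intro v hv
    rw [mulVecLin_apply, hLv] at hv
    have hv' : (∑ s, v s • b s : LinearMap.range w.mulVecLin) = 0 := Subtype.ext hv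
    ext s
    exact Fintype.linearIndependent_iff.mp b.linearIndependent v hv' s
  obtain ⟨g, hg⟩ := L.mulVecLin.exists_leftInverse_of_injective hinj
  have hL' : LinearMap.toMatrix' g * L = 1 := by
    apply Matrix.toLin'.injective
    rw [toLin'_mul, toLin'_toMatrix', toLin'_one]
    exact hg
  have hw : w = L * R := by
    ext i j
    have h1 : (L *ᵥ (R.col j)) i = w i j := by
      rw [hLv]
      simp [R, col]
    rw [← h1]; rfl
  -- The columns of L form a basis of the range of w; preimages of them under w serve as the columns
  -- of the right inverse of R.
  have hex : ∀ s, ∃ v, w *ᵥ v = L *ᵥ (Pi.single s 1) := by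
    intro s
    obtain ⟨v, hv⟩ := (b s).2
    refine ⟨v, ?_⟩
    rw [hLv]
    rw [mulVecLin_apply] at hv
    rw [hv]
    rw [Finset.sum_eq_single s]
    · rw [Pi.single_eq_same, one_smul]
    · intro t _ ht; rw [Pi.single_eq_of_ne ht, zero_smul]
    · intro h; exact absurd (Finset.mem_univ s) h
  choose v hv using hex
  refine ⟨L, R, LinearMap.toMatrix' g, Matrix.of fun j s => v s j, hw, hL', ?_⟩
  ext i s
  have h1 : R *ᵥ v s = Pi.single s 1 := by
    have h2 : LinearMap.toMatrix' g *ᵥ (L *ᵥ (R *ᵥ v s)) =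
        LinearMap.toMatrix' g *ᵥ (L *ᵥ Pi.single s 1) := by
      rw [mulVec_mulVec (v s) L R, ← hw, hv s]
    rwa [mulVec_mulVec, hL', one_mulVec, mulVec_mulVec, hL', one_mulVec] at h2
  have h2 := congrFun h1 i
  rw [Pi.single_apply] at h2
  rw [one_apply, ← h2]
  rfl

theorem rank_mul_mul {L : Matrix m κ F} {L' : Matrix κ m F} {R : Matrix κ n F} {R' : Matrix n κ F}
    (hL : L' * L = 1) (hR : R * R' = 1) (Y : Matrix κ κ F) : (L * Y * R).rank = Y.rank := by
  apply le_antisymm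
  · exact (rank_mul_le_left _ _).trans (rank_mul_le_right _ _)
  · have h : Y = L' * (L * Y * R) * R' := by
      calc Y = (L' * L) * Y * (R * R') := by rw [hL, hR, Matrix.one_mul, Matrix.mul_one]
        _ = _ := by simp only [Matrix.mul_assoc]
    conv_lhs => rw [h]
    exact (rank_mul_le_left _ _).trans (rank_mul_le_right _ _)

theorem rank_mul_of_inverses {L : Matrix m κ F} {L' : Matrix κ m F} {R : Matrix κ n F}
    {R' : Matrix n κ F} (hL : L' * L = 1) (hR : R * R' = 1) :
    (L * R).rank = Fintype.card κ := by
  have := rank_mul_mul hL hR 1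
  rwa [Matrix.mul_one, rank_one] at this

theorem rank_vecMulVec_eq_one {a : m → F} {b : n → F} (ha : a ≠ 0) (hb : b ≠ 0) :
    (vecMulVec a b).rank = 1 := by
  apply le_antisymm (rank_vecMulVec_le a b)
  rw [Nat.one_le_iff_ne_zero, Ne, rank_eq_zero_iff]
  intro h
  obtain ⟨i, hi⟩ := Function.ne_iff.mp ha
  obtain ⟨j, hj⟩ := Function.ne_iff.mp hb
  exact mul_ne_zero hi hj congr($h i j)

theorem rank_eq_one_iff_exists {u : Matrix m n F} :
    u.rank = 1 ↔ ∃ a b, a ≠ 0 ∧ b ≠ 0 ∧ u = vecMulVec a b := by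
  constructor
  · intro h
    obtain ⟨L, R, -, -, hu, -, -⟩ := exists_full_rank_factorization u
    generalize hr : u.rank = r at L R
    rw [h] at hr
    subst hr
    have hu' : u = vecMulVec (fun i => L i 0) (fun j => R 0 j) := by
      rw [hu]
      ext i j
      simp [mul_apply, vecMulVec_apply]
    refine ⟨_, _, ?_, ?_, hu'⟩
    · intro h0
      have hu0 : u = 0 := by ext i j; rw [hu', vecMulVec_apply, congrFun h0 i]; exact zero_mul _
      rw [hu0, rank_zero] at h
      exact zero_ne_one h
    · intro h0
      have hu0 : u = 0 := by ext i j; rw [hu', vecMulVec_apply, congrFun h0 j]; exact mul_zero _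
      rw [hu0, rank_zero] at h
      exact zero_ne_one h
  · rintro ⟨a, b, ha, hb, rfl⟩
    exact rank_vecMulVec_eq_one ha hb

/-- Sherman–Morrison: the inverse is written down explicitly. -/
theorem rank_one_add_vecMulVec_of_ne {c d : κ → F} (h : 1 + c ⬝ᵥ d ≠ 0) :
    (1 + vecMulVec c d).rank = Fintype.card κ := by
  apply rank_of_isUnit
  refine (isUnit_iff_isUnit_det _).mpr (isUnit_det_of_right_inverse
    (B := 1 - (1 + c ⬝ᵥ d)⁻¹ • vecMulVec c d) ?_)
  have h1 : vecMulVec c d * vecMulVec c d = (c ⬝ᵥ d) • vecMulVec c d := by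
    rw [vecMulVec_mul_vecMulVec, dotProduct_comm]
    ext i j
    simp [vecMulVec_apply]
    try ring
  rw [Matrix.add_mul, Matrix.one_mul, Matrix.mul_sub, Matrix.mul_one, Matrix.mul_smul, h1]
  generalize vecMulVec c d = Y
  have h2 : (1 + c ⬝ᵥ d)⁻¹ • Y + (1 + c ⬝ᵥ d)⁻¹ • (c ⬝ᵥ d) • Y = Y := by
    rw [smul_smul, ← add_smul]
    nth_rewrite 1 [← mul_one (1 + c ⬝ᵥ d)⁻¹]
    rw [← mul_add, inv_mul_cancel₀ h, one_smul]
  nth_rewrite 2 [← h2]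
  abel

/-- The vector c spans a line in the kernel, so the rank drops; it drops by one only, since removing
a matrix of rank at most one restores the identity. -/
theorem rank_one_add_vecMulVec_of_eq {c d : κ → F} (h : 1 + c ⬝ᵥ d = 0) :
    (1 + vecMulVec c d).rank + 1 = Fintype.card κ := by
  have hc : c ≠ 0 := by rintro rfl; simp at h
  apply le_antisymm
  · have h1 : (1 + vecMulVec c d).mulVecLin c = 0 := by
      rw [mulVecLin_apply, add_mulVec, one_mulVec, vecMulVec_mulVec, dotProduct_comm]
      ext i
      simp only [Pi.add_apply, Pi.smul_apply, Pi.zero_apply, MulOpposite.smul_eq_mul_unop,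
        MulOpposite.unop_op]
      linear_combination c i * h
    have h2 := LinearMap.finrank_range_add_finrank_ker (1 + vecMulVec c d).mulVecLin
    rw [Module.finrank_fintype_fun_eq_card] at h2
    have h3 : 0 < Module.finrank F (LinearMap.ker (1 + vecMulVec c d).mulVecLin) := by
      rw [Module.finrank_pos_iff_exists_ne_zero]
      exact ⟨⟨c, h1⟩, fun h4 => hc (congrArg Subtype.val h4)⟩
    rw [← h2]
    exact Nat.add_le_add_left h3 _
  · have h1 := rank_add_le (1 + vecMulVec c d) (-vecMulVec c d)
    rw [add_neg_cancel_right, rank_one, rank_neg] at h1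
    exact h1.trans (Nat.add_le_add_left (rank_vecMulVec_le _ _) _)

/-- The projection 1 - LL' kills the columns of L but not a. Composing it with a coordinate at which
the image of a is nonzero, and rescaling, gives the separating functional. -/
theorem exists_vecMul_eq_zero_dotProduct_eq_one {L : Matrix m κ F} {L' : Matrix κ m F}
    (hL : L' * L = 1) {a : m → F} (ha : ¬ ∃ c, L *ᵥ c = a) :
    ∃ f : m → F, f ᵥ* L = 0 ∧ f ⬝ᵥ a = 1 := by
  have h : a - L *ᵥ (L' *ᵥ a) ≠ 0 := fun h => ha ⟨L' *ᵥ a, (sub_eq_zero.mp h).symm⟩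
  obtain ⟨i, hi⟩ := Function.ne_iff.mp h
  let g : m → F := Pi.single i ((a - L *ᵥ (L' *ᵥ a)) i)⁻¹
  refine ⟨g - g ᵥ* (L * L'), ?_, ?_⟩
  · rw [sub_vecMul, vecMul_vecMul, Matrix.mul_assoc, hL, Matrix.mul_one, sub_self]
  · rw [sub_dotProduct, ← dotProduct_mulVec, ← dotProduct_sub, ← mulVec_mulVec]
    simp only [g, single_dotProduct]
    exact inv_mul_cancel₀ hi

theorem exists_mulVec_eq_zero_dotProduct_eq_one {R : Matrix κ n F} {R' : Matrix n κ F}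
    (hR : R * R' = 1) {b : n → F} (hb : ¬ ∃ d, d ᵥ* R = b) :
    ∃ e : n → F, R *ᵥ e = 0 ∧ b ⬝ᵥ e = 1 := by
  have hR2 : R'ᵀ * Rᵀ = 1 := by rw [← transpose_mul, hR, transpose_one]
  obtain ⟨f, hf, hf2⟩ := exists_vecMul_eq_zero_dotProduct_eq_one hR2 (a := b)
    (by simpa [mulVec_transpose] using hb)
  exact ⟨f, by rwa [vecMul_transpose] at hf, by rwa [dotProduct_comm]⟩

section Update

variable {L : Matrix m κ F} {L' : Matrix κ m F} {R : Matrix κ n F} {R' : Matrix n κ F}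

theorem mul_add_vecMulVec (c d : κ → F) :
    L * R + vecMulVec (L *ᵥ c) (d ᵥ* R) = L * (1 + vecMulVec c d) * R := by
  rw [Matrix.mul_add, Matrix.mul_one, Matrix.add_mul, mul_vecMulVec, vecMulVec_mul]

theorem rank_update_of_ne (hL : L' * L = 1) (hR : R * R' = 1) {c d : κ → F}
    (h : 1 + c ⬝ᵥ d ≠ 0) :
    (L * R + vecMulVec (L *ᵥ c) (d ᵥ* R)).rank = Fintype.card κ := by
  rw [mul_add_vecMulVec, rank_mul_mul hL hR, rank_one_add_vecMulVec_of_ne h]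

theorem rank_update_of_eq (hL : L' * L = 1) (hR : R * R' = 1) {c d : κ → F}
    (h : 1 + c ⬝ᵥ d = 0) :
    (L * R + vecMulVec (L *ᵥ c) (d ᵥ* R)).rank + 1 = Fintype.card κ := by
  rw [mul_add_vecMulVec, rank_mul_mul hL hR, rank_one_add_vecMulVec_of_eq h]

/-- The perturbed matrix is L(R + cb^T). A vector e with Re = 0 and b ⬝ e = 1 corrects R' to a right
inverse of the second factor, so the rank is unchanged. -/
theorem rank_update_of_row_notMem (hL : L' * L = 1) (hR : R * R' = 1) (c : κ → F) {b : n → F}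
    (hb : ¬ ∃ d, d ᵥ* R = b) :
    (L * R + vecMulVec (L *ᵥ c) b).rank = Fintype.card κ := by
  obtain ⟨e, he, he2⟩ := exists_mulVec_eq_zero_dotProduct_eq_one hR hb
  have h1 : L * R + vecMulVec (L *ᵥ c) b = L * (R + vecMulVec c b) := by
    rw [Matrix.mul_add, mul_vecMulVec]
  have h2 : (R + vecMulVec c b) * (R' - vecMulVec e (b ᵥ* R')) = 1 := by
    rw [Matrix.mul_sub, Matrix.add_mul, Matrix.add_mul, hR, mul_vecMulVec, he, zero_vecMulVec,
      vecMulVec_mul, vecMulVec_mul_vecMulVec, he2, one_smul]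
    simp
  rw [h1, rank_mul_of_inverses hL h2]

theorem rank_update_of_col_notMem (hL : L' * L = 1) (hR : R * R' = 1) (d : κ → F) {a : m → F}
    (ha : ¬ ∃ c, L *ᵥ c = a) :
    (L * R + vecMulVec a (d ᵥ* R)).rank = Fintype.card κ := by
  obtain ⟨f, hf, hf2⟩ := exists_vecMul_eq_zero_dotProduct_eq_one hL ha
  have h1 : L * R + vecMulVec a (d ᵥ* R) = (L + vecMulVec a d) * R := by
    rw [Matrix.add_mul, vecMulVec_mul]
  have h2 : (L' - vecMulVec (L' *ᵥ a) f) * (L + vecMulVec a d) = 1 := by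
    rw [Matrix.sub_mul, Matrix.mul_add, Matrix.mul_add, hL, vecMulVec_mul, hf, vecMulVec_zero,
      mul_vecMulVec, vecMulVec_mul_vecMulVec, hf2, one_smul]
    simp
  rw [h1, rank_mul_of_inverses h2 hR]

/-- Appending a to L as a column and b to R as a row gives a factorization through one more
dimension, and separating functionals provide one-sided inverses for both factors. -/
theorem rank_update_of_notMem (hL : L' * L = 1) (hR : R * R' = 1) {a : m → F} {b : n → F}
    (ha : ¬ ∃ c, L *ᵥ c = a) (hb : ¬ ∃ d, d ᵥ* R = b) :
    (L * R + vecMulVec a b).rank = Fintype.card κ + 1 := by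
  obtain ⟨e, he, he2⟩ := exists_mulVec_eq_zero_dotProduct_eq_one hR hb
  obtain ⟨f, hf, hf2⟩ := exists_vecMul_eq_zero_dotProduct_eq_one hL ha
  have h1 : L * R + vecMulVec a b =
      fromCols L (replicateCol Unit a) * fromRows R (replicateRow Unit b) := by
    rw [fromCols_mul_fromRows, vecMulVec_eq Unit]
  have h2 : fromRows (L' - vecMulVec (L' *ᵥ a) f) (replicateRow Unit f) *
      fromCols L (replicateCol Unit a) = 1 := by
    rw [fromRows_mul_fromCols, ← fromBlocks_one]
    congr 1
    · rw [Matrix.sub_mul, hL, vecMulVec_mul, hf, vecMulVec_zero, sub_zero]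
    · rw [← replicateCol_mulVec, sub_mulVec, vecMulVec_mulVec, hf2]
      ext i j; simp
    · rw [← replicateRow_vecMul, hf]; rfl
    · ext i j
      simpa [mul_apply, dotProduct] using hf2
  have h3 : fromRows R (replicateRow Unit b) *
      fromCols (R' - vecMulVec e (b ᵥ* R')) (replicateCol Unit e) = 1 := by
    rw [fromRows_mul_fromCols, ← fromBlocks_one]
    congr 1
    · rw [Matrix.mul_sub, hR, mul_vecMulVec, he, zero_vecMulVec, sub_zero]
    · rw [← replicateCol_mulVec, he]; rfl
    · rw [← replicateRow_vecMul, vecMul_sub, vecMul_vecMulVec, he2]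
      ext i j; simp
    · ext i j
      simpa [mul_apply, dotProduct] using he2
  rw [h1, rank_mul_of_inverses h2 h3, Fintype.card_sum, Fintype.card_unit]

end Update

end RankFacts

/-! ### Sums over rank-one matrices and over common neighbours. -/

section RankOneSums

variable {F : Type*} [Field F] [Fintype F] [DecidableEq F] {m n : Type*} [Fintype m] [Fintype n]
  [DecidableEq m] [DecidableEq n]

variable (F m n) in
/-- The set of matrices of rank one. -/
noncomputable def rankOne : Finset (Matrix m n F) := Finset.univ.filter fun u => u.rank = 1

/-- The matrices `C` of rank one such that `B - C` has rank one. -/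
noncomputable def rankOneNbrs (B : Matrix m n F) : Finset (Matrix m n F) :=
  Finset.univ.filter fun C => C.rank = 1 ∧ (B - C).rank = 1

theorem mem_rankOne {u : Matrix m n F} : u ∈ rankOne F m n ↔ u.rank = 1 := by simp [rankOne]

theorem mem_rankOneNbrs {B C : Matrix m n F} :
    C ∈ rankOneNbrs B ↔ C.rank = 1 ∧ (B - C).rank = 1 := by simp [rankOneNbrs]

/-- The only freedom in the two factors is (ta₀, t⁻¹b₀) with t a unit. -/
theorem card_vecMulVec_fiber {a₀ : m → F} {b₀ : n → F} (ha : a₀ ≠ 0) (hb : b₀ ≠ 0) :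
    (Finset.univ.filter fun p : (m → F) × (n → F) =>
      vecMulVec p.1 p.2 = vecMulVec a₀ b₀).card = Fintype.card F - 1 := by
  obtain ⟨i, hi⟩ := Function.ne_iff.mp ha
  obtain ⟨j, hj⟩ := Function.ne_iff.mp hb
  rw [Pi.zero_apply] at hi hj
  rw [← Fintype.card_units, ← Finset.card_univ]
  symm
  refine Finset.card_bij (fun t _ => ((t : F) • a₀, (t⁻¹ : F) • b₀)) ?_ ?_ ?_
  · intro t _
    rw [Finset.mem_filter]
    refine ⟨Finset.mem_univ _, ?_⟩
    ext i' j'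
    have ht := t.ne_zero
    simp only [vecMulVec_apply, Pi.smul_apply, smul_eq_mul]
    field_simp
  · intro t _ t' _ h
    have := congrFun (congrArg Prod.fst h) i
    exact Units.ext (mul_right_cancel₀ hi this)
  · rintro ⟨a, b⟩ h
    rw [Finset.mem_filter] at h
    have h1 : ∀ i' j', a i' * b j' = a₀ i' * b₀ j' := fun i' j' => congr($(h.2) i' j')
    have hab : a i * b j ≠ 0 := by rw [h1]; exact mul_ne_zero hi hj
    have hai := left_ne_zero_of_mul hab
    have hbj := right_ne_zero_of_mul hab
    refine ⟨Units.mk0 (a i / a₀ i) (div_ne_zero hai hi), Finset.mem_univ _, ?_⟩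
    refine Prod.ext ?_ ?_
    · ext i'
      simp only [Units.val_mk0, Pi.smul_apply, smul_eq_mul]
      rw [div_mul_eq_mul_div, div_eq_iff hi]
      apply mul_right_cancel₀ hbj
      linear_combination a₀ i' * h1 i j - a₀ i * h1 i' j
    · ext j'
      simp only [Units.val_mk0, Pi.smul_apply, smul_eq_mul]
      rw [inv_div, div_mul_eq_mul_div, div_eq_iff hai]
      linear_combination -h1 i j'

theorem sum_sum_vecMulVec (f : Matrix m n F → ℂ) (h0 : f 0 = 0) :
    ∑ a : m → F, ∑ b : n → F, f (vecMulVec a b) =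
      ((Fintype.card F : ℂ) - 1) * ∑ u ∈ rankOne F m n, f u := by
  rw [← Finset.sum_product', Finset.univ_product_univ,
    ← Finset.sum_fiberwise (s := Finset.univ)
      (g := fun p : (m → F) × (n → F) => vecMulVec p.1 p.2), Finset.mul_sum, rankOne,
      Finset.sum_filter]
  refine Finset.sum_congr rfl fun u _ => ?_
  have h1 : ∑ p : (m → F) × (n → F) with vecMulVec p.1 p.2 = u, f (vecMulVec p.1 p.2) =
      ((Finset.univ.filter fun p : (m → F) × (n → F) => vecMulVec p.1 p.2 = u).card : ℂ) * f u := by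
    rw [← nsmul_eq_mul, ← Finset.sum_const]
    refine Finset.sum_congr rfl fun p hp => ?_
    rw [(Finset.mem_filter.mp hp).2]
  rw [h1]
  split_ifs with hu
  · obtain ⟨a, b, ha, hb, rfl⟩ := rank_eq_one_iff_exists.mp hu
    rw [card_vecMulVec_fiber ha hb, Nat.cast_sub Fintype.card_pos, Nat.cast_one]
  · by_cases hu0 : u = 0
    · rw [hu0, h0, mul_zero]
    · rw [Finset.card_eq_zero.mpr, Nat.cast_zero, zero_mul]
      rw [Finset.filter_eq_empty_iff]
      rintro ⟨a, b⟩ - rfl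
      refine hu (rank_vecMulVec_eq_one ?_ ?_)
      · rintro rfl; exact hu0 (by ext i j; simp [vecMulVec_apply])
      · rintro rfl; exact hu0 (by ext i j; simp [vecMulVec_apply])

/-- Such a difference has rank two: apply `rank_update_of_notMem` to a factorization through a
one-dimensional space. Consequently, adjacent rank-one matrices share a column direction or a row
direction. -/
theorem rank_sub_vecMulVec_ne_one {a a₂ : m → F} {b b₂ : n → F} (ha : a ≠ 0) (hb : b ≠ 0)
    (ha₂ : ∀ t : F, t • a ≠ a₂) (hb₂ : ∀ t : F, t • b ≠ b₂) :
    (vecMulVec a b - vecMulVec a₂ b₂).rank ≠ 1 := by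
  obtain ⟨i, hi⟩ := Function.ne_iff.mp ha
  obtain ⟨j, hj⟩ := Function.ne_iff.mp hb
  have hL : replicateRow Unit (Pi.single i (a i)⁻¹ : m → F) * replicateCol Unit a = 1 := by
    ext s t
    simpa [mul_apply, Pi.single_apply] using inv_mul_cancel₀ hi
  have hR : replicateRow Unit b * replicateCol Unit (Pi.single j (b j)⁻¹ : n → F) = 1 := by
    ext s t
    simpa [mul_apply, Pi.single_apply] using mul_inv_cancel₀ hj
  have h := rank_update_of_notMem hL hR (a := -a₂) (b := b₂) ?_ ?_
  · rw [← vecMulVec_eq Unit, neg_vecMulVec, ← sub_eq_add_neg, Fintype.card_unit] at h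
    omega
  · rintro ⟨c, hc⟩
    apply ha₂ (-c ())
    rw [neg_smul, neg_eq_iff_eq_neg, ← hc]
    ext s
    simp [mulVec, dotProduct, mul_comm]
  · rintro ⟨c, hc⟩
    apply hb₂ (c ())
    rw [← hc]
    ext s
    simp [vecMul, dotProduct, mul_comm]

/-- Summation over the common neighbours of `0` and a matrix of rank one. -/
theorem sum_rankOneNbrs {A : Type*} [AddCommMonoid A] (f : Matrix m n F → A) {a : m → F}
    {b : n → F} (ha : a ≠ 0) (hb : b ≠ 0) :
    ∑ C ∈ rankOneNbrs (vecMulVec a b), f C + (f 0 + f (vecMulVec a b)) +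
        ∑ t : F, f (vecMulVec (t • a) b) =
      ∑ b' : n → F, f (vecMulVec a b') + ∑ a' : m → F, f (vecMulVec a' b) := by
  obtain ⟨i, hi⟩ := Function.ne_iff.mp ha
  obtain ⟨j, hj⟩ := Function.ne_iff.mp hb
  rw [Pi.zero_apply] at hi hj
  have inj1 : Function.Injective fun b' : n → F => vecMulVec a b' := by
    intro b₁ b₂ h
    ext j'
    exact mul_left_cancel₀ hi congr($h i j')
  have inj2 : Function.Injective fun a' : m → F => vecMulVec a' b := by
    intro b₁ b₂ h
    ext i'
    exact mul_right_cancel₀ hj congr($h i' j)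
  have inj3 : Function.Injective fun t : F => vecMulVec (t • a) b := by
    intro t₁ t₂ h
    have h1 := congrFun (inj2 h) i
    exact mul_right_cancel₀ hi h1
  have h0 : vecMulVec a (0 : n → F) = 0 := by ext; simp [vecMulVec_apply]
  have h0' : vecMulVec (0 : m → F) b = 0 := by ext; simp [vecMulVec_apply]
  have hu0 : vecMulVec a b ≠ 0 := fun h => hb (inj1 (h.trans h0.symm))
  -- Inclusion–exclusion: the families ab'^T and a'b^T meet in the multiples of ab^T, and their
  -- union is the set of common neighbours together with 0 and ab^T.
  have hinter : Finset.univ.image (fun b' : n → F => vecMulVec a b') ∩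
      Finset.univ.image (fun a' : m → F => vecMulVec a' b) =
      Finset.univ.image fun t : F => vecMulVec (t • a) b := by
    ext C
    simp only [Finset.mem_inter, Finset.mem_image, Finset.mem_univ, true_and]
    constructor
    · rintro ⟨⟨b', rfl⟩, a', h⟩
      have h1 : ∀ i' j', a' i' * b j' = a i' * b' j' := fun i' j' => congr($h i' j')
      refine ⟨b' j / b j, ?_⟩
      rw [← h]
      congr 1
      ext i'
      rw [Pi.smul_apply, smul_eq_mul, div_mul_eq_mul_div, div_eq_iff hj, h1, mul_comm]
    · rintro ⟨t, rfl⟩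
      refine ⟨⟨t • b, ?_⟩, t • a, rfl⟩
      ext i' j'
      simp only [vecMulVec_apply, Pi.smul_apply, smul_eq_mul]
      ring
  have hunion : Finset.univ.image (fun b' : n → F => vecMulVec a b') ∪
      Finset.univ.image (fun a' : m → F => vecMulVec a' b) =
      rankOneNbrs (vecMulVec a b) ∪ {0, vecMulVec a b} := by
    ext C
    simp only [Finset.mem_union, Finset.mem_image, Finset.mem_univ, true_and, mem_rankOneNbrs,
      Finset.mem_insert, Finset.mem_singleton]
    constructor
    · intro hC
      rw [or_iff_not_imp_right]
      intro h
      rcases hC with ⟨b', rfl⟩ | ⟨a', rfl⟩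
      · rw [not_or] at h
        rw [← vecMulVec_sub]
        refine ⟨rank_vecMulVec_eq_one ha ?_, rank_vecMulVec_eq_one ha ?_⟩
        · rintro rfl; exact h.1 h0
        · intro h1; exact h.2 (by rw [sub_eq_zero.mp h1])
      · rw [not_or] at h
        rw [← sub_vecMulVec]
        refine ⟨rank_vecMulVec_eq_one ?_ hb, rank_vecMulVec_eq_one ?_ hb⟩
        · rintro rfl; exact h.1 h0'
        · intro h1; exact h.2 (by rw [sub_eq_zero.mp h1])
    · rintro (⟨h1, h2⟩ | rfl | rfl)
      · obtain ⟨a₂, b₂, -, -, rfl⟩ := rank_eq_one_iff_exists.mp h1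
        by_cases hA : ∃ t : F, t • a = a₂
        · obtain ⟨t, rfl⟩ := hA
          left
          refine ⟨t • b₂, ?_⟩
          ext i' j'
          simp only [vecMulVec_apply, Pi.smul_apply, smul_eq_mul]
          ring
        by_cases hB : ∃ t : F, t • b = b₂
        · obtain ⟨t, rfl⟩ := hB
          right
          refine ⟨t • a₂, ?_⟩
          ext i' j'
          simp only [vecMulVec_apply, Pi.smul_apply, smul_eq_mul]
          ring
        exact absurd h2 (rank_sub_vecMulVec_ne_one ha hb (not_exists.mp hA) (not_exists.mp hB))
      · exact Or.inl ⟨0, h0⟩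
      · exact Or.inl ⟨b, rfl⟩
  have hdisj : Disjoint (rankOneNbrs (vecMulVec a b)) {0, vecMulVec a b} := by
    rw [Finset.disjoint_left]
    intro C hC h
    rw [mem_rankOneNbrs] at hC
    simp only [Finset.mem_insert, Finset.mem_singleton] at h
    rcases h with rfl | rfl
    · rw [rank_zero] at hC; exact zero_ne_one hC.1
    · rw [sub_self, rank_zero] at hC; exact zero_ne_one hC.2
  have key := Finset.sum_union_inter (f := f)
    (s₁ := Finset.univ.image (fun b' : n → F => vecMulVec a b'))
    (s₂ := Finset.univ.image (fun a' : m → F => vecMulVec a' b))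
  rw [hinter, hunion, Finset.sum_union hdisj, Finset.sum_pair hu0.symm,
    Finset.sum_image inj1.injOn, Finset.sum_image inj2.injOn, Finset.sum_image inj3.injOn] at key
  exact key

end RankOneSums

/-! ### Additive characters and exponential sums over bilinear conditions. -/

section Characters

variable {F : Type*} [Field F] [Fintype F] [DecidableEq F] {m n κ ι : Type*} [Fintype m]
  [Fintype n] [Fintype κ] [Fintype ι] [DecidableEq m] [DecidableEq n] [DecidableEq κ]
  [DecidableEq ι]

variable (F) in
theorem exists_addChar_apply_one_ne_one : ∃ ψ : AddChar F ℂ, ψ 1 ≠ 1 :=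
  AddChar.exists_apply_ne_zero.mpr one_ne_zero

variable (F) in
/-- A fixed nontrivial additive character of `F`. -/
noncomputable def fieldChar : AddChar F ℂ := (exists_addChar_apply_one_ne_one F).choose

theorem fieldChar_one_ne_one : fieldChar F 1 ≠ 1 := (exists_addChar_apply_one_ne_one F).choose_spec

theorem fieldChar_isPrimitive : (fieldChar F).IsPrimitive :=
  AddChar.IsPrimitive.of_ne_one fun h => fieldChar_one_ne_one (by rw [h, AddChar.one_apply])

theorem sum_fieldChar_mul (c : F) :
    ∑ t : F, fieldChar F (t * c) = if c = 0 then (Fintype.card F : ℂ) else 0 := by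
  simpa using AddChar.sum_mulShift c (fieldChar_isPrimitive (F := F))

theorem sum_fieldChar_dotProduct (v : κ → F) :
    ∑ c : κ → F, fieldChar F (c ⬝ᵥ v) =
      if v = 0 then (Fintype.card F : ℂ) ^ Fintype.card κ else 0 := by
  split_ifs with h
  · subst h
    simp
  · obtain ⟨i, hi⟩ := Function.ne_iff.mp h
    let φ : AddChar (κ → F) ℂ := (fieldChar F).compAddMonoidHom
      (AddMonoidHom.mk' (fun c : κ → F => c ⬝ᵥ v) fun a b => add_dotProduct a b v)
    have h1 : ∑ c, φ c = 0 := by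
      rw [AddChar.sum_eq_zero_iff_ne_zero]
      intro h2
      -- This test vector has dot product 1 with v, where the fixed character is nontrivial.
      have h3 := DFunLike.congr_fun h2 (Pi.single i (v i)⁻¹)
      apply fieldChar_one_ne_one (F := F)
      rw [← inv_mul_cancel₀ hi]
      simpa [φ] using h3
    exact h1

/-- The standard bilinear pairing on matrices. -/
def pairing (C z : Matrix m n F) : F := ∑ i, ∑ j, C i j * z i j

/-- The additive character of the matrix space attached to `C`. -/
noncomputable def chi (C z : Matrix m n F) : ℂ := fieldChar F (pairing C z)

theorem pairing_comm (C z : Matrix m n F) : pairing C z = pairing z C := by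
  simp only [pairing, mul_comm]

theorem pairing_add_right (C z z' : Matrix m n F) :
    pairing C (z + z') = pairing C z + pairing C z' := by
  simp [pairing, mul_add, Finset.sum_add_distrib]

theorem pairing_zero_right (C : Matrix m n F) : pairing C 0 = 0 := by simp [pairing]

theorem pairing_neg_right (C z : Matrix m n F) : pairing C (-z) = -pairing C z := by
  simp [pairing]

theorem pairing_vecMulVec_right (C : Matrix m n F) (a : m → F) (b : n → F) :
    pairing C (vecMulVec a b) = a ⬝ᵥ C *ᵥ b := by
  simp only [pairing, vecMulVec_apply, dotProduct, mulVec, Finset.mul_sum]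
  refine Finset.sum_congr rfl fun i _ => Finset.sum_congr rfl fun j _ => ?_
  ring

theorem pairing_vecMulVec (α a : m → F) (β b : n → F) :
    pairing (vecMulVec α β) (vecMulVec a b) = (α ⬝ᵥ a) * (β ⬝ᵥ b) := by
  rw [pairing_vecMulVec_right, vecMulVec_mulVec]
  simp only [dotProduct, Pi.smul_apply, MulOpposite.smul_eq_mul_unop, MulOpposite.unop_op,
    Finset.sum_mul]
  refine Finset.sum_congr rfl fun i _ => ?_
  ring

theorem chi_comm (C z : Matrix m n F) : chi C z = chi z C := by rw [chi, chi, pairing_comm]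

theorem chi_add_right (C z z' : Matrix m n F) : chi C (z + z') = chi C z * chi C z' := by
  rw [chi, pairing_add_right, AddChar.map_add_eq_mul]; rfl

theorem chi_add_left (C C' z : Matrix m n F) : chi (C + C') z = chi C z * chi C' z := by
  rw [chi_comm, chi_add_right, chi_comm z, chi_comm z]

@[simp] theorem chi_zero_right (C : Matrix m n F) : chi C 0 = 1 := by
  rw [chi, pairing_zero_right, AddChar.map_zero_eq_one]

@[simp] theorem chi_zero_left (z : Matrix m n F) : chi 0 z = 1 := by
  rw [chi_comm, chi_zero_right]

theorem chi_sub_left (C C' z : Matrix m n F) : chi (C - C') z = chi C z * chi C' (-z) := by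
  rw [sub_eq_add_neg, chi_add_left]
  congr 1
  rw [chi_comm, chi, chi, pairing_neg_right, pairing_neg_right, pairing_comm]

theorem sum_chi (C : Matrix m n F) :
    ∑ z : Matrix m n F, chi C z =
      if C = 0 then (Fintype.card (Matrix m n F) : ℂ) else 0 := by
  split_ifs with h
  · subst h
    simp
  · obtain ⟨i, j, hij⟩ : ∃ i j, C i j ≠ 0 := by
      by_contra! h2
      exact h (by ext i j; exact h2 i j)
    let φ : AddChar (Matrix m n F) ℂ := (fieldChar F).compAddMonoidHom
      (AddMonoidHom.mk' (pairing C) (pairing_add_right C))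
    have h1 : ∑ c, φ c = 0 := by
      rw [AddChar.sum_eq_zero_iff_ne_zero]
      intro h2
      have h3 := DFunLike.congr_fun h2 (vecMulVec (Pi.single i (C i j)⁻¹) (Pi.single j 1))
      apply fieldChar_one_ne_one (F := F)
      rw [← inv_mul_cancel₀ hij]
      simpa [φ, pairing_vecMulVec_right] using h3
    exact h1

/-- Detect γ ⬝ c = 0 by a sum of characters over t; for γ ≠ 0 only t = 0 survives the sum over c.
The leading factor q avoids a division. -/
theorem sum_dotProduct_eq_zero (γ : κ → F) :
    (Fintype.card F : ℂ) * ∑ c : κ → F, (if γ ⬝ᵥ c = 0 then (1 : ℂ) else 0) =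
      if γ = 0 then (Fintype.card F : ℂ) * (Fintype.card F : ℂ) ^ Fintype.card κ
      else (Fintype.card F : ℂ) ^ Fintype.card κ := by
  split_ifs with h
  · subst h; simp
  · have h1 : ∀ c : κ → F, (Fintype.card F : ℂ) * (if γ ⬝ᵥ c = 0 then (1 : ℂ) else 0) =
        ∑ t : F, fieldChar F (c ⬝ᵥ (t • γ)) := by
      intro c
      simp only [dotProduct_smul, smul_eq_mul]
      rw [sum_fieldChar_mul, dotProduct_comm]
      split_ifs <;> simp
    rw [Finset.mul_sum, Finset.sum_congr rfl fun c _ => h1 c, Finset.sum_comm]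
    simp only [sum_fieldChar_dotProduct, smul_eq_zero, h, or_false]
    rw [Finset.sum_ite_eq' Finset.univ (0 : F)]
    simp

/-- The sum over d vanishes unless (γ ⬝ c)δ = 0, which leaves the size of a hyperplane or of the
whole space. -/
theorem sum_sum_fieldChar_mul (γ : κ → F) (δ : ι → F) :
    (Fintype.card F : ℂ) * ∑ c : κ → F, ∑ d : ι → F, fieldChar F ((γ ⬝ᵥ c) * (δ ⬝ᵥ d)) =
      (Fintype.card F : ℂ) ^ Fintype.card κ * (Fintype.card F : ℂ) ^ Fintype.card ι *
        if γ = 0 ∨ δ = 0 then (Fintype.card F : ℂ) else 1 := by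
  have h1 : ∀ c : κ → F, ∑ d : ι → F, fieldChar F ((γ ⬝ᵥ c) * (δ ⬝ᵥ d)) =
      (Fintype.card F : ℂ) ^ Fintype.card ι * if γ ⬝ᵥ c = 0 ∨ δ = 0 then 1 else 0 := by
    intro c
    have h2 : ∀ d : ι → F, (γ ⬝ᵥ c) * (δ ⬝ᵥ d) = d ⬝ᵥ ((γ ⬝ᵥ c) • δ) := by
      intro d; rw [dotProduct_smul, smul_eq_mul, dotProduct_comm d]
    simp only [h2, sum_fieldChar_dotProduct, smul_eq_zero]
    split_ifs <;> simp
  simp only [h1, ← Finset.mul_sum]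
  by_cases hδ : δ = 0
  · simp only [hδ, or_true, if_true, Finset.sum_const, Finset.card_univ, Fintype.card_fun,
      nsmul_eq_mul, mul_one]
    push_cast
    ring
  · simp only [hδ, or_false]
    rw [mul_left_comm, sum_dotProduct_eq_zero]
    split_ifs <;> ring

/-- The number of solutions of `t c + (γ ⬝ c) δ = 0`. -/
theorem sum_smul_add_smul_eq_zero (γ δ : κ → F) {t : F} (ht : t ≠ 0) :
    ∑ c : κ → F, (if t • c + (γ ⬝ᵥ c) • δ = 0 then (1 : ℂ) else 0) =
      if γ ⬝ᵥ δ ≠ 0 ∧ t = -(γ ⬝ᵥ δ) then (Fintype.card F : ℂ) else 1 := by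
  split_ifs with h
  · obtain ⟨h1, rfl⟩ := h
    have hδ : δ ≠ 0 := by rintro rfl; simp at h1
    have h2 : (Finset.univ.filter fun c : κ → F => -(γ ⬝ᵥ δ) • c + (γ ⬝ᵥ c) • δ = 0) =
        Finset.univ.image fun s : F => s • δ := by
      ext c
      simp only [Finset.mem_filter, Finset.mem_univ, true_and, Finset.mem_image]
      constructor
      · intro h3
        refine ⟨(γ ⬝ᵥ c) / (γ ⬝ᵥ δ), ?_⟩
        rw [neg_smul, neg_add_eq_zero] at h3
        rw [div_eq_inv_mul, mul_smul, ← h3, smul_smul, inv_mul_cancel₀ h1, one_smul]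
      · rintro ⟨s, rfl⟩
        rw [dotProduct_smul, smul_smul, smul_eq_mul, ← add_smul]
        convert zero_smul F δ using 2
        ring
    rw [← Finset.sum_filter, h2, Finset.sum_const, Finset.card_image_of_injective _
      (smul_left_injective F hδ), Finset.card_univ, nsmul_eq_mul, mul_one]
  · have h2 : ∀ c : κ → F, t • c + (γ ⬝ᵥ c) • δ = 0 ↔ c = 0 := by
      intro c
      constructor
      · intro h3
        -- Pairing the equation with γ shows that a nonzero solution c forces t = -(γ ⬝ δ).
        have h4 : (t + γ ⬝ᵥ δ) * (γ ⬝ᵥ c) = 0 := by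
          have := congrArg (fun v => γ ⬝ᵥ v) h3
          simp only [dotProduct_add, dotProduct_smul, smul_eq_mul, dotProduct_zero] at this
          linear_combination this
        rcases mul_eq_zero.mp h4 with h5 | h5
        · have h6 : t = -(γ ⬝ᵥ δ) := eq_neg_of_add_eq_zero_left h5
          exact absurd ⟨fun h7 => ht (by rw [h6, h7, neg_zero]), h6⟩ h
        · rw [h5, zero_smul, add_zero, smul_eq_zero] at h3
          exact h3.resolve_left ht
      · rintro rfl; simp
    simp only [h2]
    simp

/-- The sum of a product character over a quadric `c ⬝ d = s`. -/
theorem sum_sum_fieldChar_quadric (γ δ : κ → F) (s : F) :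
    (Fintype.card F : ℂ) * (∑ c : κ → F, ∑ d : κ → F,
        if c ⬝ᵥ d = s then fieldChar F ((γ ⬝ᵥ c) * (δ ⬝ᵥ d)) else 0) =
      (Fintype.card F : ℂ) ^ Fintype.card κ *
        ((Fintype.card F : ℂ) ^ Fintype.card κ / Fintype.card F *
            (if γ = 0 ∨ δ = 0 then (Fintype.card F : ℂ) else 1) +
          ((if s = 0 then (Fintype.card F : ℂ) else 0) - 1) +
          if γ ⬝ᵥ δ = 0 then 0 else ((Fintype.card F : ℂ) - 1) * fieldChar F (s * (γ ⬝ᵥ δ))) := by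
  have hq : (Fintype.card F : ℂ) ≠ 0 := Nat.cast_ne_zero.mpr Fintype.card_ne_zero
  -- The condition c ⬝ d = s is detected by a sum over t, after which the exponent is linear in d
  -- for fixed t and c; summing over d leaves the equation tc + (γ ⬝ c)δ = 0.
  have h1 : ∀ c d : κ → F, (Fintype.card F : ℂ) *
      (if c ⬝ᵥ d = s then fieldChar F ((γ ⬝ᵥ c) * (δ ⬝ᵥ d)) else 0) =
      ∑ t : F, fieldChar F (-(t * s)) * fieldChar F (d ⬝ᵥ (t • c + (γ ⬝ᵥ c) • δ)) := by
    intro c d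
    have h2 : ∀ t : F, fieldChar F (-(t * s)) * fieldChar F (d ⬝ᵥ (t • c + (γ ⬝ᵥ c) • δ)) =
        fieldChar F (t * (c ⬝ᵥ d - s)) * fieldChar F ((γ ⬝ᵥ c) * (δ ⬝ᵥ d)) := by
      intro t
      rw [← AddChar.map_add_eq_mul, ← AddChar.map_add_eq_mul]
      congr 1
      simp only [dotProduct_add, dotProduct_smul, smul_eq_mul]
      rw [dotProduct_comm d c, dotProduct_comm d δ]
      ring
    rw [Finset.sum_congr rfl fun t _ => h2 t, ← Finset.sum_mul, sum_fieldChar_mul]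
    simp only [sub_eq_zero]
    split_ifs <;> simp
  simp only [Finset.mul_sum, h1]
  have h3 : ∑ c : κ → F, ∑ d : κ → F, ∑ t : F,
      fieldChar F (-(t * s)) * fieldChar F (d ⬝ᵥ (t • c + (γ ⬝ᵥ c) • δ)) =
      ∑ t : F, fieldChar F (-(t * s)) * ((Fintype.card F : ℂ) ^ Fintype.card κ *
        ∑ c : κ → F, if t • c + (γ ⬝ᵥ c) • δ = 0 then (1 : ℂ) else 0) := by
    rw [Finset.sum_congr rfl fun c _ => Finset.sum_comm, Finset.sum_comm]
    refine Finset.sum_congr rfl fun t _ => ?_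
    rw [Finset.mul_sum, Finset.mul_sum]
    refine Finset.sum_congr rfl fun c _ => ?_
    rw [← Finset.mul_sum, sum_fieldChar_dotProduct]
    split_ifs <;> simp
  -- The term t = 0 is treated apart: the equation degenerates to γ ⬝ c = 0 or δ = 0.
  have h4 : ∑ c : κ → F, (if (0 : F) • c + (γ ⬝ᵥ c) • δ = 0 then (1 : ℂ) else 0) =
      (Fintype.card F : ℂ) ^ Fintype.card κ / Fintype.card F *
            (if γ = 0 ∨ δ = 0 then (Fintype.card F : ℂ) else 1) := by
    simp only [zero_smul, zero_add, smul_eq_zero]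
    by_cases hδ : δ = 0
    · simp only [hδ, or_true, if_true, Finset.sum_const, Finset.card_univ, Fintype.card_fun,
        nsmul_eq_mul, mul_one]
      push_cast
      field_simp
    · simp only [hδ, or_false]
      apply mul_left_cancel₀ hq
      rw [sum_dotProduct_eq_zero]
      split_ifs <;> field_simp
  have h5 : ∑ t ∈ Finset.univ.erase (0 : F), fieldChar F (-(t * s)) =
      (if s = 0 then (Fintype.card F : ℂ) else 0) - 1 := by
    have h6 := sum_fieldChar_mul (-s)
    simp only [neg_eq_zero] at h6
    rw [← Finset.add_sum_erase _ _ (Finset.mem_univ (0 : F)), zero_mul,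
      AddChar.map_zero_eq_one] at h6
    rw [← h6]
    simp only [mul_neg]
    ring
  rw [h3, ← Finset.add_sum_erase _ _ (Finset.mem_univ (0 : F)), h4, zero_mul, neg_zero,
    AddChar.map_zero_eq_one, one_mul]
  -- For t ≠ 0 only c = 0 solves the equation, except at t = -(γ ⬝ δ), where the q multiples of δ
  -- do; the excess q - 1 is the correction term.
  have h7 : ∀ t ∈ Finset.univ.erase (0 : F), fieldChar F (-(t * s)) *
      ((Fintype.card F : ℂ) ^ Fintype.card κ *
        ∑ c : κ → F, if t • c + (γ ⬝ᵥ c) • δ = 0 then (1 : ℂ) else 0) =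
      (Fintype.card F : ℂ) ^ Fintype.card κ * (fieldChar F (-(t * s)) +
        if t = -(γ ⬝ᵥ δ) then (if γ ⬝ᵥ δ = 0 then 0 else
          ((Fintype.card F : ℂ) - 1) * fieldChar F (s * (γ ⬝ᵥ δ))) else 0) := by
    intro t ht
    rw [sum_smul_add_smul_eq_zero γ δ (Finset.ne_of_mem_erase ht)]
    by_cases h8 : t = -(γ ⬝ᵥ δ)
    · have h9 : γ ⬝ᵥ δ ≠ 0 := fun h => Finset.ne_of_mem_erase ht (by rw [h8, h, neg_zero])
      have h10 : fieldChar F (-(t * s)) = fieldChar F (s * (γ ⬝ᵥ δ)) := by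
        rw [h8]; congr 1; ring
      rw [if_pos ⟨h9, h8⟩, if_pos h8, if_neg h9, h10]
      ring
    · rw [if_neg fun h => h8 h.2, if_neg h8]
      ring
  rw [Finset.sum_congr rfl h7, ← Finset.mul_sum, Finset.sum_add_distrib, h5, Finset.sum_ite_eq']
  have h8 : (if -(γ ⬝ᵥ δ) ∈ Finset.univ.erase (0 : F) then (if γ ⬝ᵥ δ = 0 then 0 else
      ((Fintype.card F : ℂ) - 1) * fieldChar F (s * (γ ⬝ᵥ δ))) else 0) =
      if γ ⬝ᵥ δ = 0 then 0 else ((Fintype.card F : ℂ) - 1) * fieldChar F (s * (γ ⬝ᵥ δ)) := by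
    by_cases h9 : γ ⬝ᵥ δ = 0
    · rw [if_pos h9, ite_self]
    · rw [if_pos]
      simp [h9]
  rw [h8]
  ring

end Characters

/-! ### The Fourier transform on the matrix space. -/

section Transform

variable {F : Type*} [Field F] [Fintype F] [DecidableEq F] {m n : Type*} [Fintype m]
  [Fintype n] [DecidableEq m] [DecidableEq n]

/-- The Fourier transform on the matrix space, based at `y`. -/
noncomputable def transform (y : Matrix m n F) (v : Matrix m n F → ℝ) (C : Matrix m n F) : ℂ :=
  ∑ z, (v z : ℂ) * chi C (z - y)

theorem transform_add (y : Matrix m n F) (u v : Matrix m n F → ℝ) (C : Matrix m n F) :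
    transform y (u + v) C = transform y u C + transform y v C := by
  simp [transform, add_mul, Finset.sum_add_distrib]

theorem transform_smul (y : Matrix m n F) (r : ℝ) (v : Matrix m n F → ℝ) (C : Matrix m n F) :
    transform y (r • v) C = r * transform y v C := by
  simp [transform, mul_assoc, Finset.mul_sum]

theorem transform_sub (y : Matrix m n F) (u v : Matrix m n F → ℝ) (C : Matrix m n F) :
    transform y (u - v) C = transform y u C - transform y v C := by
  simp [transform, sub_mul, Finset.sum_sub_distrib]

theorem transform_single (x y C : Matrix m n F) :
    transform y (Pi.single x 1) C = chi C (x - y) := by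
  rw [transform, Finset.sum_eq_single x]
  · simp
  · intro z _ hz; simp [hz]
  · simp

theorem card_mul_apply_eq_sum_transform (y : Matrix m n F) (v : Matrix m n F → ℝ)
    (z : Matrix m n F) :
    (Fintype.card (Matrix m n F) : ℂ) * v z = ∑ C, transform y v C * chi C (y - z) := by
  simp only [transform, Finset.sum_mul, mul_assoc, ← chi_add_right, sub_add_sub_cancel]
  rw [Finset.sum_comm]
  simp only [← Finset.mul_sum, chi_comm _ (_ - z), sum_chi, sub_eq_zero]
  simp [mul_comm]

theorem transform_injective (y : Matrix m n F) {u v : Matrix m n F → ℝ}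
    (h : ∀ C, transform y u C = transform y v C) : u = v := by
  ext z
  have h1 : (Fintype.card (Matrix m n F) : ℂ) * u z = Fintype.card (Matrix m n F) * v z := by
    simp only [card_mul_apply_eq_sum_transform y, h]
  have h2 : (Fintype.card (Matrix m n F) : ℂ) ≠ 0 := Nat.cast_ne_zero.mpr Fintype.card_ne_zero
  exact_mod_cast mul_left_cancel₀ h2 h1

/-- The product of characters is χ_B(z' - y) χ_C(z - z'), so summing over C forces z = z'. -/
theorem transform_mul (y : Matrix m n F) (u v : Matrix m n F → ℝ) (B : Matrix m n F) :
    (Fintype.card (Matrix m n F) : ℂ) * transform y (u * v) B =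
      ∑ C, transform y u C * transform y v (B - C) := by
  have h1 : ∀ C, transform y u C * transform y v (B - C) =
      ∑ z', ∑ z, ((u z : ℂ) * v z' * chi B (z' - y)) * chi (z - z') C := by
    intro C
    rw [transform, transform, Finset.sum_mul_sum, Finset.sum_comm]
    refine Finset.sum_congr rfl fun z' _ => Finset.sum_congr rfl fun z _ => ?_
    have h2 : chi (z - z') C = chi C (z - y) * chi C (-(z' - y)) := by
      rw [chi_comm, ← chi_add_right]; congr 1; abel
    rw [chi_sub_left, h2]
    ring
  rw [Finset.sum_congr rfl fun C _ => h1 C, Finset.sum_comm, transform, Finset.mul_sum]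
  refine Finset.sum_congr rfl fun z' _ => ?_
  rw [Finset.sum_comm]
  simp only [← Finset.mul_sum, sum_chi, sub_eq_zero]
  simp
  ring

/-- The matrix with entries `e (z - w)`. -/
def diffKernel (e : Matrix m n F → ℝ) : Matrix (Matrix m n F) (Matrix m n F) ℝ :=
  Matrix.of fun z w => e (z - w)

theorem transform_diffKernel_mulVec (y : Matrix m n F) (e v : Matrix m n F → ℝ)
    (C : Matrix m n F) :
    transform y (diffKernel e *ᵥ v) C =
      (∑ u, (e u : ℂ) * chi C u) * transform y v C := by
  have h1 : ∀ w : Matrix m n F, ∑ u, (e u : ℂ) * chi C u = ∑ z, (e (z - w) : ℂ) * chi C (z - w) :=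
    fun w => ((Equiv.subRight w).sum_comp fun u => (e u : ℂ) * chi C u).symm
  rw [transform, transform, Finset.mul_sum]
  simp only [mulVec, dotProduct, diffKernel, of_apply]
  push_cast
  simp only [Finset.sum_mul]
  rw [Finset.sum_comm]
  refine Finset.sum_congr rfl fun w _ => ?_
  rw [← Finset.sum_mul, h1 w, Finset.sum_mul]
  refine Finset.sum_congr rfl fun z _ => ?_
  have h2 : chi C (z - y) = chi C (z - w) * chi C (w - y) := by
    rw [← chi_add_right, sub_add_sub_cancel]
  rw [h2]
  ring

end Transform

/-! ### Spectrum of the graph and the idempotent for θ₁. -/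

section Eigenvalues

variable {F : Type*} [Field F] [Fintype F] [DecidableEq F] {m n : Type*} [Fintype m]
  [Fintype n] [DecidableEq m] [DecidableEq n]

variable (F m n) in
/-- The eigenvalues of the bilinear forms graph. -/
noncomputable def theta (r : ℕ) : ℝ :=
  ((Fintype.card F : ℝ) ^ Fintype.card m * (Fintype.card F : ℝ) ^ Fintype.card n /
    (Fintype.card F : ℝ) ^ r - (Fintype.card F : ℝ) ^ Fintype.card m -
    (Fintype.card F : ℝ) ^ Fintype.card n + 1) / ((Fintype.card F : ℝ) - 1)

variable (F) in
theorem one_lt_card_real : (1 : ℝ) < Fintype.card F := by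
  exact_mod_cast Fintype.one_lt_card (α := F)

variable (F m n) in
theorem theta_strictAnti : StrictAnti (theta F m n) := by
  intro r s h
  have hq := one_lt_card_real F
  have hq0 : (0 : ℝ) < Fintype.card F := by linarith
  rw [theta, theta]
  have h1 : (Fintype.card F : ℝ) ^ r < (Fintype.card F : ℝ) ^ s := pow_lt_pow_right₀ hq h
  have h2 : (Fintype.card F : ℝ) ^ Fintype.card m * (Fintype.card F : ℝ) ^ Fintype.card n /
      (Fintype.card F : ℝ) ^ s < (Fintype.card F : ℝ) ^ Fintype.card m *
      (Fintype.card F : ℝ) ^ Fintype.card n / (Fintype.card F : ℝ) ^ r :=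
    div_lt_div_of_pos_left (by positivity) (by positivity) h1
  apply div_lt_div_of_pos_right _ (by linarith)
  linarith

theorem sum_mulVec_eq_zero (C : Matrix m n F) :
    ∑ b : n → F, (if C *ᵥ b = 0 then (1 : ℂ) else 0) =
      (Fintype.card F : ℂ) ^ Fintype.card n / (Fintype.card F : ℂ) ^ C.rank := by
  have hq : (Fintype.card F : ℂ) ≠ 0 := Nat.cast_ne_zero.mpr Fintype.card_ne_zero
  have h1 := LinearMap.finrank_range_add_finrank_ker C.mulVecLin
  rw [Module.finrank_fintype_fun_eq_card] at h1
  have : Fintype (LinearMap.ker C.mulVecLin) := Fintype.ofFinite _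
  have h2 : Fintype.card (LinearMap.ker C.mulVecLin) =
      Fintype.card F ^ Module.finrank F (LinearMap.ker C.mulVecLin) :=
    Module.card_eq_pow_finrank
  rw [eq_div_iff (pow_ne_zero _ hq), ← h1, pow_add, mul_comm]
  congr 1
  rw [← Nat.cast_pow, ← h2, Finset.sum_boole,
    Fintype.card_of_subtype (Finset.univ.filter fun b => C *ᵥ b = 0)]
  intro b
  simp

/-- Summation over pairs of vectors in terms of matrices of rank one. -/
theorem sum_sum_vecMulVec' (f : Matrix m n F → ℂ) :
    ∑ a : m → F, ∑ b : n → F, f (vecMulVec a b) =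
      ((Fintype.card F : ℂ) - 1) * ∑ u ∈ rankOne F m n, f u +
        ((Fintype.card F : ℂ) ^ Fintype.card m + (Fintype.card F : ℂ) ^ Fintype.card n - 1) *
          f 0 := by
  have h1 := sum_sum_vecMulVec (fun u => f u - if u = 0 then f 0 else 0) (by simp)
  have h2 : ∑ u ∈ rankOne F m n, (f u - if u = 0 then f 0 else 0) =
      ∑ u ∈ rankOne F m n, f u := by
    refine Finset.sum_congr rfl fun u hu => ?_
    rw [if_neg, sub_zero]
    rintro rfl
    rw [mem_rankOne, rank_zero] at hu
    exact zero_ne_one hu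
  have h3 : ∀ (a : m → F) (b : n → F), (if vecMulVec a b = 0 then f 0 else 0) =
      ((if a = 0 then (1 : ℂ) else 0) + (if b = 0 then 1 else 0) -
        (if a = 0 then 1 else 0) * (if b = 0 then 1 else 0)) * f 0 := by
    intro a b
    by_cases ha : a = 0
    · rw [if_pos (by ext; simp [ha, vecMulVec_apply]), if_pos ha]; ring
    by_cases hb : b = 0
    · rw [if_pos (by ext; simp [hb, vecMulVec_apply]), if_pos hb]; ring
    rw [if_neg, if_neg ha, if_neg hb]
    · ring
    · intro h
      have := rank_vecMulVec_eq_one ha hb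
      rw [h, rank_zero] at this
      exact zero_ne_one this
  rw [h2] at h1
  rw [← h1]
  simp only [h3, Finset.sum_sub_distrib, ← Finset.sum_mul, Finset.sum_add_distrib,
    ← Finset.mul_sum, Finset.sum_const, Finset.card_univ, Finset.sum_ite_eq', Finset.mem_univ,
    if_true, Fintype.card_fun, nsmul_eq_mul]
  push_cast
  ring

/-- Pass to pairs (a, b). Summing over a leaves the condition Cb = 0, so only the size of the kernel
of C, hence its rank, matters. This one identity yields both the eigenvalues and, with the roles of
C and u exchanged, the kernel of E. -/
theorem sum_rankOne_chi (C : Matrix m n F) :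
    ∑ u ∈ rankOne F m n, chi C u = (theta F m n C.rank : ℂ) := by
  have hq : (Fintype.card F : ℂ) - 1 ≠ 0 := by
    have := one_lt_card_real F
    have h2 : (Fintype.card F : ℝ) - 1 ≠ 0 := by linarith
    exact_mod_cast h2
  have h1 := sum_sum_vecMulVec' (fun u : Matrix m n F => chi C u)
  simp only [chi, pairing_vecMulVec_right, pairing_zero_right,
    AddChar.map_zero_eq_one] at h1
  rw [Finset.sum_comm] at h1
  have h2 : ∑ b : n → F, (if C *ᵥ b = 0 then (Fintype.card F : ℂ) ^ Fintype.card m else 0) =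
      (Fintype.card F : ℂ) ^ Fintype.card m *
        ((Fintype.card F : ℂ) ^ Fintype.card n / (Fintype.card F : ℂ) ^ C.rank) := by
    rw [← sum_mulVec_eq_zero, Finset.mul_sum]
    refine Finset.sum_congr rfl fun b _ => ?_
    split_ifs <;> simp
  have h3 : ∑ b : n → F, ∑ a : m → F, fieldChar F (a ⬝ᵥ C *ᵥ b) =
      (Fintype.card F : ℂ) ^ Fintype.card m *
        ((Fintype.card F : ℂ) ^ Fintype.card n / (Fintype.card F : ℂ) ^ C.rank) := by
    rw [← h2]
    exact Finset.sum_congr rfl fun b _ => sum_fieldChar_dotProduct _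
  rw [h3] at h1
  rw [theta]
  push_cast
  rw [eq_div_iff hq]
  simp only [chi]
  linear_combination -h1

variable (F m n) in
/-- The adjacency matrix of the bilinear forms graph as a difference kernel. -/
noncomputable def rankAdj : Matrix (Matrix m n F) (Matrix m n F) ℝ :=
  diffKernel fun u => if u.rank = 1 then 1 else 0

variable (F m n) in
/-- The primitive idempotent for `θ₁` as a difference kernel. -/
noncomputable def rankIdem : Matrix (Matrix m n F) (Matrix m n F) ℝ :=
  diffKernel fun u => theta F m n u.rank / (Fintype.card (Matrix m n F) : ℝ)

theorem transform_rankAdj (y : Matrix m n F) (v : Matrix m n F → ℝ) (C : Matrix m n F) :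
    transform y (rankAdj F m n *ᵥ v) C = theta F m n C.rank * transform y v C := by
  rw [rankAdj, transform_diffKernel_mulVec, ← sum_rankOne_chi, rankOne, Finset.sum_filter]
  congr 1
  refine Finset.sum_congr rfl fun u _ => ?_
  split_ifs <;> simp

/-- Expand the kernel by `sum_rankOne_chi` as a sum of characters over rank-one C'. Orthogonality
selects C' = -C, which occurs precisely when C has rank one. -/
theorem transform_rankIdem (y : Matrix m n F) (v : Matrix m n F → ℝ) (C : Matrix m n F) :
    transform y (rankIdem F m n *ᵥ v) C = (if C.rank = 1 then 1 else 0) * transform y v C := by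
  have hX : (Fintype.card (Matrix m n F) : ℂ) ≠ 0 := Nat.cast_ne_zero.mpr Fintype.card_ne_zero
  rw [rankIdem, transform_diffKernel_mulVec]
  congr 1
  have h1 : ∀ u : Matrix m n F,
      ((theta F m n u.rank / (Fintype.card (Matrix m n F) : ℝ) : ℝ) : ℂ) * chi C u =
        ∑ C' ∈ rankOne F m n, (Fintype.card (Matrix m n F) : ℂ)⁻¹ * chi (C' + C) u := by
    intro u
    push_cast
    rw [← sum_rankOne_chi, div_mul_eq_mul_div, Finset.sum_mul, Finset.sum_div]
    refine Finset.sum_congr rfl fun C' _ => ?_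
    rw [chi_add_left, chi_comm u C']
    ring
  rw [Finset.sum_congr rfl fun u _ => h1 u, Finset.sum_comm]
  simp only [← Finset.mul_sum, sum_chi, add_eq_zero_iff_eq_neg, Finset.sum_ite_eq',
    mem_rankOne, rank_neg]
  split_ifs <;> simp [hX]

theorem rankAdj_isPrimitiveIdempotent :
    IsPrimitiveIdempotent (rankAdj F m n) (theta F m n 1) (rankIdem F m n) := by
  -- The transform of an η-eigenvector can be nonzero only at matrices whose multiplier is η.
  have key : ∀ (η : ℝ) (v : Matrix m n F → ℝ), rankAdj F m n *ᵥ v = η • v → ∀ C,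
      theta F m n C.rank = η ∨ transform 0 v C = 0 := by
    intro η v hv C
    have h1 := transform_rankAdj 0 v C
    rw [hv, transform_smul] at h1
    by_cases h2 : transform 0 v C = 0
    · exact Or.inr h2
    · exact Or.inl (by exact_mod_cast (mul_right_cancel₀ h2 h1).symm)
  refine ⟨fun v hv => transform_injective 0 fun C => ?_,
    fun η hη v hv => transform_injective 0 fun C => ?_⟩
  · rw [transform_rankIdem]
    rcases key _ v hv C with h | h
    · rw [(theta_strictAnti F m n).injective h, if_pos rfl, one_mul]
    · rw [h, mul_zero]
  · rw [transform_rankIdem]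
    have h0 : transform 0 (0 : Matrix m n F → ℝ) C = 0 := by simp [transform]
    rw [h0]
    rcases key _ v hv C with h | h
    · rw [if_neg, zero_mul]
      intro h1
      rw [h1] at h
      exact hη h.symm
    · rw [h, mul_zero]

theorem isRoot_minpoly_iff {X : Type*} [Fintype X] [DecidableEq X] (A : Matrix X X ℝ) (η : ℝ) :
    (minpoly ℝ A).IsRoot η ↔ ∃ v : X → ℝ, v ≠ 0 ∧ A *ᵥ v = η • v := by
  rw [← Matrix.minpoly_toLin', ← Module.End.hasEigenvalue_iff_isRoot]
  constructor
  · intro h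
    obtain ⟨v, hv⟩ := h.exists_hasEigenvector
    exact ⟨v, hv.2, by simpa using hv.apply_eq_smul⟩
  · rintro ⟨v, hv, hA⟩
    exact Module.End.hasEigenvalue_of_hasEigenvector
      (x := v) ⟨Module.End.mem_eigenspace_iff.mpr (by simpa using hA), hv⟩

theorem isRoot_minpoly_rankAdj_iff (η : ℝ) :
    (minpoly ℝ (rankAdj F m n)).IsRoot η ↔ ∃ C : Matrix m n F, η = theta F m n C.rank := by
  rw [isRoot_minpoly_iff]
  constructor
  · rintro ⟨v, hv, hA⟩
    obtain ⟨C, hC⟩ : ∃ C, transform 0 v C ≠ 0 := by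
      by_contra! h
      apply hv
      apply transform_injective 0
      intro C
      rw [h C]
      simp [transform]
    refine ⟨C, ?_⟩
    have h1 := transform_rankAdj 0 v C
    rw [hA, transform_smul] at h1
    exact_mod_cast mul_right_cancel₀ hC h1
  · rintro ⟨C, rfl⟩
    -- The real part of a character is a real eigenvector, nonzero because its value at 0 is 1.
    refine ⟨fun z => (chi C z).re, ?_, ?_⟩
    · intro h
      have := congrFun h 0
      simp at this
    · ext z
      have h1 : (rankAdj F m n *ᵥ fun z => (chi C z).re) z =
          (∑ w, (if (z - w).rank = 1 then chi C w else 0)).re := by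
        simp only [mulVec, dotProduct, rankAdj, diffKernel, of_apply, Complex.re_sum]
        refine Finset.sum_congr rfl fun w _ => ?_
        split_ifs <;> simp
      have h2 : ∑ w, (if (z - w).rank = 1 then chi C w else 0) =
          chi C z * (theta F m n C.rank : ℂ) := by
        rw [← sum_rankOne_chi, rankOne, Finset.sum_filter, Finset.mul_sum,
          ← Equiv.sum_comp (Equiv.addLeft z) fun w => if (z - w).rank = 1 then chi C w else 0]
        refine Finset.sum_congr rfl fun u _ => ?_
        rw [Equiv.coe_addLeft, chi_add_right, sub_add_cancel_left, rank_neg]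
        split_ifs <;> simp
      rw [h1, h2, Pi.smul_apply, smul_eq_mul, Complex.re_mul_ofReal, mul_comm]

theorem secondEigenvalue_rankAdj [Nonempty m] [Nonempty n] :
    secondEigenvalue (rankAdj F m n) = theta F m n 1 := by
  have hanti := theta_strictAnti F m n
  apply IsGreatest.csSup_eq
  constructor
  · have h1 : ∃ C : Matrix m n F, C.rank = 1 := by
      refine ⟨vecMulVec (fun _ => 1) (fun _ => 1), rank_vecMulVec_eq_one ?_ ?_⟩
      · exact fun h => one_ne_zero (congrFun h (Classical.arbitrary m))
      · exact fun h => one_ne_zero (congrFun h (Classical.arbitrary n))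
    obtain ⟨C, hC⟩ := h1
    refine ⟨(isRoot_minpoly_rankAdj_iff _).mpr ⟨C, by rw [hC]⟩, theta F m n 0,
      (isRoot_minpoly_rankAdj_iff _).mpr ⟨0, by rw [rank_zero]⟩, hanti zero_lt_one⟩
  · rintro _ ⟨h1, η, h2, hlt⟩
    obtain ⟨C, rfl⟩ := (isRoot_minpoly_rankAdj_iff _).mp h1
    obtain ⟨C', rfl⟩ := (isRoot_minpoly_rankAdj_iff _).mp h2
    exact hanti.antitone (Nat.one_le_iff_ne_zero.mpr fun h0 => by
      rw [hanti.lt_iff_gt, h0] at hlt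
      exact Nat.not_lt_zero _ hlt)

/-- Subtract one column-row product of a full rank factorization. Iterated, this gives a walk whose
length is the rank of the difference. -/
theorem exists_rank_add_one_eq {w : Matrix m n F} {r : ℕ} (hw : w.rank = r + 1) :
    ∃ p : Matrix m n F, p.rank = 1 ∧ (w + p).rank = r := by
  obtain ⟨L, R, L', R', h, hL, hR⟩ := exists_full_rank_factorization w
  let s : Fin w.rank := ⟨0, by omega⟩
  have h1 : 1 + (Pi.single s 1 : Fin w.rank → F) ⬝ᵥ (-Pi.single s 1) = 0 := by
    rw [dotProduct_neg, single_dotProduct, Pi.single_eq_same, mul_one, add_neg_cancel]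
  have h2 := rank_update_of_eq hL hR h1
  rw [← h, Fintype.card_fin] at h2
  have h3 : (w + vecMulVec (L *ᵥ Pi.single s 1) (-Pi.single s 1 ᵥ* R)).rank = r := by omega
  refine ⟨_, le_antisymm (rank_vecMulVec_le _ _) ?_, h3⟩
  have h4 := rank_add_le (w + vecMulVec (L *ᵥ Pi.single s 1) (-Pi.single s 1 ᵥ* R))
    (-vecMulVec (L *ᵥ Pi.single s 1) (-Pi.single s 1 ᵥ* R))
  rw [add_neg_cancel_right, rank_neg, h3] at h4
  omega

theorem exists_rank_eq {r : ℕ} (hm : r ≤ Fintype.card m) (hn : r ≤ Fintype.card n) :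
    ∃ w : Matrix m n F, w.rank = r := by
  obtain ⟨f⟩ : Nonempty (Fin r ↪ m) := Function.Embedding.nonempty_of_card_le (by simpa using hm)
  obtain ⟨g⟩ : Nonempty (Fin r ↪ n) := Function.Embedding.nonempty_of_card_le (by simpa using hn)
  refine ⟨(Matrix.of fun i s => if i = f s then (1 : F) else 0) *
    (Matrix.of fun s j => if j = g s then (1 : F) else 0), ?_⟩
  rw [rank_mul_of_inverses (L' := (Matrix.of fun s i => if i = f s then 1 else 0))
    (R' := (Matrix.of fun j s => if j = g s then 1 else 0)), Fintype.card_fin]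
  · ext s t
    simp [mul_apply, one_apply, eq_comm]
  · ext s t
    simp [mul_apply, one_apply, eq_comm]

end Eigenvalues

/-! ### Distance as rank, and identification of E and of the dual eigenvalues. -/

section Graph

variable {F : Type*} [Field F] {D N : ℕ}

theorem exists_walk_length_eq (r : ℕ) (u v : Vert F D N) (h : (u - v).rank = r)
    [Fintype F] [DecidableEq F] : ∃ p : (graph F D N).Walk u v, p.length = r := by
  induction r generalizing u with
  | zero =>
    have : u = v := sub_eq_zero.mp (rank_eq_zero_iff.mp h)
    subst this
    exact ⟨.nil, rfl⟩
  | succ r ih =>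
    obtain ⟨p, hp, hr⟩ := exists_rank_add_one_eq h
    have hadj : (graph F D N).Adj u (u + p) := by
      change (u - (u + p)).rank = 1
      rw [sub_add_cancel_left, rank_neg, hp]
    obtain ⟨s, hs⟩ := ih (u + p) (by rw [← hr]; congr 1; abel)
    exact ⟨.cons hadj s, by rw [SimpleGraph.Walk.length_cons, hs]⟩

theorem rank_sub_le_length {u v : Vert F D N} (p : (graph F D N).Walk u v) :
    (u - v).rank ≤ p.length := by
  induction p with
  | nil => rw [sub_self, rank_zero]; exact Nat.zero_le _
  | @cons u w v h p ih =>
    have h1 := rank_add_le (u - w) (w - v)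
    rw [sub_add_sub_cancel] at h1
    have h2 : (u - w).rank = 1 := h
    rw [SimpleGraph.Walk.length_cons]
    omega

variable [Fintype F] [DecidableEq F]

theorem dist_eq_rank_sub (u v : Vert F D N) : (graph F D N).dist u v = (u - v).rank := by
  obtain ⟨p, hp⟩ := exists_walk_length_eq _ u v rfl
  apply le_antisymm
  · rw [← hp]; exact SimpleGraph.dist_le p
  · obtain ⟨s, hs⟩ := p.reachable.exists_walk_length_eq_dist
    rw [← hs]; exact rank_sub_le_length s

theorem mem_sphere {i : ℕ} {x z : Vert F D N} : z ∈ sphere i x ↔ (x - z).rank = i := by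
  simp [sphere, dist_eq_rank_sub]

theorem adjMatrix_graph : (graph F D N).adjMatrix ℝ = rankAdj F (Fin D) (Fin (N - D)) := by
  ext z w
  rw [SimpleGraph.adjMatrix_apply]
  simp only [rankAdj, diffKernel, of_apply]
  congr 1

theorem idem_eq_rankIdem (hD : 0 < D) (hN : D < N) :
    idem F D N = rankIdem F (Fin D) (Fin (N - D)) := by
  have : Nonempty (Fin D) := ⟨⟨0, hD⟩⟩
  have : Nonempty (Fin (N - D)) := ⟨⟨0, by omega⟩⟩
  have hs : (rankAdj F (Fin D) (Fin (N - D))).IsSymm := by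
    ext z w
    simp only [transpose_apply, rankAdj, diffKernel, of_apply]
    rw [rank_sub_comm]
  rw [idem, adjMatrix_graph, secondEigenvalue_rankAdj]
  exact (isPrimitiveIdempotent_primitiveIdempotent hs _).eq hs rankAdj_isPrimitiveIdempotent

theorem dualEigenvalue_eq_theta (hD : 0 < D) (hN : 2 * D < N) {i : ℕ} (hi : i ≤ D) :
    dualEigenvalue (graph F D N) (idem F D N) i = theta F (Fin D) (Fin (N - D)) i := by
  have hX : (Fintype.card (Vert F D N) : ℝ) ≠ 0 := Nat.cast_ne_zero.mpr Fintype.card_ne_zero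
  have hE : ∀ u v : Vert F D N, (graph F D N).dist u v = i →
      (Fintype.card (Vert F D N) : ℝ) * idem F D N u v = theta F (Fin D) (Fin (N - D)) i := by
    intro u v h
    rw [dist_eq_rank_sub] at h
    rw [idem_eq_rankIdem hD (by omega)]
    simp only [rankIdem, diffKernel, of_apply]
    rw [h]
    exact mul_div_cancel₀ _ hX
  have hex : ∃ c : ℝ, ∀ u v : Vert F D N, (graph F D N).dist u v = i →
      c = (Fintype.card (Vert F D N) : ℝ) * idem F D N u v := ⟨_, fun u v h => (hE u v h).symm⟩
  -- A pair at distance i must exist, since otherwise the chosen scalar would be unconstrained; this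
  -- is where i ≤ D enters.
  obtain ⟨w, hw⟩ := exists_rank_eq (F := F) (m := Fin D) (n := Fin (N - D)) (r := i)
    (by simpa using hi) (by simp; omega)
  have hd : (graph F D N).dist w 0 = i := by rw [dist_eq_rank_sub, sub_zero, hw]
  rw [dualEigenvalue, Classical.epsilon_spec hex w 0 hd, hE w 0 hd]

end Graph

/-! ### Counting common neighbours by their distance from y. -/

section Counting

variable {F : Type*} [Field F] [Fintype F] [DecidableEq F] {m n : Type*} [Fintype m]
  [Fintype n] [DecidableEq m] [DecidableEq n]

/-- A factorization of `w` through `F ^ k` by a matrix with a left inverse and a matrix with a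
right inverse. -/
structure FullRankFactorization (w : Matrix m n F) (k : ℕ) where
  L : Matrix m (Fin k) F
  R : Matrix (Fin k) n F
  L' : Matrix (Fin k) m F
  R' : Matrix n (Fin k) F
  eq_mul : w = L * R
  left_inv : L' * L = 1
  right_inv : R * R' = 1

theorem nonempty_fullRankFactorization {w : Matrix m n F} {k : ℕ} (hw : w.rank = k) :
    Nonempty (FullRankFactorization w k) := by
  subst hw
  obtain ⟨L, R, L', R', h, hL, hR⟩ := exists_full_rank_factorization w
  exact ⟨⟨L, R, L', R', h, hL, hR⟩⟩

theorem card_dotProduct_eq {k : ℕ} {c : Fin k → F} (hc : c ≠ 0) (hk : 1 ≤ k) (s : F) :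
    ∑ d : Fin k → F, (if c ⬝ᵥ d = s then 1 else 0) = Fintype.card F ^ (k - 1) := by
  have h1 : ∀ d : Fin k → F, (Fintype.card F : ℂ) * (if c ⬝ᵥ d = s then (1 : ℂ) else 0) =
      ∑ t : F, fieldChar F (-(t * s)) * fieldChar F (d ⬝ᵥ (t • c)) := by
    intro d
    have h2 : ∀ t : F, fieldChar F (-(t * s)) * fieldChar F (d ⬝ᵥ (t • c)) =
        fieldChar F (t * (c ⬝ᵥ d - s)) := by
      intro t
      rw [← AddChar.map_add_eq_mul]
      congr 1
      simp only [dotProduct_smul, smul_eq_mul, dotProduct_comm d c]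
      ring
    rw [Finset.sum_congr rfl fun t _ => h2 t, sum_fieldChar_mul]
    simp only [sub_eq_zero]
    split_ifs <;> simp
  have h3 : (Fintype.card F : ℂ) * ∑ d : Fin k → F, (if c ⬝ᵥ d = s then (1 : ℂ) else 0) =
      (Fintype.card F : ℂ) ^ k := by
    rw [Finset.mul_sum, Finset.sum_congr rfl fun d _ => h1 d, Finset.sum_comm]
    simp only [← Finset.mul_sum, sum_fieldChar_dotProduct, smul_eq_zero, hc, or_false]
    rw [Finset.sum_eq_single (0 : F)]
    · simp
    · intro t _ ht; simp [ht]
    · simp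
  have h4 : Fintype.card F * ∑ d : Fin k → F, (if c ⬝ᵥ d = s then 1 else 0) =
      Fintype.card F ^ k := by
    have h5 : ((Fintype.card F * ∑ d : Fin k → F, (if c ⬝ᵥ d = s then 1 else 0) : ℕ) : ℂ) =
        ((Fintype.card F ^ k : ℕ) : ℂ) := by
      push_cast
      exact h3
    exact_mod_cast h5
  apply Nat.eq_of_mul_eq_mul_left (Fintype.card_pos (α := F))
  rw [h4, ← pow_succ', Nat.sub_add_cancel hk]

namespace FullRankFactorization

variable {w : Matrix m n F} {k : ℕ} (f : FullRankFactorization w k)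

theorem L_mulVec_injective : Function.Injective fun c : Fin k → F => f.L *ᵥ c := by
  intro c c' h
  have h1 := congrArg (fun v => f.L' *ᵥ v) h
  simpa [mulVec_mulVec, f.left_inv] using h1

theorem vecMul_R_injective : Function.Injective fun d : Fin k → F => d ᵥ* f.R := by
  intro d d' h
  have h1 := congrArg (fun v => v ᵥ* f.R') h
  simpa [vecMul_vecMul, f.right_inv] using h1

theorem L_mulVec_ne_zero {c : Fin k → F} : f.L *ᵥ c ≠ 0 ↔ c ≠ 0 := by
  rw [not_iff_not]
  constructor
  · intro h; exact f.L_mulVec_injective (h.trans (mulVec_zero f.L).symm)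
  · rintro rfl; exact mulVec_zero _

theorem vecMul_R_ne_zero {d : Fin k → F} : d ᵥ* f.R ≠ 0 ↔ d ≠ 0 := by
  rw [not_iff_not]
  constructor
  · intro h; exact f.vecMul_R_injective (h.trans (zero_vecMul f.R).symm)
  · rintro rfl; exact zero_vecMul _

/-- The vectors outside the column space. -/
def outCol : Finset (m → F) := Finset.univ.filter fun a => ¬ ∃ c, f.L *ᵥ c = a

/-- The vectors outside the row space. -/
def outRow : Finset (n → F) := Finset.univ.filter fun b => ¬ ∃ d, d ᵥ* f.R = b

theorem mem_outCol {a : m → F} : a ∈ f.outCol ↔ ¬ ∃ c, f.L *ᵥ c = a := by simp [outCol]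

theorem mem_outRow {b : n → F} : b ∈ f.outRow ↔ ¬ ∃ d, d ᵥ* f.R = b := by simp [outRow]

theorem ne_zero_of_mem_outCol {a : m → F} (h : a ∈ f.outCol) : a ≠ 0 := by
  rintro rfl
  exact f.mem_outCol.mp h ⟨0, mulVec_zero _⟩

theorem ne_zero_of_mem_outRow {b : n → F} (h : b ∈ f.outRow) : b ≠ 0 := by
  rintro rfl
  exact f.mem_outRow.mp h ⟨0, zero_vecMul _⟩

theorem sum_col {A : Type*} [AddCommMonoid A] (g : (m → F) → A) :
    ∑ a, g a = ∑ c, g (f.L *ᵥ c) + ∑ a ∈ f.outCol, g a := by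
  rw [← Finset.sum_filter_add_sum_filter_not Finset.univ (fun a => ∃ c, f.L *ᵥ c = a) g]
  have h : (Finset.univ.filter fun a => ∃ c, f.L *ᵥ c = a) =
      Finset.univ.image fun c => f.L *ᵥ c := by ext a; simp
  rw [h, Finset.sum_image f.L_mulVec_injective.injOn]
  rfl

theorem sum_row {A : Type*} [AddCommMonoid A] (g : (n → F) → A) :
    ∑ b, g b = ∑ d, g (d ᵥ* f.R) + ∑ b ∈ f.outRow, g b := by
  rw [← Finset.sum_filter_add_sum_filter_not Finset.univ (fun b => ∃ d, d ᵥ* f.R = b) g]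
  have h : (Finset.univ.filter fun b => ∃ d, d ᵥ* f.R = b) =
      Finset.univ.image fun d => d ᵥ* f.R := by ext b; simp
  rw [h, Finset.sum_image f.vecMul_R_injective.injOn]
  rfl

theorem card_outCol : Fintype.card F ^ k + f.outCol.card = Fintype.card F ^ Fintype.card m := by
  have h := f.sum_col fun _ => 1
  simpa using h.symm

theorem card_outRow : Fintype.card F ^ k + f.outRow.card = Fintype.card F ^ Fintype.card n := by
  have h := f.sum_row fun _ => 1
  simpa using h.symm

/-- The perturbation is L(1 + cd^T)R, and the middle factor is singular exactly when c ⬝ d = -1. -/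
theorem rank_in_in (c d : Fin k → F) :
    (w + vecMulVec (f.L *ᵥ c) (d ᵥ* f.R)).rank = if c ⬝ᵥ d = -1 then k - 1 else k := by
  split_ifs with h
  · have h1 := rank_update_of_eq f.left_inv f.right_inv (c := c) (d := d) (by rw [h]; ring)
    rw [← f.eq_mul, Fintype.card_fin] at h1
    omega
  · have h1 := rank_update_of_ne f.left_inv f.right_inv (c := c) (d := d)
      (fun h2 => h (eq_neg_of_add_eq_zero_right h2))
    rwa [← f.eq_mul, Fintype.card_fin] at h1

theorem rank_in_out (c : Fin k → F) {b : n → F} (hb : b ∈ f.outRow) :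
    (w + vecMulVec (f.L *ᵥ c) b).rank = k := by
  have h1 := rank_update_of_row_notMem f.left_inv f.right_inv c (f.mem_outRow.mp hb)
  rwa [← f.eq_mul, Fintype.card_fin] at h1

theorem rank_out_in {a : m → F} (ha : a ∈ f.outCol) (d : Fin k → F) :
    (w + vecMulVec a (d ᵥ* f.R)).rank = k := by
  have h1 := rank_update_of_col_notMem f.left_inv f.right_inv d (f.mem_outCol.mp ha)
  rwa [← f.eq_mul, Fintype.card_fin] at h1

theorem rank_out_out {a : m → F} (ha : a ∈ f.outCol) {b : n → F} (hb : b ∈ f.outRow) :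
    (w + vecMulVec a b).rank = k + 1 := by
  have h1 := rank_update_of_notMem f.left_inv f.right_inv (f.mem_outCol.mp ha)
    (f.mem_outRow.mp hb)
  rwa [← f.eq_mul, Fintype.card_fin] at h1

theorem count_row_in_pred (hk : 1 ≤ k) {c : Fin k → F} (hc : c ≠ 0) :
    ∑ b, (if (w + vecMulVec (f.L *ᵥ c) b).rank = k - 1 then 1 else 0) =
      Fintype.card F ^ (k - 1) := by
  rw [f.sum_row, ← card_dotProduct_eq hc hk (-1), Finset.sum_eq_zero (s := f.outRow), add_zero]
  · refine Finset.sum_congr rfl fun d _ => ?_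
    rw [f.rank_in_in]
    split_ifs <;> first | rfl | omega
  · intro b hb
    rw [f.rank_in_out c hb, if_neg (by omega)]

theorem count_row_in_succ (c : Fin k → F) :
    ∑ b, (if (w + vecMulVec (f.L *ᵥ c) b).rank = k + 1 then 1 else 0) = 0 := by
  rw [f.sum_row, Finset.sum_eq_zero, Finset.sum_eq_zero (s := f.outRow), add_zero]
  · intro b hb
    rw [f.rank_in_out c hb, if_neg (by omega)]
  · intro d _
    rw [f.rank_in_in, if_neg]
    split_ifs <;> omega

theorem count_row_out_pred (hk : 1 ≤ k) {a : m → F} (ha : a ∈ f.outCol) :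
    ∑ b, (if (w + vecMulVec a b).rank = k - 1 then 1 else 0) = 0 := by
  rw [f.sum_row, Finset.sum_eq_zero, Finset.sum_eq_zero (s := f.outRow), add_zero]
  · intro b hb
    rw [f.rank_out_out ha hb, if_neg (by omega)]
  · intro d _
    rw [f.rank_out_in ha, if_neg (by omega)]

theorem count_row_out_succ {a : m → F} (ha : a ∈ f.outCol) :
    ∑ b, (if (w + vecMulVec a b).rank = k + 1 then 1 else 0) = f.outRow.card := by
  rw [f.sum_row, Finset.sum_eq_zero, zero_add, Finset.card_eq_sum_ones]
  · refine Finset.sum_congr rfl fun b hb => ?_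
    rw [f.rank_out_out ha hb, if_pos rfl]
  · intro d _
    rw [f.rank_out_in ha, if_neg (by omega)]

theorem count_col_in_pred (hk : 1 ≤ k) {d : Fin k → F} (hd : d ≠ 0) :
    ∑ a, (if (w + vecMulVec a (d ᵥ* f.R)).rank = k - 1 then 1 else 0) =
      Fintype.card F ^ (k - 1) := by
  rw [f.sum_col, ← card_dotProduct_eq hd hk (-1), Finset.sum_eq_zero (s := f.outCol), add_zero]
  · refine Finset.sum_congr rfl fun c _ => ?_
    rw [f.rank_in_in, dotProduct_comm]
    split_ifs <;> first | rfl | omega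
  · intro a ha
    rw [f.rank_out_in ha, if_neg (by omega)]

theorem count_col_in_succ (d : Fin k → F) :
    ∑ a, (if (w + vecMulVec a (d ᵥ* f.R)).rank = k + 1 then 1 else 0) = 0 := by
  rw [f.sum_col, Finset.sum_eq_zero, Finset.sum_eq_zero (s := f.outCol), add_zero]
  · intro a ha
    rw [f.rank_out_in ha, if_neg (by omega)]
  · intro c _
    rw [f.rank_in_in, if_neg]
    split_ifs <;> omega

theorem count_col_out_pred (hk : 1 ≤ k) {b : n → F} (hb : b ∈ f.outRow) :
    ∑ a, (if (w + vecMulVec a b).rank = k - 1 then 1 else 0) = 0 := by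
  rw [f.sum_col, Finset.sum_eq_zero, Finset.sum_eq_zero (s := f.outCol), add_zero]
  · intro a ha
    rw [f.rank_out_out ha hb, if_neg (by omega)]
  · intro c _
    rw [f.rank_in_out c hb, if_neg (by omega)]

theorem count_col_out_succ {b : n → F} (hb : b ∈ f.outRow) :
    ∑ a, (if (w + vecMulVec a b).rank = k + 1 then 1 else 0) = f.outCol.card := by
  rw [f.sum_col, Finset.sum_eq_zero, zero_add, Finset.card_eq_sum_ones]
  · refine Finset.sum_congr rfl fun a ha => ?_
    rw [f.rank_out_out ha hb, if_pos rfl]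
  · intro c _
    rw [f.rank_in_out c hb, if_neg (by omega)]

end FullRankFactorization

/-- The number of common neighbours `u'` of `0` and `u` for which `w + u'` has rank `i`. -/
noncomputable def nbrCount (w u : Matrix m n F) (i : ℕ) : ℕ :=
  ((rankOneNbrs u).filter fun u' => (w + u').rank = i).card

/-- This is `sum_rankOneNbrs` for a rank indicator; the two rank hypotheses remove the contributions
of 0 and of ab^T itself. -/
theorem nbrCount_add {w : Matrix m n F} {a : m → F} {b : n → F} (ha : a ≠ 0) (hb : b ≠ 0) {i : ℕ}
    (hw : w.rank ≠ i) (hu : (w + vecMulVec a b).rank ≠ i) :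
    nbrCount w (vecMulVec a b) i + ∑ t : F, (if (w + vecMulVec (t • a) b).rank = i then 1 else 0) =
      ∑ b', (if (w + vecMulVec a b').rank = i then 1 else 0) +
        ∑ a', (if (w + vecMulVec a' b).rank = i then 1 else 0) := by
  rw [← sum_rankOneNbrs (fun u' => if (w + u').rank = i then 1 else 0) ha hb, add_zero w,
    if_neg hw, if_neg hu, nbrCount, Finset.card_filter, add_zero, add_zero]

namespace FullRankFactorization

variable {w : Matrix m n F} {k : ℕ} (f : FullRankFactorization w k)

theorem rank_eq (f : FullRankFactorization w k) : w.rank = k := by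
  have := rank_mul_of_inverses f.left_inv f.right_inv
  rwa [← f.eq_mul, Fintype.card_fin] at this

/-- The row and column families each contribute q^(k-1). A multiple t of the matrix is counted twice
when t(c ⬝ d) = -1, which has one solution if c ⬝ d ≠ 0 and none otherwise; this separates O₂ from
O₃. -/
theorem nbrCount_in_in_pred (hk : 1 ≤ k) {c d : Fin k → F} (hc : c ≠ 0) (hd : d ≠ 0)
    (hcd : c ⬝ᵥ d ≠ -1) :
    nbrCount w (vecMulVec (f.L *ᵥ c) (d ᵥ* f.R)) (k - 1) + (if c ⬝ᵥ d = 0 then 0 else 1) =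
      2 * Fintype.card F ^ (k - 1) := by
  have h := nbrCount_add (f.L_mulVec_ne_zero.mpr hc) (f.vecMul_R_ne_zero.mpr hd) (w := w)
    (i := k - 1) (by rw [f.rank_eq]; omega) (by rw [f.rank_in_in, if_neg hcd]; omega)
  rw [f.count_row_in_pred hk hc, f.count_col_in_pred hk hd] at h
  have h1 : ∑ t : F, (if (w + vecMulVec (t • f.L *ᵥ c) (d ᵥ* f.R)).rank = k - 1 then 1 else 0) =
      if c ⬝ᵥ d = 0 then 0 else 1 := by
    have h2 : ∀ t : F, (if (w + vecMulVec (t • f.L *ᵥ c) (d ᵥ* f.R)).rank = k - 1 then 1 else 0) =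
        if t * (c ⬝ᵥ d) = -1 then 1 else 0 := by
      intro t
      rw [← mulVec_smul, f.rank_in_in, smul_dotProduct, smul_eq_mul]
      split_ifs <;> first | rfl | omega
    rw [Finset.sum_congr rfl fun t _ => h2 t]
    split_ifs with h3
    · simp [h3]
    · have h4 : ∀ t : F, t * (c ⬝ᵥ d) = -1 ↔ t = -1 / (c ⬝ᵥ d) := fun t => (eq_div_iff h3).symm
      simp [h4]
  rw [h1] at h
  omega

theorem nbrCount_in_in_succ {c d : Fin k → F} (hc : c ≠ 0) (hd : d ≠ 0) :
    nbrCount w (vecMulVec (f.L *ᵥ c) (d ᵥ* f.R)) (k + 1) = 0 := by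
  have h := nbrCount_add (f.L_mulVec_ne_zero.mpr hc) (f.vecMul_R_ne_zero.mpr hd) (w := w)
    (i := k + 1) (by rw [f.rank_eq]; omega) (by rw [f.rank_in_in]; split_ifs <;> omega)
  rw [f.count_row_in_succ, f.count_col_in_succ] at h
  omega

theorem nbrCount_in_out_pred (hk : 1 ≤ k) {c : Fin k → F} (hc : c ≠ 0) {b : n → F}
    (hb : b ∈ f.outRow) :
    nbrCount w (vecMulVec (f.L *ᵥ c) b) (k - 1) = Fintype.card F ^ (k - 1) := by
  have h := nbrCount_add (f.L_mulVec_ne_zero.mpr hc) (f.ne_zero_of_mem_outRow hb) (w := w)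
    (i := k - 1) (by rw [f.rank_eq]; omega) (by rw [f.rank_in_out c hb]; omega)
  rw [f.count_row_in_pred hk hc, f.count_col_out_pred hk hb, Finset.sum_eq_zero] at h
  · omega
  · intro t _
    rw [← mulVec_smul, f.rank_in_out _ hb, if_neg (by omega)]

theorem nbrCount_in_out_succ {c : Fin k → F} (hc : c ≠ 0) {b : n → F} (hb : b ∈ f.outRow) :
    nbrCount w (vecMulVec (f.L *ᵥ c) b) (k + 1) = f.outCol.card := by
  have h := nbrCount_add (f.L_mulVec_ne_zero.mpr hc) (f.ne_zero_of_mem_outRow hb) (w := w)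
    (i := k + 1) (by rw [f.rank_eq]; omega) (by rw [f.rank_in_out c hb]; omega)
  rw [f.count_row_in_succ, f.count_col_out_succ hb, Finset.sum_eq_zero] at h
  · omega
  · intro t _
    rw [← mulVec_smul, f.rank_in_out _ hb, if_neg (by omega)]

theorem nbrCount_out_in_pred (hk : 1 ≤ k) {a : m → F} (ha : a ∈ f.outCol) {d : Fin k → F}
    (hd : d ≠ 0) :
    nbrCount w (vecMulVec a (d ᵥ* f.R)) (k - 1) = Fintype.card F ^ (k - 1) := by
  have h := nbrCount_add (f.ne_zero_of_mem_outCol ha) (f.vecMul_R_ne_zero.mpr hd) (w := w)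
    (i := k - 1) (by rw [f.rank_eq]; omega) (by rw [f.rank_out_in ha]; omega)
  rw [f.count_row_out_pred hk ha, f.count_col_in_pred hk hd, Finset.sum_eq_zero] at h
  · omega
  · intro t _
    rw [smul_vecMulVec, ← vecMulVec_smul, ← smul_vecMul, f.rank_out_in ha, if_neg (by omega)]

theorem nbrCount_out_in_succ {a : m → F} (ha : a ∈ f.outCol) {d : Fin k → F}
    (hd : d ≠ 0) :
    nbrCount w (vecMulVec a (d ᵥ* f.R)) (k + 1) = f.outRow.card := by
  have h := nbrCount_add (f.ne_zero_of_mem_outCol ha) (f.vecMul_R_ne_zero.mpr hd) (w := w)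
    (i := k + 1) (by rw [f.rank_eq]; omega) (by rw [f.rank_out_in ha]; omega)
  rw [f.count_row_out_succ ha, f.count_col_in_succ, Finset.sum_eq_zero] at h
  · omega
  · intro t _
    rw [smul_vecMulVec, ← vecMulVec_smul, ← smul_vecMul, f.rank_out_in ha, if_neg (by omega)]

end FullRankFactorization

end Counting

/-! ### The sets O_j in coordinates. -/

section Parts

variable {F : Type*} [Field F] [Fintype F] [DecidableEq F] {D N : ℕ}

theorem mem_sphere_one_add {x u : Vert F D N} : x + u ∈ sphere 1 x ↔ u.rank = 1 := by
  rw [mem_sphere, sub_add_cancel_left, rank_neg]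

theorem mem_sphere_add {x y u : Vert F D N} {i : ℕ} :
    x + u ∈ sphere i y ↔ (x - y + u).rank = i := by
  rw [mem_sphere, rank_sub_comm, add_sub_right_comm]

/-- Translation by x turns common neighbours of x and x + u into common neighbours of 0 and u. -/
theorem common_add (x y u : Vert F D N) (i : ℕ) :
    common x y i (x + u) = nbrCount (x - y) u i := by
  rw [common, nbrCount]
  symm
  refine Finset.card_bij (fun u' _ => x + u') ?_ ?_ ?_
  · intro u' h
    rw [Finset.mem_filter, mem_rankOneNbrs] at h
    rw [Finset.mem_inter, Finset.mem_inter, mem_sphere_one_add,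
      mem_sphere_add (y := y), mem_sphere,
      add_sub_add_left_eq_sub]
    exact ⟨h.1, h.2⟩
  · intro u' _ u'' _ h
    exact add_left_cancel h
  · intro z h
    refine ⟨z - x, ?_, add_sub_cancel _ _⟩
    rw [← add_sub_cancel x z, Finset.mem_inter, Finset.mem_inter, mem_sphere_one_add,
      mem_sphere_add (y := y), mem_sphere, add_sub_add_left_eq_sub] at h
    rw [Finset.mem_filter, mem_rankOneNbrs]
    exact ⟨h.1, h.2⟩

variable {x y : Vert F D N} {k : ℕ}

theorem rank_eq_one_of_mem_part {u : Vert F D N} {j : Fin 6} (h : x + u ∈ part x y j) :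
    u.rank = 1 := by
  rw [← mem_sphere_one_add (x := x)]
  fin_cases j <;> simp [part] at h <;> tauto

theorem mem_part_zero (hk : (x - y).rank = k) {u : Vert F D N} :
    x + u ∈ part x y 0 ↔ u.rank = 1 ∧ (x - y + u).rank = k - 1 := by
  simp [part, mem_sphere_add, dist_eq_rank_sub, hk]

theorem mem_part_five (hk : (x - y).rank = k) {u : Vert F D N} :
    x + u ∈ part x y 5 ↔ u.rank = 1 ∧ (x - y + u).rank = k + 1 := by
  simp [part, mem_sphere_add, dist_eq_rank_sub, hk]

theorem mem_part_one (hk : (x - y).rank = k) {u : Vert F D N} :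
    x + u ∈ part x y 1 ↔ (u.rank = 1 ∧ (x - y + u).rank = k) ∧
      nbrCount (x - y) u (k - 1) = 2 * Fintype.card F ^ (k - 1) ∧
        nbrCount (x - y) u (k + 1) = 0 := by
  simp [part, mem_sphere_add, dist_eq_rank_sub, hk, common_add]

theorem mem_part_two (hk : (x - y).rank = k) {u : Vert F D N} :
    x + u ∈ part x y 2 ↔ (u.rank = 1 ∧ (x - y + u).rank = k) ∧
      nbrCount (x - y) u (k - 1) = 2 * Fintype.card F ^ (k - 1) - 1 ∧
        nbrCount (x - y) u (k + 1) = 0 := by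
  simp [part, mem_sphere_add, dist_eq_rank_sub, hk, common_add]

theorem mem_part_three (hk : (x - y).rank = k) {u : Vert F D N} :
    x + u ∈ part x y 3 ↔ (u.rank = 1 ∧ (x - y + u).rank = k) ∧
      nbrCount (x - y) u (k - 1) = Fintype.card F ^ (k - 1) ∧
        nbrCount (x - y) u (k + 1) = Fintype.card F ^ D - Fintype.card F ^ k := by
  simp [part, mem_sphere_add, dist_eq_rank_sub, hk, common_add]

theorem mem_part_four (hk : (x - y).rank = k) {u : Vert F D N} :
    x + u ∈ part x y 4 ↔ (u.rank = 1 ∧ (x - y + u).rank = k) ∧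
      nbrCount (x - y) u (k - 1) = Fintype.card F ^ (k - 1) ∧
        nbrCount (x - y) u (k + 1) = Fintype.card F ^ (N - D) - Fintype.card F ^ k := by
  simp [part, mem_sphere_add, dist_eq_rank_sub, hk, common_add]

variable (f : FullRankFactorization (x - y) k)

theorem mem_part_out_out (hk : 1 ≤ k) {a : Fin D → F} (ha : a ∈ f.outCol)
    {b : Fin (N - D) → F} (hb : b ∈ f.outRow) (j : Fin 6) : x + vecMulVec a b ∈ part x y j ↔ j = 5 := by
  have h1 := rank_vecMulVec_eq_one (f.ne_zero_of_mem_outCol ha) (f.ne_zero_of_mem_outRow hb)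
  have h2 := f.rank_out_out ha hb
  have h3 : ¬ k + 1 = k - 1 := by omega
  fin_cases j <;> simp [mem_part_zero f.rank_eq, mem_part_one f.rank_eq, mem_part_two f.rank_eq,
    mem_part_three f.rank_eq, mem_part_four f.rank_eq, mem_part_five f.rank_eq, h1, h2, h3]

theorem outCol_card_eq : f.outCol.card = Fintype.card F ^ D - Fintype.card F ^ k := by
  have := f.card_outCol
  rw [Fintype.card_fin] at this
  omega

theorem outRow_card_eq : f.outRow.card = Fintype.card F ^ (N - D) - Fintype.card F ^ k := by
  have := f.card_outRow
  rw [Fintype.card_fin] at this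
  omega

theorem part_pow_lt {i j : ℕ} (h : i < j) : Fintype.card F ^ i < Fintype.card F ^ j :=
  Nat.pow_lt_pow_right Fintype.one_lt_card h

theorem mem_part_in_out (hk : 1 ≤ k) (hkD : k < D) (hDN : D < N - D) (c : Fin k → F)
    {b : Fin (N - D) → F} (hb : b ∈ f.outRow) (j : Fin 6) :
    x + vecMulVec (f.L *ᵥ c) b ∈ part x y j ↔ c ≠ 0 ∧ j = 3 := by
  by_cases hc : c = 0
  · refine iff_of_false (fun h => ?_) (fun h => h.1 hc)
    have h1 := rank_eq_one_of_mem_part h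
    have h0 : vecMulVec (f.L *ᵥ c) b = 0 := by
      rw [hc, mulVec_zero]; ext; simp [vecMulVec_apply]
    rw [h0, rank_zero] at h1
    exact zero_ne_one h1
  have h1 := rank_vecMulVec_eq_one (f.L_mulVec_ne_zero.mpr hc) (f.ne_zero_of_mem_outRow hb)
  have h2 := f.rank_in_out c hb
  have h3 := f.nbrCount_in_out_pred hk hc hb
  have h4 := f.nbrCount_in_out_succ hc hb
  rw [outCol_card_eq] at h4
  have h5 := part_pow_lt (F := F) hkD
  have h6 := part_pow_lt (F := F) hDN
  have h7 : ¬ k = k - 1 := by omega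
  have h8 : ¬ Fintype.card F ^ D - Fintype.card F ^ k = 0 := by omega
  -- The inequality D < N - D keeps the fourth and fifth sets apart, and k < D keeps both apart from
  -- the second and third.
  have h9 : ¬ Fintype.card F ^ D - Fintype.card F ^ k =
    Fintype.card F ^ (N - D) - Fintype.card F ^ k := by omega
  fin_cases j <;> simp only [mem_part_zero f.rank_eq, mem_part_one f.rank_eq,
    mem_part_two f.rank_eq, mem_part_three f.rank_eq, mem_part_four f.rank_eq,
    mem_part_five f.rank_eq, h1, h2, h3, h4, h7, h8, h9, Fin.mk_one, Fin.zero_eta,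
    Fin.reduceFinMk] <;> simp [hc]

theorem mem_part_out_in (hk : 1 ≤ k) (hkD : k < D) (hDN : D < N - D) {a : Fin D → F}
    (ha : a ∈ f.outCol) (d : Fin k → F) (j : Fin 6) :
    x + vecMulVec a (d ᵥ* f.R) ∈ part x y j ↔ d ≠ 0 ∧ j = 4 := by
  by_cases hd : d = 0
  · refine iff_of_false (fun h => ?_) (fun h => h.1 hd)
    have h1 := rank_eq_one_of_mem_part h
    have h0 : vecMulVec a (d ᵥ* f.R) = 0 := by
      rw [hd, zero_vecMul]; ext; simp [vecMulVec_apply]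
    rw [h0, rank_zero] at h1
    exact zero_ne_one h1
  have h1 := rank_vecMulVec_eq_one (f.ne_zero_of_mem_outCol ha) (f.vecMul_R_ne_zero.mpr hd)
  have h2 := f.rank_out_in ha d
  have h3 := f.nbrCount_out_in_pred hk ha hd
  have h4 := f.nbrCount_out_in_succ ha hd
  rw [outRow_card_eq] at h4
  have h5 := part_pow_lt (F := F) hkD
  have h6 := part_pow_lt (F := F) hDN
  have h7 : ¬ k = k - 1 := by omega
  have h8 : ¬ Fintype.card F ^ (N - D) - Fintype.card F ^ k = 0 := by omega
  have h9 : ¬ Fintype.card F ^ (N - D) - Fintype.card F ^ k =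
    Fintype.card F ^ D - Fintype.card F ^ k := by omega
  fin_cases j <;> simp only [mem_part_zero f.rank_eq, mem_part_one f.rank_eq,
    mem_part_two f.rank_eq, mem_part_three f.rank_eq, mem_part_four f.rank_eq,
    mem_part_five f.rank_eq, h1, h2, h3, h4, h7, h8, h9, Fin.mk_one, Fin.zero_eta,
    Fin.reduceFinMk] <;> simp [hd]

theorem mem_part_in_in (hk : 1 ≤ k) (hkD : k < D) (hDN : D < N - D)
    (c d : Fin k → F) (j : Fin 6) :
    x + vecMulVec (f.L *ᵥ c) (d ᵥ* f.R) ∈ part x y j ↔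
      (j = 0 ∧ c ⬝ᵥ d = -1) ∨ (j = 1 ∧ (c ≠ 0 ∧ d ≠ 0) ∧ c ⬝ᵥ d = 0) ∨
        (j = 2 ∧ c ⬝ᵥ d ≠ 0 ∧ c ⬝ᵥ d ≠ -1) := by
  by_cases hcd : c = 0 ∨ d = 0
  · have h0 : vecMulVec (f.L *ᵥ c) (d ᵥ* f.R) = 0 := by
      rcases hcd with h | h
      · rw [h, mulVec_zero]; ext; simp [vecMulVec_apply]
      · rw [h, zero_vecMul]; ext; simp [vecMulVec_apply]
    have h2 : c ⬝ᵥ d = 0 := by rcases hcd with h | h <;> simp [h]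
    refine iff_of_false (fun h => ?_) ?_
    · have h1 := rank_eq_one_of_mem_part h
      rw [h0, rank_zero] at h1
      exact zero_ne_one h1
    · rw [h2]
      simp only [ne_eq]
      have : ¬ (0 : F) = -1 := by simp
      tauto
  rw [not_or] at hcd
  obtain ⟨hc, hd⟩ := hcd
  have h1 := rank_vecMulVec_eq_one (f.L_mulVec_ne_zero.mpr hc) (f.vecMul_R_ne_zero.mpr hd)
  have h2 := f.rank_in_in c d
  have h7 : ¬ k - 1 = k := by omega
  have h8 : ¬ k - 1 = k + 1 := by omega
  have h10 : ¬ k = k - 1 := by omega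
  have h11 : ¬ (-1 : F) = 0 := by simp
  by_cases hm : c ⬝ᵥ d = -1
  · rw [if_pos hm] at h2
    fin_cases j <;> simp only [mem_part_zero f.rank_eq, mem_part_one f.rank_eq,
      mem_part_two f.rank_eq, mem_part_three f.rank_eq, mem_part_four f.rank_eq,
      mem_part_five f.rank_eq, h1, h2, h7, h8, hm, Fin.mk_one, Fin.zero_eta,
      Fin.reduceFinMk] <;> simp
  · rw [if_neg hm] at h2
    have h3 := f.nbrCount_in_in_pred hk hc hd hm
    have h4 := f.nbrCount_in_in_succ hc hd
    have h5 := part_pow_lt (F := F) hkD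
    have h6 := part_pow_lt (F := F) hDN
    have h9 : 0 < Fintype.card F ^ (k - 1) := Nat.pow_pos Fintype.card_pos
    have h12 : ¬ 0 = Fintype.card F ^ D - Fintype.card F ^ k := by omega
    have h13 : ¬ 0 = Fintype.card F ^ (N - D) - Fintype.card F ^ k := by omega
    by_cases h0 : c ⬝ᵥ d = 0
    · rw [if_pos h0, add_zero] at h3
      have h14 : ¬ 2 * Fintype.card F ^ (k - 1) = 2 * Fintype.card F ^ (k - 1) - 1 := by omega
      fin_cases j <;> simp only [mem_part_zero f.rank_eq, mem_part_one f.rank_eq,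
        mem_part_two f.rank_eq, mem_part_three f.rank_eq, mem_part_four f.rank_eq,
        mem_part_five f.rank_eq, h1, h2, h3, h4, h10, h12, h13, h14, h0, Fin.mk_one,
        Fin.zero_eta, Fin.reduceFinMk] <;> simp [hc, hd]
    · rw [if_neg h0] at h3
      have h15 : nbrCount (x - y) (vecMulVec (f.L *ᵥ c) (d ᵥ* f.R)) (k - 1) =
        2 * Fintype.card F ^ (k - 1) - 1 := by omega
      have h14 : ¬ 2 * Fintype.card F ^ (k - 1) - 1 = 2 * Fintype.card F ^ (k - 1) := by omega
      fin_cases j <;> simp only [mem_part_zero f.rank_eq, mem_part_one f.rank_eq,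
        mem_part_two f.rank_eq, mem_part_three f.rank_eq, mem_part_four f.rank_eq,
        mem_part_five f.rank_eq, h1, h2, h15, h4, h10, h12, h13, h14, Fin.mk_one,
        Fin.zero_eta, Fin.reduceFinMk] <;> simp [hm, h0]

end Parts

/-! ### Sums of the basic functions over common neighbours. -/

section Convolution

variable {F : Type*} [Field F] [Fintype F] [DecidableEq F] {m n : Type*} [Fintype m]
  [Fintype n] [DecidableEq m] [DecidableEq n]

/-- The indicator of `B` being orthogonal to `w`. -/
noncomputable def indPair (w B : Matrix m n F) : ℂ := if pairing B w = 0 then 1 else 0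

/-- The indicator of the row space of `B` being annihilated by `w`. -/
noncomputable def indRow (w B : Matrix m n F) : ℂ := if w * Bᵀ = 0 then 1 else 0

/-- The indicator of the column space of `B` being annihilated by `wᵀ`. -/
noncomputable def indCol (w B : Matrix m n F) : ℂ := if wᵀ * B = 0 then 1 else 0

theorem vecMulVec_eq_zero_iff {a : m → F} {b : n → F} : vecMulVec a b = 0 ↔ a = 0 ∨ b = 0 := by
  constructor
  · intro h
    by_contra! h2
    have := rank_vecMulVec_eq_one h2.1 h2.2
    rw [h, rank_zero] at this
    exact zero_ne_one this
  · rintro (rfl | rfl)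
    · ext; simp [vecMulVec_apply]
    · ext; simp [vecMulVec_apply]

theorem pairing_vecMulVec_left (a : m → F) (b : n → F) (w : Matrix m n F) :
    pairing (vecMulVec a b) w = a ⬝ᵥ w *ᵥ b := by
  rw [pairing_comm, pairing_vecMulVec_right]

theorem indPair_vecMulVec (w : Matrix m n F) (a : m → F) (b : n → F) :
    indPair w (vecMulVec a b) = if a ⬝ᵥ w *ᵥ b = 0 then 1 else 0 := by
  rw [indPair, pairing_vecMulVec_left]

theorem indRow_vecMulVec (w : Matrix m n F) (a : m → F) (b : n → F) :
    indRow w (vecMulVec a b) = if a = 0 ∨ w *ᵥ b = 0 then 1 else 0 := by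
  rw [indRow, transpose_vecMulVec, mul_vecMulVec]
  simp only [vecMulVec_eq_zero_iff, or_comm]

theorem indCol_vecMulVec (w : Matrix m n F) (a : m → F) (b : n → F) :
    indCol w (vecMulVec a b) = if a ᵥ* w = 0 ∨ b = 0 then 1 else 0 := by
  rw [indCol, mul_vecMulVec, mulVec_transpose]
  simp only [vecMulVec_eq_zero_iff]

theorem chi_vecMulVec_left (w : Matrix m n F) (a : m → F) (b : n → F) :
    chi (vecMulVec a b) w = fieldChar F (a ⬝ᵥ w *ᵥ b) := by
  rw [chi, pairing_vecMulVec_left]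

/-- The pairing is the trace of wB^T, so it vanishes with that matrix. Hence χ_B(w) = 1 on the
support of each indicator, the fact behind all the convolution formulas. -/
theorem indRow_mul_indPair (w B : Matrix m n F) : indRow w B * indPair w B = indRow w B := by
  by_cases h : w * Bᵀ = 0
  · have h2 : pairing B w = (w * Bᵀ).trace := by
      simp only [pairing, trace, diag_apply, mul_apply, transpose_apply, mul_comm]
    rw [indPair, h2, h, trace_zero, if_pos rfl, mul_one]
  · rw [indRow, if_neg h, zero_mul]

theorem indCol_mul_indPair (w B : Matrix m n F) : indCol w B * indPair w B = indCol w B := by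
  by_cases h : wᵀ * B = 0
  · have h2 : pairing B w = (wᵀ * B).trace := by
      simp only [pairing, trace, diag_apply, mul_apply, transpose_apply]
      rw [Finset.sum_comm]
      simp only [mul_comm]
    rw [indPair, h2, h, trace_zero, if_pos rfl, mul_one]
  · rw [indCol, if_neg h, zero_mul]

theorem indPair_mul_chi (w B : Matrix m n F) : indPair w B * chi B w = indPair w B := by
  by_cases h : pairing B w = 0
  · rw [chi, h, AddChar.map_zero_eq_one, mul_one]
  · rw [indPair, if_neg h, zero_mul]

theorem indRow_mul_chi (w B : Matrix m n F) : indRow w B * chi B w = indRow w B := by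
  rw [← indRow_mul_indPair, mul_assoc, indPair_mul_chi]

theorem indCol_mul_chi (w B : Matrix m n F) : indCol w B * chi B w = indCol w B := by
  rw [← indCol_mul_indPair, mul_assoc, indPair_mul_chi]

variable (F m n) in
/-- The number of common neighbours of two adjacent vertices. -/
noncomputable def nbrNum : ℂ := (Fintype.card F : ℂ) ^ Fintype.card m +
  (Fintype.card F : ℂ) ^ Fintype.card n - Fintype.card F - 2

variable {a : m → F} {b : n → F}

theorem sum_nbrs_one (ha : a ≠ 0) (hb : b ≠ 0) :
    ∑ _C ∈ rankOneNbrs (vecMulVec a b), (1 : ℂ) = nbrNum F m n := by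
  have h := sum_rankOneNbrs (fun _ => (1 : ℂ)) ha hb
  simp only [Finset.sum_const, Finset.card_univ, Fintype.card_fun, nsmul_eq_mul, mul_one] at h ⊢
  push_cast at h
  rw [nbrNum]
  linear_combination h

theorem sum_ite_mul_eq_zero (s : F) (g : F → ℂ) (hg : ∀ t, g t = if t * s = 0 then 1 else 0) :
    ∑ t : F, g t = 1 + ((Fintype.card F : ℂ) - 1) * if s = 0 then 1 else 0 := by
  simp only [hg, mul_eq_zero]
  split_ifs with h
  · simp [h]
  · simp [h]

theorem sum_nbrs_chi (w : Matrix m n F) (ha : a ≠ 0) (hb : b ≠ 0) :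
    ∑ C ∈ rankOneNbrs (vecMulVec a b), chi C w =
      (Fintype.card F : ℂ) ^ Fintype.card m * indRow w (vecMulVec a b) +
      (Fintype.card F : ℂ) ^ Fintype.card n * indCol w (vecMulVec a b) -
      Fintype.card F * indPair w (vecMulVec a b) - 1 - chi (vecMulVec a b) w := by
  have h := sum_rankOneNbrs (fun C => chi C w) ha hb
  have h1 : ∑ b', chi (vecMulVec a b') w =
      (Fintype.card F : ℂ) ^ Fintype.card n * indCol w (vecMulVec a b) := by
    have : ∀ b', chi (vecMulVec a b') w = fieldChar F (b' ⬝ᵥ (a ᵥ* w)) := fun b' => by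
      rw [chi_vecMulVec_left, dotProduct_mulVec, dotProduct_comm]
    rw [Finset.sum_congr rfl fun b' _ => this b', sum_fieldChar_dotProduct, indCol_vecMulVec]
    simp [hb]
  have h2 : ∑ a', chi (vecMulVec a' b) w =
      (Fintype.card F : ℂ) ^ Fintype.card m * indRow w (vecMulVec a b) := by
    rw [Finset.sum_congr rfl fun a' _ => chi_vecMulVec_left w a' b, sum_fieldChar_dotProduct,
      indRow_vecMulVec]
    simp [ha]
  have h3 : ∑ t : F, chi (vecMulVec (t • a) b) w =
      Fintype.card F * indPair w (vecMulVec a b) := by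
    simp only [chi_vecMulVec_left, smul_dotProduct, smul_eq_mul]
    rw [sum_fieldChar_mul, indPair_vecMulVec]
    split_ifs <;> simp
  rw [h1, h2, h3, chi_zero_left] at h
  linear_combination h

theorem sum_nbrs_indPair (w : Matrix m n F) (ha : a ≠ 0) (hb : b ≠ 0) :
    ∑ C ∈ rankOneNbrs (vecMulVec a b), indPair w C =
      (Fintype.card F : ℂ) ^ Fintype.card m / Fintype.card F *
        (1 + ((Fintype.card F : ℂ) - 1) * indRow w (vecMulVec a b)) +
      (Fintype.card F : ℂ) ^ Fintype.card n / Fintype.card F *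
        (1 + ((Fintype.card F : ℂ) - 1) * indCol w (vecMulVec a b)) -
      Fintype.card F * indPair w (vecMulVec a b) - 2 := by
  have hq : (Fintype.card F : ℂ) ≠ 0 := Nat.cast_ne_zero.mpr Fintype.card_ne_zero
  have h := sum_rankOneNbrs (fun C => indPair w C) ha hb
  have h1 : ∑ b', indPair w (vecMulVec a b') =
      (Fintype.card F : ℂ) ^ Fintype.card n / Fintype.card F *
        (1 + ((Fintype.card F : ℂ) - 1) * indCol w (vecMulVec a b)) := by
    have : ∀ b', indPair w (vecMulVec a b') = if (a ᵥ* w) ⬝ᵥ b' = 0 then 1 else 0 := fun b' => by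
      rw [indPair_vecMulVec, dotProduct_mulVec]
    apply mul_left_cancel₀ hq
    rw [Finset.sum_congr rfl fun b' _ => this b', sum_dotProduct_eq_zero, indCol_vecMulVec]
    simp only [hb, or_false]
    split_ifs <;> field_simp <;> ring
  have h2 : ∑ a', indPair w (vecMulVec a' b) =
      (Fintype.card F : ℂ) ^ Fintype.card m / Fintype.card F *
        (1 + ((Fintype.card F : ℂ) - 1) * indRow w (vecMulVec a b)) := by
    have : ∀ a', indPair w (vecMulVec a' b) = if (w *ᵥ b) ⬝ᵥ a' = 0 then 1 else 0 := fun a' => by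
      rw [indPair_vecMulVec, dotProduct_comm]
    apply mul_left_cancel₀ hq
    rw [Finset.sum_congr rfl fun a' _ => this a', sum_dotProduct_eq_zero, indRow_vecMulVec]
    simp only [ha, false_or]
    split_ifs <;> field_simp <;> ring
  have h3 : ∑ t : F, indPair w (vecMulVec (t • a) b) =
      1 + ((Fintype.card F : ℂ) - 1) * indPair w (vecMulVec a b) := by
    rw [indPair_vecMulVec]
    apply sum_ite_mul_eq_zero
    intro t
    rw [indPair_vecMulVec, smul_dotProduct, smul_eq_mul]
  have h4 : indPair w 0 = 1 := by simp [indPair, pairing]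
  rw [h1, h2, h3, h4] at h
  linear_combination h

theorem sum_ite_eq_zero_or {κ : Type*} [Fintype κ] [DecidableEq κ] (P : Prop) [Decidable P] :
    ∑ c : κ → F, (if c = 0 ∨ P then (1 : ℂ) else 0) =
      1 + ((Fintype.card F : ℂ) ^ Fintype.card κ - 1) * if P then 1 else 0 := by
  split_ifs with h
  · simp [h]
  · simp [h]

theorem sum_vecMul_eq_zero (w : Matrix m n F) :
    ∑ a : m → F, (if a ᵥ* w = 0 then (1 : ℂ) else 0) =
      (Fintype.card F : ℂ) ^ Fintype.card m / (Fintype.card F : ℂ) ^ w.rank := by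
  have h := sum_mulVec_eq_zero wᵀ
  rw [rank_transpose] at h
  simpa only [mulVec_transpose] using h

theorem indRow_smul_vecMulVec (w : Matrix m n F) (t : F) (ha : a ≠ 0) :
    indRow w (vecMulVec (t • a) b) = if t = 0 ∨ w *ᵥ b = 0 then 1 else 0 := by
  rw [indRow_vecMulVec]
  simp only [smul_eq_zero, ha, or_false]

theorem indCol_smul_vecMulVec (w : Matrix m n F) (t : F) (hb : b ≠ 0) :
    indCol w (vecMulVec (t • a) b) = if t = 0 ∨ a ᵥ* w = 0 then 1 else 0 := by
  rw [indCol_vecMulVec]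
  simp only [smul_vecMul, smul_eq_zero, hb, or_false]

theorem sum_ite_eq_zero_or' (P : Prop) [Decidable P] :
    ∑ t : F, (if t = 0 ∨ P then (1 : ℂ) else 0) =
      1 + ((Fintype.card F : ℂ) - 1) * if P then 1 else 0 := by
  split_ifs with h
  · simp [h]
  · simp [h]

theorem sum_nbrs_indRow (w : Matrix m n F) (ha : a ≠ 0) (hb : b ≠ 0) :
    ∑ C ∈ rankOneNbrs (vecMulVec a b), indRow w C =
      (Fintype.card F : ℂ) ^ Fintype.card n / (Fintype.card F : ℂ) ^ w.rank - 1 +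
        ((Fintype.card F : ℂ) ^ Fintype.card m - Fintype.card F - 1) *
          indRow w (vecMulVec a b) := by
  have h := sum_rankOneNbrs (fun C => indRow w C) ha hb
  have h1 : ∑ b', indRow w (vecMulVec a b') =
      (Fintype.card F : ℂ) ^ Fintype.card n / (Fintype.card F : ℂ) ^ w.rank := by
    rw [← sum_mulVec_eq_zero]
    simp only [indRow_vecMulVec, ha, false_or]
  have h5 : indRow w (vecMulVec a b) = if w *ᵥ b = 0 then 1 else 0 := by
    simp only [indRow_vecMulVec, ha, false_or]
  have h2 : ∑ a', indRow w (vecMulVec a' b) =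
      1 + ((Fintype.card F : ℂ) ^ Fintype.card m - 1) * indRow w (vecMulVec a b) := by
    rw [h5, ← sum_ite_eq_zero_or]
    simp only [indRow_vecMulVec]
  have h3 : ∑ t : F, indRow w (vecMulVec (t • a) b) =
      1 + ((Fintype.card F : ℂ) - 1) * indRow w (vecMulVec a b) := by
    rw [h5, ← sum_ite_eq_zero_or']
    simp only [indRow_smul_vecMulVec w _ ha]
  have h4 : indRow w 0 = 1 := by simp [indRow]
  rw [h1, h2, h3, h4] at h
  linear_combination h

theorem sum_nbrs_indCol (w : Matrix m n F) (ha : a ≠ 0) (hb : b ≠ 0) :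
    ∑ C ∈ rankOneNbrs (vecMulVec a b), indCol w C =
      (Fintype.card F : ℂ) ^ Fintype.card m / (Fintype.card F : ℂ) ^ w.rank - 1 +
        ((Fintype.card F : ℂ) ^ Fintype.card n - Fintype.card F - 1) *
          indCol w (vecMulVec a b) := by
  have h := sum_rankOneNbrs (fun C => indCol w C) ha hb
  have h1 : ∑ a', indCol w (vecMulVec a' b) =
      (Fintype.card F : ℂ) ^ Fintype.card m / (Fintype.card F : ℂ) ^ w.rank := by
    rw [← sum_vecMul_eq_zero]
    simp only [indCol_vecMulVec, hb, or_false]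
  have h5 : indCol w (vecMulVec a b) = if a ᵥ* w = 0 then 1 else 0 := by
    simp only [indCol_vecMulVec, hb, or_false]
  have h2 : ∑ b', indCol w (vecMulVec a b') =
      1 + ((Fintype.card F : ℂ) ^ Fintype.card n - 1) * indCol w (vecMulVec a b) := by
    rw [h5, ← sum_ite_eq_zero_or]
    simp only [indCol_vecMulVec, or_comm]
  have h3 : ∑ t : F, indCol w (vecMulVec (t • a) b) =
      1 + ((Fintype.card F : ℂ) - 1) * indCol w (vecMulVec a b) := by
    rw [h5, ← sum_ite_eq_zero_or']
    simp only [indCol_smul_vecMulVec w _ hb]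
  have h4 : indCol w 0 = 1 := by simp [indCol]
  rw [h1, h2, h3, h4] at h
  linear_combination h

theorem sum_mul_of_eq_one_at_zero {κ : Type*} [Fintype κ] [DecidableEq κ] (g : (κ → F) → ℂ)
    (h0 : g 0 = 1) (P : Prop) [Decidable P] :
    ∑ c : κ → F, g c * (if P ∨ c = 0 then 1 else 0) =
      1 + (∑ c, g c - 1) * if P then 1 else 0 := by
  split_ifs with h
  · simp [h]
  · simp [h, h0]

/-- Unlike for the other indicators, no constant term remains: the contributions at 0 cancel. The
product therefore does not enter the eigenvalue `symEig`. -/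
theorem sum_nbrs_indRow_mul_indCol (w : Matrix m n F) (ha : a ≠ 0) (hb : b ≠ 0) :
    ∑ C ∈ rankOneNbrs (vecMulVec a b), indRow w C * indCol w C =
      ((Fintype.card F : ℂ) ^ Fintype.card n / (Fintype.card F : ℂ) ^ w.rank - 1) *
          indCol w (vecMulVec a b) +
        ((Fintype.card F : ℂ) ^ Fintype.card m / (Fintype.card F : ℂ) ^ w.rank - 1) *
          indRow w (vecMulVec a b) -
        (Fintype.card F : ℂ) * (indRow w (vecMulVec a b) * indCol w (vecMulVec a b)) := by
  have h := sum_rankOneNbrs (fun C => indRow w C * indCol w C) ha hb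
  have h5 : indRow w (vecMulVec a b) = if w *ᵥ b = 0 then 1 else 0 := by
    simp only [indRow_vecMulVec, ha, false_or]
  have h6 : indCol w (vecMulVec a b) = if a ᵥ* w = 0 then 1 else 0 := by
    simp only [indCol_vecMulVec, hb, or_false]
  have h1 : ∑ b', indRow w (vecMulVec a b') * indCol w (vecMulVec a b') =
      1 + ((Fintype.card F : ℂ) ^ Fintype.card n / (Fintype.card F : ℂ) ^ w.rank - 1) *
        indCol w (vecMulVec a b) := by
    rw [h6, ← sum_mulVec_eq_zero, ← sum_mul_of_eq_one_at_zero
      (fun b' => if w *ᵥ b' = 0 then (1 : ℂ) else 0) (by simp)]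
    simp only [indRow_vecMulVec, indCol_vecMulVec, ha, false_or]
  have h2 : ∑ a', indRow w (vecMulVec a' b) * indCol w (vecMulVec a' b) =
      1 + ((Fintype.card F : ℂ) ^ Fintype.card m / (Fintype.card F : ℂ) ^ w.rank - 1) *
        indRow w (vecMulVec a b) := by
    rw [h5, ← sum_vecMul_eq_zero, ← sum_mul_of_eq_one_at_zero
      (fun a' => if a' ᵥ* w = 0 then (1 : ℂ) else 0) (by simp)]
    refine Finset.sum_congr rfl fun a' _ => ?_
    rw [indRow_vecMulVec, indCol_vecMulVec, mul_comm]
    simp only [hb, false_or, or_comm]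
  have h3 : ∑ t : F, indRow w (vecMulVec (t • a) b) * indCol w (vecMulVec (t • a) b) =
      1 + ((Fintype.card F : ℂ) - 1) * (indRow w (vecMulVec a b) * indCol w (vecMulVec a b)) := by
    have h7 : indRow w (vecMulVec a b) * indCol w (vecMulVec a b) =
        if w *ᵥ b = 0 ∧ a ᵥ* w = 0 then 1 else 0 := by
      rw [h5, h6]
      split_ifs <;> simp_all
    rw [h7, ← sum_ite_eq_zero_or']
    refine Finset.sum_congr rfl fun t _ => ?_
    rw [indRow_smul_vecMulVec w _ ha, indCol_smul_vecMulVec w _ hb]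
    split_ifs <;> simp_all
  have h4 : indRow w 0 * indCol w 0 = 1 := by simp [indRow, indCol]
  rw [h1, h2, h3, h4] at h
  linear_combination h

end Convolution

/-! ### Character sums over the sets O_j. -/

section PartSums

variable {F : Type*} [Field F] [Fintype F] [DecidableEq F] {D N : ℕ} {x y : Vert F D N} {k : ℕ}

/-- The sum of a bilinear character over all pairs of vectors. -/
noncomputable def prodSum {r s : ℕ} (γ : Fin r → F) (δ : Fin s → F) : ℂ :=
  ∑ c, ∑ d, fieldChar F ((γ ⬝ᵥ c) * (δ ⬝ᵥ d))

/-- The sum of a bilinear character over the pairs of vectors with given dot product. -/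
noncomputable def quadricSum {r : ℕ} (γ δ : Fin r → F) (s : F) : ℂ :=
  ∑ c, ∑ d, if c ⬝ᵥ d = s then fieldChar F ((γ ⬝ᵥ c) * (δ ⬝ᵥ d)) else 0

/-- The sum of a character over the differences `z - x` with `z` in a part. -/
noncomputable def partSum (x y : Vert F D N) (j : Fin 6) (C : Vert F D N) : ℂ :=
  ∑ z ∈ part x y j, chi C (z - x)

theorem partSum_zero (j : Fin 6) : partSum x y j 0 = (part x y j).card := by
  simp [partSum]

/-- Summing over pairs (a, b) counts each rank-one difference q - 1 times, hence the factor. -/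
theorem card_sub_one_mul_partSum (j : Fin 6) (C : Vert F D N) :
    ((Fintype.card F : ℂ) - 1) * partSum x y j C =
      ∑ a, ∑ b, if x + vecMulVec a b ∈ part x y j then chi C (vecMulVec a b) else 0 := by
  have h0 : x + 0 ∉ part x y j := fun h => by
    have h1 := rank_eq_one_of_mem_part h
    rw [rank_zero] at h1
    exact zero_ne_one h1
  rw [sum_sum_vecMulVec (fun u => if x + u ∈ part x y j then chi C u else 0) (if_neg h0)]
  congr 1
  rw [rankOne, Finset.sum_filter, partSum]
  have h2 : ∀ u : Vert F D N, (if u.rank = 1 then (if x + u ∈ part x y j then chi C u else 0)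
      else 0) = (fun z => if z ∈ part x y j then chi C (z - x) else 0) (Equiv.addLeft x u) := by
    intro u
    simp only [Equiv.coe_addLeft, add_sub_cancel_left]
    split_ifs with h3 h4 h4
    · rfl
    · rfl
    · exact absurd (rank_eq_one_of_mem_part h4) h3
    · rfl
  rw [Finset.sum_congr rfl fun u _ => h2 u]
  refine Eq.trans ?_ (Equiv.sum_comp (Equiv.addLeft x)
    fun z => if z ∈ part x y j then chi C (z - x) else 0).symm
  rw [Finset.sum_ite_mem, Finset.univ_inter]

variable (f : FullRankFactorization (x - y) k)

theorem sum_sum_ite_ne_zero_ne_zero :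
    ∑ c : Fin k → F, ∑ d : Fin k → F, (if c = 0 ∨ d = 0 then (1 : ℂ) else 0) =
      2 * (Fintype.card F : ℂ) ^ k - 1 := by
  have h : ∀ c : Fin k → F, ∑ d : Fin k → F, (if c = 0 ∨ d = 0 then (1 : ℂ) else 0) =
      1 + ((Fintype.card F : ℂ) ^ k - 1) * if c = 0 then 1 else 0 := by
    intro c
    have := sum_ite_eq_zero_or (F := F) (κ := Fin k) (c = 0)
    rw [Fintype.card_fin] at this
    rw [← this]
    simp only [or_comm]
  rw [Finset.sum_congr rfl fun c _ => h c, Finset.sum_add_distrib, ← Finset.mul_sum,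
    Finset.sum_ite_eq']
  simp
  ring

theorem chi_vecMulVec_in_in (α : Fin D → F) (β : Fin (N - D) → F) (c d : Fin k → F) :
    chi (vecMulVec α β) (vecMulVec (f.L *ᵥ c) (d ᵥ* f.R)) =
      fieldChar F (((α ᵥ* f.L) ⬝ᵥ c) * ((f.R *ᵥ β) ⬝ᵥ d)) := by
  rw [chi, pairing_vecMulVec, dotProduct_mulVec, dotProduct_comm β,
    ← dotProduct_mulVec d, dotProduct_comm d]

theorem chi_vecMulVec_in_left (α : Fin D → F) (β b : Fin (N - D) → F) (c : Fin k → F) :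
    chi (vecMulVec α β) (vecMulVec (f.L *ᵥ c) b) =
      fieldChar F (((α ᵥ* f.L) ⬝ᵥ c) * (β ⬝ᵥ b)) := by
  rw [chi, pairing_vecMulVec, dotProduct_mulVec]

theorem chi_vecMulVec_in_right (α a : Fin D → F) (β : Fin (N - D) → F) (d : Fin k → F) :
    chi (vecMulVec α β) (vecMulVec a (d ᵥ* f.R)) =
      fieldChar F ((α ⬝ᵥ a) * ((f.R *ᵥ β) ⬝ᵥ d)) := by
  rw [chi, pairing_vecMulVec, dotProduct_comm β, ← dotProduct_mulVec, dotProduct_comm d]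

theorem chi_vecMulVec_vecMulVec (α a : Fin D → F) (β b : Fin (N - D) → F) :
    chi (vecMulVec α β) (vecMulVec a b) = fieldChar F ((α ⬝ᵥ a) * (β ⬝ᵥ b)) := by
  rw [chi, pairing_vecMulVec]

theorem sum_in_out (α : Fin D → F) (β : Fin (N - D) → F) :
    ∑ c, ∑ b ∈ f.outRow, chi (vecMulVec α β) (vecMulVec (f.L *ᵥ c) b) =
      prodSum (α ᵥ* f.L) β - prodSum (α ᵥ* f.L) (f.R *ᵥ β) := by
  rw [prodSum, prodSum, ← Finset.sum_sub_distrib]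
  refine Finset.sum_congr rfl fun c _ => ?_
  simp only [← chi_vecMulVec_in_left f, ← chi_vecMulVec_in_in f]
  rw [f.sum_row, add_sub_cancel_left]

theorem sum_out_in (α : Fin D → F) (β : Fin (N - D) → F) :
    ∑ a ∈ f.outCol, ∑ d, chi (vecMulVec α β) (vecMulVec a (d ᵥ* f.R)) =
      prodSum α (f.R *ᵥ β) - prodSum (α ᵥ* f.L) (f.R *ᵥ β) := by
  rw [prodSum, prodSum]
  simp only [← chi_vecMulVec_in_right f, ← chi_vecMulVec_in_in f]
  rw [f.sum_col, add_sub_cancel_left]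

theorem sum_out_out (α : Fin D → F) (β : Fin (N - D) → F) :
    ∑ a ∈ f.outCol, ∑ b ∈ f.outRow, chi (vecMulVec α β) (vecMulVec a b) =
      prodSum α β - prodSum α (f.R *ᵥ β) - prodSum (α ᵥ* f.L) β +
        prodSum (α ᵥ* f.L) (f.R *ᵥ β) := by
  have h1 : ∑ a, ∑ b, chi (vecMulVec α β) (vecMulVec a b) = prodSum α β := by
    rw [prodSum]; simp only [chi_vecMulVec_vecMulVec]
  rw [f.sum_col] at h1
  simp only [f.sum_row, Finset.sum_add_distrib] at h1
  rw [sum_in_out, sum_out_in] at h1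
  have h2 : ∑ c, ∑ d, chi (vecMulVec α β) (vecMulVec (f.L *ᵥ c) (d ᵥ* f.R)) =
      prodSum (α ᵥ* f.L) (f.R *ᵥ β) := by
    rw [prodSum]; simp only [chi_vecMulVec_in_in]
  rw [h2] at h1
  linear_combination h1

theorem card_outRow_complex :
    (f.outRow.card : ℂ) = (Fintype.card F : ℂ) ^ (N - D) - (Fintype.card F : ℂ) ^ k := by
  have h := f.card_outRow
  rw [Fintype.card_fin] at h
  rw [eq_sub_iff_add_eq', ← Nat.cast_pow, ← Nat.cast_pow, ← Nat.cast_add, h]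

theorem card_outCol_complex :
    (f.outCol.card : ℂ) = (Fintype.card F : ℂ) ^ D - (Fintype.card F : ℂ) ^ k := by
  have h := f.card_outCol
  rw [Fintype.card_fin] at h
  rw [eq_sub_iff_add_eq', ← Nat.cast_pow, ← Nat.cast_pow, ← Nat.cast_add, h]

/-- Split a and b according to the column space of L and the row space of R. The three in-in
families are cut out by c ⬝ d, and sums over a complement are differences of full sums. The
subtracted constants account for pairs with a zero factor, where the character is 1. -/
theorem partSum_vecMulVec (hk : 1 ≤ k) (hkD : k < D) (hDN : D < N - D) (α : Fin D → F)
    (β : Fin (N - D) → F) (j : Fin 6) :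
    ((Fintype.card F : ℂ) - 1) * partSum x y j (vecMulVec α β) =
      ![quadricSum (α ᵥ* f.L) (f.R *ᵥ β) (-1),
        quadricSum (α ᵥ* f.L) (f.R *ᵥ β) 0 - (2 * (Fintype.card F : ℂ) ^ k - 1),
        prodSum (α ᵥ* f.L) (f.R *ᵥ β) - quadricSum (α ᵥ* f.L) (f.R *ᵥ β) 0 -
          quadricSum (α ᵥ* f.L) (f.R *ᵥ β) (-1),
        prodSum (α ᵥ* f.L) β - prodSum (α ᵥ* f.L) (f.R *ᵥ β) -
          ((Fintype.card F : ℂ) ^ (N - D) - (Fintype.card F : ℂ) ^ k),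
        prodSum α (f.R *ᵥ β) - prodSum (α ᵥ* f.L) (f.R *ᵥ β) -
          ((Fintype.card F : ℂ) ^ D - (Fintype.card F : ℂ) ^ k),
        prodSum α β - prodSum α (f.R *ᵥ β) - prodSum (α ᵥ* f.L) β +
          prodSum (α ᵥ* f.L) (f.R *ᵥ β)] j := by
  rw [card_sub_one_mul_partSum, f.sum_col]
  simp only [f.sum_row, Finset.sum_add_distrib]
  have hii : ∀ c d : Fin k → F, (if x + vecMulVec (f.L *ᵥ c) (d ᵥ* f.R) ∈ part x y j then
      chi (vecMulVec α β) (vecMulVec (f.L *ᵥ c) (d ᵥ* f.R)) else 0) =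
      if (j = 0 ∧ c ⬝ᵥ d = -1) ∨ (j = 1 ∧ (c ≠ 0 ∧ d ≠ 0) ∧ c ⬝ᵥ d = 0) ∨
        (j = 2 ∧ c ⬝ᵥ d ≠ 0 ∧ c ⬝ᵥ d ≠ -1) then
        fieldChar F (((α ᵥ* f.L) ⬝ᵥ c) * ((f.R *ᵥ β) ⬝ᵥ d)) else 0 := by
    intro c d
    rw [chi_vecMulVec_in_in]
    simp only [mem_part_in_in f hk hkD hDN c d j]
  have hio : ∑ c : Fin k → F, ∑ b ∈ f.outRow, (if x + vecMulVec (f.L *ᵥ c) b ∈ part x y j then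
      chi (vecMulVec α β) (vecMulVec (f.L *ᵥ c) b) else 0) =
      if j = 3 then prodSum (α ᵥ* f.L) β - prodSum (α ᵥ* f.L) (f.R *ᵥ β) -
          ((Fintype.card F : ℂ) ^ (N - D) - (Fintype.card F : ℂ) ^ k) else 0 := by
    split_ifs with hj
    · rw [← sum_in_out, ← card_outRow_complex f]
      have h1 : ∀ c : Fin k → F, ∀ b ∈ f.outRow,
          (if x + vecMulVec (f.L *ᵥ c) b ∈ part x y j then
            chi (vecMulVec α β) (vecMulVec (f.L *ᵥ c) b) else 0) =
          chi (vecMulVec α β) (vecMulVec (f.L *ᵥ c) b) - if c = 0 then 1 else 0 := by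
        intro c b hb
        have hmem := mem_part_in_out f hk hkD hDN c hb j
        by_cases hc : c = 0
        · have h0 : vecMulVec (f.L *ᵥ c) b = 0 := by
            rw [hc, mulVec_zero, vecMulVec_eq_zero_iff]; exact Or.inl rfl
          rw [if_neg fun h => (hmem.mp h).1 hc, if_pos hc, h0, chi_zero_right, sub_self]
        · rw [if_pos (hmem.mpr ⟨hc, hj⟩), if_neg hc, sub_zero]
      rw [Finset.sum_congr rfl fun c _ => Finset.sum_congr rfl (h1 c)]
      simp only [Finset.sum_sub_distrib, Finset.sum_const, smul_ite, smul_zero]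
      rw [Finset.sum_ite_eq']
      simp
    · refine Finset.sum_eq_zero fun c _ => Finset.sum_eq_zero fun b hb => ?_
      rw [if_neg]
      rw [mem_part_in_out f hk hkD hDN c hb j]
      exact fun h => hj h.2
  have hoi : ∑ a ∈ f.outCol, ∑ d : Fin k → F, (if x + vecMulVec a (d ᵥ* f.R) ∈ part x y j then
      chi (vecMulVec α β) (vecMulVec a (d ᵥ* f.R)) else 0) =
      if j = 4 then prodSum α (f.R *ᵥ β) - prodSum (α ᵥ* f.L) (f.R *ᵥ β) -
          ((Fintype.card F : ℂ) ^ D - (Fintype.card F : ℂ) ^ k) else 0 := by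
    split_ifs with hj
    · rw [← sum_out_in, ← card_outCol_complex f]
      have h1 : ∀ a ∈ f.outCol, ∀ d ∈ (Finset.univ : Finset (Fin k → F)),
          (if x + vecMulVec a (d ᵥ* f.R) ∈ part x y j then
            chi (vecMulVec α β) (vecMulVec a (d ᵥ* f.R)) else 0) =
          chi (vecMulVec α β) (vecMulVec a (d ᵥ* f.R)) - if d = 0 then 1 else 0 := by
        intro a ha d _
        have hmem := mem_part_out_in f hk hkD hDN ha d j
        by_cases hd : d = 0
        · have h0 : vecMulVec a (d ᵥ* f.R) = 0 := by
            rw [hd, zero_vecMul, vecMulVec_eq_zero_iff]; exact Or.inr rfl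
          rw [if_neg fun h => (hmem.mp h).1 hd, if_pos hd, h0, chi_zero_right, sub_self]
        · rw [if_pos (hmem.mpr ⟨hd, hj⟩), if_neg hd, sub_zero]
      rw [Finset.sum_congr rfl fun a ha => Finset.sum_congr rfl (h1 a ha)]
      simp only [Finset.sum_sub_distrib, Finset.sum_ite_eq']
      simp
    · refine Finset.sum_eq_zero fun a ha => Finset.sum_eq_zero fun d _ => ?_
      rw [if_neg]
      rw [mem_part_out_in f hk hkD hDN ha d j]
      exact fun h => hj h.2
  have hoo : ∑ a ∈ f.outCol, ∑ b ∈ f.outRow, (if x + vecMulVec a b ∈ part x y j then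
      chi (vecMulVec α β) (vecMulVec a b) else 0) =
      if j = 5 then prodSum α β - prodSum α (f.R *ᵥ β) - prodSum (α ᵥ* f.L) β +
          prodSum (α ᵥ* f.L) (f.R *ᵥ β) else 0 := by
    rw [← sum_out_out f]
    split_ifs with hj
    · refine Finset.sum_congr rfl fun a ha => Finset.sum_congr rfl fun b hb => ?_
      rw [if_pos ((mem_part_out_out f hk ha hb j).mpr hj)]
    · refine Finset.sum_eq_zero fun a ha => Finset.sum_eq_zero fun b hb => ?_
      rw [if_neg fun h => hj ((mem_part_out_out f hk ha hb j).mp h)]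
  rw [hio, hoi, hoo]
  simp only [hii]
  fin_cases j
  · simp [quadricSum]
  · rw [← sum_sum_ite_ne_zero_ne_zero (F := F), quadricSum]
    simp only [Fin.mk_one, one_ne_zero, false_and, true_and, false_or, or_false,
      Fin.reduceEq, if_false, add_zero, Matrix.cons_val_one, Matrix.cons_val_zero, quadricSum,
      ← Finset.sum_sub_distrib]
    refine Finset.sum_congr rfl fun c _ => Finset.sum_congr rfl fun d _ => ?_
    by_cases hc : c = 0
    · simp [hc]
    by_cases hd : d = 0
    · simp [hd]
    simp [hc, hd]
  · simp only [quadricSum, prodSum]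
    simp
    simp only [← Finset.sum_sub_distrib]
    refine Finset.sum_congr rfl fun c _ => Finset.sum_congr rfl fun d _ => ?_
    by_cases h0 : c ⬝ᵥ d = 0
    · simp [h0]
    · by_cases h1 : c ⬝ᵥ d = -1
      · simp [h1]
      · simp [h0, h1]
  · simp
  · simp
  · simp

end PartSums

/-! ### Closed forms for |O_j|, λ_j and the transforms of E O_j^∨. -/

section ClosedForms

variable {F : Type*} [Field F] [Fintype F] [DecidableEq F] {D N : ℕ} {x y : Vert F D N} {k : ℕ}

variable (F) in
theorem card_complex_ne_zero : (Fintype.card F : ℂ) ≠ 0 :=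
  Nat.cast_ne_zero.mpr Fintype.card_ne_zero

variable (F) in
theorem card_sub_one_complex_ne_zero : (Fintype.card F : ℂ) - 1 ≠ 0 := by
  have h := one_lt_card_real F
  have h2 : (Fintype.card F : ℝ) - 1 ≠ 0 := by linarith
  exact_mod_cast h2

theorem prodSum_eq {r s : ℕ} (γ : Fin r → F) (δ : Fin s → F) :
    (Fintype.card F : ℂ) * prodSum γ δ = (Fintype.card F : ℂ) ^ r * (Fintype.card F : ℂ) ^ s *
      if γ = 0 ∨ δ = 0 then (Fintype.card F : ℂ) else 1 := by
  have h := sum_sum_fieldChar_mul γ δ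
  rwa [Fintype.card_fin, Fintype.card_fin] at h

theorem quadricSum_zero_eq (hk : 1 ≤ k) (γ δ : Fin k → F) :
    quadricSum γ δ 0 = (Fintype.card F : ℂ) ^ (k - 1) *
      ((Fintype.card F : ℂ) ^ (k - 1) * (if γ = 0 ∨ δ = 0 then (Fintype.card F : ℂ) else 1) +
        ((Fintype.card F : ℂ) - 1) +
        ((Fintype.card F : ℂ) - 1) * (1 - if γ ⬝ᵥ δ = 0 then 1 else 0)) := by
  have hq := card_complex_ne_zero F
  have h := sum_sum_fieldChar_quadric γ δ 0
  obtain ⟨r, rfl⟩ : ∃ r, k = r + 1 := ⟨k - 1, by omega⟩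
  rw [Fintype.card_fin, if_pos rfl, zero_mul, AddChar.map_zero_eq_one] at h
  apply mul_left_cancel₀ hq
  rw [quadricSum, h, Nat.add_sub_cancel, pow_succ, mul_div_assoc, div_self hq]
  split_ifs <;> ring

theorem quadricSum_neg_one_eq (hk : 1 ≤ k) (γ δ : Fin k → F) :
    quadricSum γ δ (-1) = (Fintype.card F : ℂ) ^ (k - 1) *
      ((Fintype.card F : ℂ) ^ (k - 1) * (if γ = 0 ∨ δ = 0 then (Fintype.card F : ℂ) else 1) - 1 +
        ((Fintype.card F : ℂ) - 1) * (1 - if γ ⬝ᵥ δ = 0 then 1 else 0) *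
          fieldChar F (-(γ ⬝ᵥ δ))) := by
  have hq := card_complex_ne_zero F
  have h := sum_sum_fieldChar_quadric γ δ (-1)
  obtain ⟨r, rfl⟩ : ∃ r, k = r + 1 := ⟨k - 1, by omega⟩
  rw [Fintype.card_fin, if_neg (neg_ne_zero.mpr one_ne_zero), neg_one_mul] at h
  apply mul_left_cancel₀ hq
  rw [quadricSum, h, Nat.add_sub_cancel, pow_succ, mul_div_assoc, div_self hq]
  split_ifs <;> ring

/-- Specialise the character sum to the trivial character. -/
theorem card_part_eq (f : FullRankFactorization (x - y) k) (hk : 1 ≤ k) (hkD : k < D) (hDN : D < N - D) (j : Fin 6) :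
    ((Fintype.card F : ℝ) - 1) * (part x y j).card =
      let q : ℝ := Fintype.card F
      let s : ℝ := q ^ (k - 1)
      ![s * (q * s - 1), (s - 1) * (q * s - 1), (q - 2) * s * (q * s - 1),
        (q ^ (N - D) - q * s) * (q * s - 1), (q ^ D - q * s) * (q * s - 1),
        (q ^ D - q * s) * (q ^ (N - D) - q * s)] j := by
  have hq := card_complex_ne_zero F
  have hp : ∀ {r s : ℕ}, prodSum (0 : Fin r → F) (0 : Fin s → F) =
      (Fintype.card F : ℂ) ^ r * (Fintype.card F : ℂ) ^ s := by
    intro r s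
    apply mul_left_cancel₀ hq
    rw [prodSum_eq, if_pos (Or.inl rfl)]
    ring
  have h := partSum_vecMulVec f hk hkD hDN 0 0 j
  rw [vecMulVec_eq_zero_iff.mpr (Or.inl rfl), partSum_zero, zero_vecMul, mulVec_zero,
    quadricSum_zero_eq hk, quadricSum_neg_one_eq hk, hp, hp, hp, hp] at h
  obtain ⟨r, rfl⟩ : ∃ r, k = r + 1 := ⟨k - 1, by omega⟩
  simp only [Nat.add_sub_cancel, true_or, if_true, dotProduct_zero, sub_self, mul_zero,
    zero_mul, add_zero, pow_succ] at h ⊢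
  have h2 : (((Fintype.card F : ℝ) - 1) * (part x y j).card : ℝ) =
      (((Fintype.card F : ℂ) - 1) * (part x y j).card : ℂ) := by push_cast; rfl
  apply Complex.ofReal_injective
  rw [h2, h]
  fin_cases j <;> simp <;> ring

theorem theta_ratio {m n : Type*} [Fintype m] [Fintype n] (k r : ℕ) :
    (theta F m n 1 - theta F m n r) / (theta F m n 0 - theta F m n k) =
      (1 / (Fintype.card F : ℝ) - 1 / (Fintype.card F : ℝ) ^ r) /
        (1 - 1 / (Fintype.card F : ℝ) ^ k) := by
  have hq := one_lt_card_real F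
  have hq1 : (Fintype.card F : ℝ) - 1 ≠ 0 := by linarith
  have hA : (Fintype.card F : ℝ) ^ Fintype.card m * (Fintype.card F : ℝ) ^ Fintype.card n ≠ 0 := by
    positivity
  have h : ∀ r s : ℕ, theta F m n r - theta F m n s =
      ((Fintype.card F : ℝ) ^ Fintype.card m * (Fintype.card F : ℝ) ^ Fintype.card n /
        ((Fintype.card F : ℝ) - 1)) *
        (1 / (Fintype.card F : ℝ) ^ r - 1 / (Fintype.card F : ℝ) ^ s) := by
    intro r s
    rw [theta, theta]
    field_simp
    ring
  rw [h, h, mul_div_mul_left _ _ (div_ne_zero hA hq1), pow_one, pow_zero, div_one]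

theorem lam_eq (hk : 2 ≤ k) (hkD : k < D) (hDN : 2 * D < N) (f : FullRankFactorization (x - y) k)
    (j : Fin 6) :
    ((Fintype.card F : ℝ) - 1) * lam x y j =
      let q : ℝ := Fintype.card F
      let s : ℝ := q ^ (k - 1)
      ![s * (s - q), (s - 1) * (s - 1), (q - 2) * s * (s - 1),
        (q ^ (N - D) - q * s) * (s - 1), (q ^ D - q * s) * (s - 1),
        (q ^ D - q * s) * (q ^ (N - D) - q * s) / q] j := by
  have hq := one_lt_card_real F
  have hD : 0 < D := by omega
  have hdist : (graph F D N).dist x y = k := by rw [dist_eq_rank_sub, f.rank_eq]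
  have hpd : partDist k j ≤ D := by
    fin_cases j <;> simp [partDist] <;> omega
  have h1 : lam x y j = (part x y j).card * ((1 / (Fintype.card F : ℝ) -
      1 / (Fintype.card F : ℝ) ^ (partDist k j)) / (1 - 1 / (Fintype.card F : ℝ) ^ k)) := by
    rw [lam]
    simp only [hdist]
    rw [dualEigenvalue_eq_theta hD hDN (by omega), dualEigenvalue_eq_theta hD hDN hpd,
      dualEigenvalue_eq_theta hD hDN (by omega), dualEigenvalue_eq_theta hD hDN (by omega),
      mul_div_assoc, theta_ratio]
  rw [h1, ← mul_assoc, card_part_eq f (by omega) hkD (by omega)]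
  obtain ⟨r, rfl⟩ : ∃ r, k = r + 2 := ⟨k - 2, by omega⟩
  have hr : (0 : ℝ) < (Fintype.card F : ℝ) ^ r := by positivity
  have hs : (1 : ℝ) < (Fintype.card F : ℝ) ^ (r + 2) := one_lt_pow₀ hq (by omega)
  have hs2 : (Fintype.card F : ℝ) * (Fintype.card F : ℝ) ^ (r + 1) - 1 ≠ 0 := by
    rw [← pow_succ']
    exact sub_ne_zero.mpr hs.ne'
  have hd : 1 - 1 / (Fintype.card F : ℝ) ^ (r + 2) =
      ((Fintype.card F : ℝ) * (Fintype.card F : ℝ) ^ (r + 1) - 1) /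
        (Fintype.card F : ℝ) ^ (r + 2) := by
    field_simp
    rw [← pow_succ']
  -- Multiplying through by q^k makes the denominator q^k - 1, written q * q^(k-1) - 1. This factor
  -- cancels against |O_j| for the first five sets and against the numerator for the last.
  have hkey : ∀ e : ℕ, (1 / (Fintype.card F : ℝ) - 1 / (Fintype.card F : ℝ) ^ e) /
      (1 - 1 / (Fintype.card F : ℝ) ^ (r + 2)) =
      ((Fintype.card F : ℝ) ^ (r + 1) - (Fintype.card F : ℝ) ^ (r + 2) / (Fintype.card F : ℝ) ^ e) /
        ((Fintype.card F : ℝ) * (Fintype.card F : ℝ) ^ (r + 1) - 1) := by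
    intro e
    rw [hd, div_div_eq_mul_div, sub_mul, pow_succ _ (r + 1)]
    congr 2
    · field_simp
    · field_simp
  rw [hkey]
  have e0 : (Fintype.card F : ℝ) ^ (r + 2) / (Fintype.card F : ℝ) ^ (r + 2 - 1) =
      Fintype.card F := by
    rw [Nat.add_sub_assoc (by omega), pow_succ _ (r + 1)]
    exact mul_div_cancel_left₀ _ (by positivity)
  have e1 : (Fintype.card F : ℝ) ^ (r + 2) / (Fintype.card F : ℝ) ^ (r + 2) = 1 :=
    div_self (by positivity)
  have e2 : (Fintype.card F : ℝ) ^ (r + 2) / (Fintype.card F : ℝ) ^ (r + 2 + 1) =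
      1 / Fintype.card F := by
    rw [pow_succ _ (r + 2)]
    field_simp
  have hr2 : r + 2 - 1 = r + 1 := by omega
  have hfin : ∀ t v w : ℝ, v ≠ 0 → t * v * (w / v) = t * w := by
    intro t v w hv
    field_simp
  fin_cases j
  · simp only [partDist, Fin.zero_eta, cons_val_zero]
    rw [e0, hr2]
    exact hfin _ _ _ hs2
  · simp [partDist]
    exact hfin _ _ _ hs2
  · simp [partDist]
    exact hfin _ _ _ hs2
  · simp [partDist]
    exact hfin _ _ _ hs2
  · simp [partDist]
    exact hfin _ _ _ hs2
  · simp [partDist]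
    rw [e2]
    generalize (Fintype.card F : ℝ) ^ (r + 1) = s at *
    have h3 : s - 1 / (Fintype.card F : ℝ) = (Fintype.card F * s - 1) / Fintype.card F := by
      field_simp
    rw [h3]
    field_simp

/-- Real combinations of the basic functions on matrices. -/
noncomputable def symFun {m n : Type*} [Fintype m] [Fintype n] [DecidableEq m] [DecidableEq n]
    (w : Matrix m n F) (r : Fin 5 → ℝ) (B : Matrix m n F) : ℂ :=
  r 0 * (chi B w + 1) + r 1 * indPair w B + r 2 * indRow w B + r 3 * indCol w B +
    r 4 * (indRow w B * indCol w B)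

variable (F) in
/-- The coefficients of the transform of `E O_j^∨`. -/
noncomputable def partCoeff (D N k : ℕ) : Fin 6 → Fin 5 → ℝ :=
  let q : ℝ := Fintype.card F
  let s : ℝ := q ^ (k - 1)
  ![![s, -s, s * s, s * s, -(s * s)],
    ![0, -s, s * s, s * s, -(s * s)],
    ![-s, 2 * s, (q - 2) * (s * s), (q - 2) * (s * s), -((q - 2) * (s * s))],
    ![0, 0, -(q * s * s), q ^ (N - D) * s - q * s * s, q * s * s],
    ![0, 0, q ^ D * s - q * s * s, -(q * s * s), q * s * s],
    ![0, 0, q * s * s - q ^ D * s, q * s * s - q ^ (N - D) * s, -(q * s * s)]]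

variable (f : FullRankFactorization (x - y) k)

theorem R_mulVec_eq_zero_iff (β : Fin (N - D) → F) : f.R *ᵥ β = 0 ↔ (x - y) *ᵥ β = 0 := by
  have h : (x - y) *ᵥ β = f.L *ᵥ (f.R *ᵥ β) := by rw [mulVec_mulVec, ← f.eq_mul]
  rw [h, ← not_iff_not]
  exact f.L_mulVec_ne_zero.symm

theorem vecMul_L_eq_zero_iff (α : Fin D → F) : α ᵥ* f.L = 0 ↔ α ᵥ* (x - y) = 0 := by
  have h : α ᵥ* (x - y) = (α ᵥ* f.L) ᵥ* f.R := by rw [vecMul_vecMul, ← f.eq_mul]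
  rw [h, ← not_iff_not]
  exact f.vecMul_R_ne_zero.symm

theorem vecMul_L_dotProduct (α : Fin D → F) (β : Fin (N - D) → F) :
    (α ᵥ* f.L) ⬝ᵥ (f.R *ᵥ β) = α ⬝ᵥ (x - y) *ᵥ β := by
  have h : (x - y) *ᵥ β = f.L *ᵥ (f.R *ᵥ β) := by rw [mulVec_mulVec, ← f.eq_mul]
  rw [h, dotProduct_mulVec α]

/-- The factor χ_B(w) arises from moving the origin from x to y. Subtracting λ_j is exactly what
makes the coefficient of χ_B(w) equal to the constant term, so that the two combine into a multiple
of χ_B(w) + 1. -/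
theorem chi_mul_partSum_sub_lam (hk : 2 ≤ k) (hkD : k < D) (hDN : 2 * D < N)
    (f : FullRankFactorization (x - y) k) {α : Fin D → F} {β : Fin (N - D) → F} (hα : α ≠ 0)
    (hβ : β ≠ 0) (j : Fin 6) :
    chi (vecMulVec α β) (x - y) * (partSum x y j (vecMulVec α β) - lam x y j) =
      symFun (x - y) (partCoeff F D N k j) (vecMulVec α β) := by
  have hq := card_complex_ne_zero F
  have hP := partSum_vecMulVec f (by omega) hkD (by omega) α β j
  have hlam := congrArg (fun t : ℝ => (t : ℂ)) (lam_eq hk hkD hDN f j)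
  -- The conjugate character produced by the quadric c ⬝ d = -1 becomes the constant 1 after
  -- multiplication by χ_B(w).
  have hpp : chi (vecMulVec α β) (x - y) * fieldChar F (-((α ᵥ* f.L) ⬝ᵥ (f.R *ᵥ β))) = 1 := by
    rw [chi_vecMulVec_left, ← vecMul_L_dotProduct f, ← AddChar.map_add_eq_mul, add_neg_cancel,
      AddChar.map_zero_eq_one]
  have h0p := indPair_mul_chi (x - y) (vecMulVec α β)
  have h1p := indRow_mul_chi (x - y) (vecMulVec α β)
  have h2p := indCol_mul_chi (x - y) (vecMulVec α β)
  have i0 : indPair (x - y) (vecMulVec α β) =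
      if (α ᵥ* f.L) ⬝ᵥ (f.R *ᵥ β) = 0 then 1 else 0 := by
    rw [indPair_vecMulVec, ← vecMul_L_dotProduct f]
  have i1 : indRow (x - y) (vecMulVec α β) = if f.R *ᵥ β = 0 then 1 else 0 := by
    simp only [indRow_vecMulVec, hα, false_or, R_mulVec_eq_zero_iff]
  have i2 : indCol (x - y) (vecMulVec α β) = if α ᵥ* f.L = 0 then 1 else 0 := by
    simp only [indCol_vecMulVec, hβ, or_false, vecMul_L_eq_zero_iff]
  have iu : (if α ᵥ* f.L = 0 ∨ f.R *ᵥ β = 0 then (Fintype.card F : ℂ) else 1) =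
      1 + ((Fintype.card F : ℂ) - 1) * (indRow (x - y) (vecMulVec α β) +
        indCol (x - y) (vecMulVec α β) -
        indRow (x - y) (vecMulVec α β) * indCol (x - y) (vecMulVec α β)) := by
    rw [i1, i2]
    by_cases h1 : f.R *ᵥ β = 0 <;> by_cases h2 : α ᵥ* f.L = 0 <;> simp [h1, h2]
  have k1 : prodSum (α ᵥ* f.L) (f.R *ᵥ β) = (Fintype.card F : ℂ) ^ (k - 1) *
      (Fintype.card F : ℂ) ^ k *
      (1 + ((Fintype.card F : ℂ) - 1) * (indRow (x - y) (vecMulVec α β) +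
        indCol (x - y) (vecMulVec α β) -
        indRow (x - y) (vecMulVec α β) * indCol (x - y) (vecMulVec α β))) := by
    apply mul_left_cancel₀ hq
    rw [prodSum_eq, iu, ← mul_assoc, ← mul_assoc, ← pow_succ', Nat.sub_add_cancel (by omega)]
  have k2 : prodSum (α ᵥ* f.L) β = (Fintype.card F : ℂ) ^ (k - 1) *
      (Fintype.card F : ℂ) ^ (N - D) *
      (1 + ((Fintype.card F : ℂ) - 1) * indCol (x - y) (vecMulVec α β)) := by
    apply mul_left_cancel₀ hq
    rw [prodSum_eq, ← mul_assoc, ← mul_assoc, ← pow_succ', Nat.sub_add_cancel (by omega), i2]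
    by_cases h2 : α ᵥ* f.L = 0 <;> simp [h2, hβ]
  have k3 : prodSum α (f.R *ᵥ β) = (Fintype.card F : ℂ) ^ (k - 1) *
      (Fintype.card F : ℂ) ^ D *
      (1 + ((Fintype.card F : ℂ) - 1) * indRow (x - y) (vecMulVec α β)) := by
    apply mul_left_cancel₀ hq
    rw [prodSum_eq, ← mul_assoc, ← mul_assoc, ← pow_succ', Nat.sub_add_cancel (by omega), i1]
    by_cases h2 : f.R *ᵥ β = 0 <;> simp [h2, hα] <;> ring
  have k4 : prodSum α β = (Fintype.card F : ℂ) ^ D * (Fintype.card F : ℂ) ^ (N - D) /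
      Fintype.card F := by
    rw [eq_div_iff hq, mul_comm, prodSum_eq, if_neg (by tauto), mul_one]
  rw [quadricSum_zero_eq (by omega), quadricSum_neg_one_eq (by omega), k1, k2, k3, k4, iu,
    ← i0] at hP
  have hkk : (Fintype.card F : ℂ) ^ k = Fintype.card F * (Fintype.card F : ℂ) ^ (k - 1) := by
    rw [← pow_succ', Nat.sub_add_cancel (by omega)]
  rw [hkk] at hP
  simp only at hlam
  apply mul_left_cancel₀ (card_sub_one_complex_ne_zero F)
  have hlam' : ((Fintype.card F : ℂ) - 1) * (lam x y j : ℂ) =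
      (((Fintype.card F : ℝ) - 1) * lam x y j : ℝ) := by push_cast; rfl
  have hsplit : ((Fintype.card F : ℂ) - 1) * (chi (vecMulVec α β) (x - y) *
      (partSum x y j (vecMulVec α β) - lam x y j)) = chi (vecMulVec α β) (x - y) *
      (((Fintype.card F : ℂ) - 1) * partSum x y j (vecMulVec α β) -
        ((Fintype.card F : ℂ) - 1) * lam x y j) := by ring
  rw [hsplit, hP, hlam', hlam, symFun]
  -- What remains is algebra in p = χ_B(w), its inverse and the three indicators, modulo p p⁻¹ = 1
  -- and Jp = J for each indicator J.
  clear hP hlam hlam' hsplit k1 k2 k3 k4 iu i0 i1 i2 hkk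
  generalize fieldChar F (-((α ᵥ* f.L) ⬝ᵥ (f.R *ᵥ β))) = pb at *
  generalize chi (vecMulVec α β) (x - y) = p at *
  generalize indPair (x - y) (vecMulVec α β) = j0 at *
  generalize indRow (x - y) (vecMulVec α β) = j1 at *
  generalize indCol (x - y) (vecMulVec α β) = j2 at *
  fin_cases j
  · simp [partCoeff]
    generalize (Fintype.card F : ℂ) ^ (k - 1) = s at *
    generalize (Fintype.card F : ℂ) = q at *
    linear_combination s * (q - 1) * (1 - j0) * hpp + s * s * (q - 1) * (h1p + h2p - j2 * h1p)
  · simp [partCoeff]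
    generalize (Fintype.card F : ℂ) ^ (k - 1) = s at *
    generalize (Fintype.card F : ℂ) = q at *
    linear_combination -s * (q - 1) * h0p + s * s * (q - 1) * (h1p + h2p - j2 * h1p)
  · simp [partCoeff]
    generalize (Fintype.card F : ℂ) ^ (k - 1) = s at *
    generalize (Fintype.card F : ℂ) = q at *
    linear_combination s * (q - 1) * h0p - s * (q - 1) * (1 - j0) * hpp +
      (q - 2) * s * s * (q - 1) * (h1p + h2p - j2 * h1p)
  · simp [partCoeff]
    generalize (Fintype.card F : ℂ) ^ (k - 1) = s at *
    generalize (Fintype.card F : ℂ) ^ (N - D) = t at *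
    generalize (Fintype.card F : ℂ) = q at *
    linear_combination s * t * (q - 1) * h2p - s * q * s * (q - 1) * (h1p + h2p - j2 * h1p)
  · simp [partCoeff]
    generalize (Fintype.card F : ℂ) ^ (k - 1) = s at *
    generalize (Fintype.card F : ℂ) ^ D = t at *
    generalize (Fintype.card F : ℂ) = q at *
    linear_combination s * t * (q - 1) * h1p - s * q * s * (q - 1) * (h1p + h2p - j2 * h1p)
  · simp [partCoeff]
    generalize (Fintype.card F : ℂ) ^ (k - 1) = s at *
    generalize (Fintype.card F : ℂ) ^ D = u at *
    generalize (Fintype.card F : ℂ) ^ (N - D) = v at *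
    generalize (Fintype.card F : ℂ) = q at *
    have hdiv : (u - q * s) * (v - q * s) / q = u * v / q - s * u - s * v + q * s * s := by
      field_simp
      ring
    rw [hdiv]
    linear_combination -s * u * (q - 1) * h1p - s * v * (q - 1) * h2p +
      s * q * s * (q - 1) * (h1p + h2p - j2 * h1p)

end ClosedForms

/-! ### Convolutions with χ + 1 and χ - 1. -/

section NbrSums

variable {F : Type*} [Field F] [Fintype F] [DecidableEq F] {m n : Type*} [Fintype m]
  [Fintype n] [DecidableEq m] [DecidableEq n]

theorem sum_rankOneNbrs_sub (f : Matrix m n F → ℂ) (B : Matrix m n F) :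
    ∑ C ∈ rankOneNbrs B, f (B - C) = ∑ C ∈ rankOneNbrs B, f C := by
  refine Finset.sum_nbij' (fun C => B - C) (fun C => B - C) ?_ ?_ ?_ ?_ ?_
  · intro C hC
    rw [mem_rankOneNbrs] at hC ⊢
    rw [sub_sub_cancel]
    exact hC.symm
  · intro C hC
    rw [mem_rankOneNbrs] at hC ⊢
    rw [sub_sub_cancel]
    exact hC.symm
  · intro C _
    exact sub_sub_cancel B C
  · intro C _
    exact sub_sub_cancel B C
  · intro C _
    rfl

theorem chi_mul_chi_sub (B C w : Matrix m n F) : chi C w * chi (B - C) w = chi B w := by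
  rw [← chi_add_left, add_sub_cancel]

/-- On the support of J the value χ_C(w) is 1, so χ_{B-C}(w) = χ_B(w) there and the second factor no
longer depends on C. -/
theorem sum_rankOneNbrs_mul_chi_sub {w : Matrix m n F} {J : Matrix m n F → ℂ}
    (hJ : ∀ C, J C * chi C w = J C) (B : Matrix m n F) (t : ℂ) :
    ∑ C ∈ rankOneNbrs B, J C * (chi (B - C) w + t) =
      (∑ C ∈ rankOneNbrs B, J C) * (chi B w + t) := by
  rw [Finset.sum_mul]
  refine Finset.sum_congr rfl fun C _ => ?_
  linear_combination J C * chi_mul_chi_sub B C w - chi (B - C) w * hJ C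

theorem indRow_mul_indCol_mul_chi (w B : Matrix m n F) :
    indRow w B * indCol w B * chi B w = indRow w B * indCol w B := by
  rw [mul_assoc, indCol_mul_chi]

variable {a : m → F} {b : n → F}

theorem sum_rankOneNbrs_chi_add_mul (w : Matrix m n F) (ha : a ≠ 0) (hb : b ≠ 0) (s t : ℂ) :
    ∑ C ∈ rankOneNbrs (vecMulVec a b), (chi C w + s) * (chi (vecMulVec a b - C) w + t) =
      nbrNum F m n * (chi (vecMulVec a b) w + s * t) +
        (s + t) * ∑ C ∈ rankOneNbrs (vecMulVec a b), chi C w := by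
  have h : ∀ C, (chi C w + s) * (chi (vecMulVec a b - C) w + t) =
      1 * (chi (vecMulVec a b) w + s * t) + s * chi (vecMulVec a b - C) w + t * chi C w := by
    intro C
    linear_combination chi_mul_chi_sub (vecMulVec a b) C w
  rw [Finset.sum_congr rfl fun C _ => h C, Finset.sum_add_distrib, Finset.sum_add_distrib,
    ← Finset.sum_mul, ← Finset.mul_sum, ← Finset.mul_sum, sum_nbrs_one ha hb,
    sum_rankOneNbrs_sub (fun C => chi C w)]
  ring

theorem sum_rankOneNbrs_symFun_mul (w : Matrix m n F) (r : Fin 5 → ℝ) (B : Matrix m n F) (t : ℂ) :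
    ∑ C ∈ rankOneNbrs B, symFun w r C * (chi (B - C) w + t) =
      r 0 * ∑ C ∈ rankOneNbrs B, (chi C w + 1) * (chi (B - C) w + t) +
        (r 1 * ∑ C ∈ rankOneNbrs B, indPair w C + r 2 * ∑ C ∈ rankOneNbrs B, indRow w C +
          r 3 * ∑ C ∈ rankOneNbrs B, indCol w C +
          r 4 * ∑ C ∈ rankOneNbrs B, indRow w C * indCol w C) * (chi B w + t) := by
  rw [add_mul, add_mul, add_mul, mul_assoc, mul_assoc, mul_assoc, mul_assoc,
    ← sum_rankOneNbrs_mul_chi_sub (indPair_mul_chi w),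
    ← sum_rankOneNbrs_mul_chi_sub (indRow_mul_chi w),
    ← sum_rankOneNbrs_mul_chi_sub (indCol_mul_chi w),
    ← sum_rankOneNbrs_mul_chi_sub (indRow_mul_indCol_mul_chi w)]
  simp only [Finset.mul_sum, ← Finset.sum_add_distrib]
  refine Finset.sum_congr rfl fun C _ => ?_
  rw [symFun]
  ring

variable (F m n) in
/-- The eigenvalue with which a function `symFun w r` acts by convolution on `chi · w - 1`. -/
noncomputable def symEig (k : ℕ) (r : Fin 5 → ℝ) : ℝ :=
  let q : ℝ := Fintype.card F
  let A : ℝ := q ^ Fintype.card m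
  let B : ℝ := q ^ Fintype.card n
  r 0 * (A + B - q - 2) + r 1 * (A / q + B / q - 2) + r 2 * (B / q ^ k - 1) +
    r 3 * (A / q ^ k - 1)

/-- Every indicator at B annihilates χ_B(w) - 1, and in the product of χ + 1 with χ - 1 the linear
terms cancel, so only constants multiply χ_B(w) - 1. -/
theorem sum_rankOneNbrs_symFun_mul_chi_sub_one (w : Matrix m n F) (r : Fin 5 → ℝ) (ha : a ≠ 0)
    (hb : b ≠ 0) :
    ∑ C ∈ rankOneNbrs (vecMulVec a b), symFun w r C * (chi (vecMulVec a b - C) w + -1) =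
      symEig F m n w.rank r * (chi (vecMulVec a b) w + -1) := by
  rw [sum_rankOneNbrs_symFun_mul, sum_rankOneNbrs_chi_add_mul w ha hb, sum_nbrs_indPair w ha hb,
    sum_nbrs_indRow w ha hb, sum_nbrs_indCol w ha hb, sum_nbrs_indRow_mul_indCol w ha hb, symEig,
    nbrNum]
  have h0 := indPair_mul_chi w (vecMulVec a b)
  have h1 := indRow_mul_chi w (vecMulVec a b)
  have h2 := indCol_mul_chi w (vecMulVec a b)
  push_cast
  generalize (Fintype.card F : ℂ) ^ Fintype.card m = A
  generalize (Fintype.card F : ℂ) ^ Fintype.card n = A'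
  generalize (Fintype.card F : ℂ) ^ w.rank = ρ
  generalize (Fintype.card F : ℂ) = q
  generalize indPair w (vecMulVec a b) = j0 at *
  generalize indRow w (vecMulVec a b) = j1 at *
  generalize indCol w (vecMulVec a b) = j2 at *
  generalize chi (vecMulVec a b) w = p at *
  linear_combination r 1 * (A / q * (q - 1) * h1 + A' / q * (q - 1) * h2 - q * h0) +
    r 2 * (A - q - 1) * h1 + r 3 * (A' - q - 1) * h2 +
    r 4 * ((A' / ρ - 1) * h2 + (A / ρ - 1) * h1 - q * j1 * h2)

variable (F m n) in
/-- The coefficients of the convolution of `symFun w r` with `chi · w + 1`. -/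
noncomputable def symMul (k : ℕ) (r : Fin 5 → ℝ) : Fin 5 → ℝ :=
  let q : ℝ := Fintype.card F
  let A : ℝ := q ^ Fintype.card m
  let B : ℝ := q ^ Fintype.card n
  ![r 0 * (A + B - q - 4) + r 1 * (A / q + B / q - 2) + r 2 * (B / q ^ k - 1) +
      r 3 * (A / q ^ k - 1),
    -2 * q * (r 0 + r 1),
    2 * (r 0 * A + r 1 * (A / q * (q - 1)) + r 2 * (A - q - 1) + r 4 * (A / q ^ k - 1)),
    2 * (r 0 * B + r 1 * (B / q * (q - 1)) + r 3 * (B - q - 1) + r 4 * (B / q ^ k - 1)),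
    -2 * q * r 4]

/-- Here each indicator J gives J(B)(χ_B(w) + 1) = 2J(B), so the family of five functions is
preserved. -/
theorem sum_rankOneNbrs_symFun_mul_chi_add_one (w : Matrix m n F) (r : Fin 5 → ℝ) (ha : a ≠ 0)
    (hb : b ≠ 0) :
    ∑ C ∈ rankOneNbrs (vecMulVec a b), symFun w r C * (chi (vecMulVec a b - C) w + 1) =
      symFun w (symMul F m n w.rank r) (vecMulVec a b) := by
  rw [sum_rankOneNbrs_symFun_mul, sum_rankOneNbrs_chi_add_mul w ha hb, sum_nbrs_chi w ha hb,
    sum_nbrs_indPair w ha hb,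
    sum_nbrs_indRow w ha hb, sum_nbrs_indCol w ha hb, sum_nbrs_indRow_mul_indCol w ha hb,
    symFun, symMul, nbrNum]
  have h0 := indPair_mul_chi w (vecMulVec a b)
  have h1 := indRow_mul_chi w (vecMulVec a b)
  have h2 := indCol_mul_chi w (vecMulVec a b)
  simp only [cons_val]
  push_cast
  generalize (Fintype.card F : ℂ) ^ Fintype.card m = A
  generalize (Fintype.card F : ℂ) ^ Fintype.card n = A'
  generalize (Fintype.card F : ℂ) ^ w.rank = ρ
  generalize (Fintype.card F : ℂ) = q
  generalize indPair w (vecMulVec a b) = j0 at *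
  generalize indRow w (vecMulVec a b) = j1 at *
  generalize indCol w (vecMulVec a b) = j2 at *
  generalize chi (vecMulVec a b) w = p at *
  linear_combination r 1 * (A / q * (q - 1) * h1 + A' / q * (q - 1) * h2 - q * h0) +
    r 2 * (A - q - 1) * h1 + r 3 * (A' - q - 1) * h2 +
    r 4 * ((A' / ρ - 1) * h2 + (A / ρ - 1) * h1 - q * j1 * h2)

variable (F m n) in
/-- The coefficients of the convolution square of `chi · w - 1`. -/
noncomputable def sqCoeff : Fin 5 → ℝ :=
  let q : ℝ := Fintype.card F
  let A : ℝ := q ^ Fintype.card m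
  let B : ℝ := q ^ Fintype.card n
  ![A + B - q, 2 * q, -2 * A, -2 * B, 0]

theorem sum_rankOneNbrs_chi_sub_one_mul (w : Matrix m n F) (ha : a ≠ 0) (hb : b ≠ 0) :
    ∑ C ∈ rankOneNbrs (vecMulVec a b), (chi C w + -1) * (chi (vecMulVec a b - C) w + -1) =
      symFun w (sqCoeff F m n) (vecMulVec a b) := by
  rw [sum_rankOneNbrs_chi_add_mul w ha hb, sum_nbrs_chi w ha hb, symFun, sqCoeff, nbrNum]
  simp only [cons_val]
  push_cast
  ring

end NbrSums

/-! ### Norton products and the description of Sym(S). -/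

section Products

variable {F : Type*} [Field F] [Fintype F] [DecidableEq F] {D N : ℕ} {x y : Vert F D N} {k : ℕ}

theorem transform_idem (hD : 0 < D) (hN : D < N) (v : Vert F D N → ℝ) (B : Vert F D N) :
    transform y (idem F D N *ᵥ v) B = if B.rank = 1 then transform y v B else 0 := by
  rw [idem_eq_rankIdem hD hN]
  exact (transform_rankIdem y v B).trans (by split_ifs <;> simp)

/-- The vector `v` is supported on rank one matrices in the frequency domain, with values `φ`. -/
def HasRankOneTransform (y : Vert F D N) (v : Vert F D N → ℝ) (φ : Vert F D N → ℂ) : Prop :=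
  ∀ B, transform y v B = if B.rank = 1 then φ B else 0

theorem HasRankOneTransform.eq {u v : Vert F D N → ℝ} {φ ψ : Vert F D N → ℂ}
    (hu : HasRankOneTransform y u φ) (hv : HasRankOneTransform y v ψ)
    (h : ∀ a b, a ≠ 0 → b ≠ 0 → φ (vecMulVec a b) = ψ (vecMulVec a b)) : u = v := by
  refine transform_injective y fun B => ?_
  rw [hu, hv]
  split_ifs with hB
  · obtain ⟨a, b, ha, hb, rfl⟩ := rank_eq_one_iff_exists.mp hB
    exact h a b ha hb
  · rfl

theorem HasRankOneTransform.congr {v : Vert F D N → ℝ} {φ ψ : Vert F D N → ℂ}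
    (hv : HasRankOneTransform y v φ)
    (h : ∀ a b, a ≠ 0 → b ≠ 0 → φ (vecMulVec a b) = ψ (vecMulVec a b)) :
    HasRankOneTransform y v ψ := by
  intro B
  rw [hv]
  split_ifs with hB
  · obtain ⟨a, b, ha, hb, rfl⟩ := rank_eq_one_iff_exists.mp hB
    exact h a b ha hb
  · rfl

theorem HasRankOneTransform.add {u v : Vert F D N → ℝ} {φ ψ : Vert F D N → ℂ}
    (hu : HasRankOneTransform y u φ) (hv : HasRankOneTransform y v ψ) :
    HasRankOneTransform y (u + v) fun B => φ B + ψ B := by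
  intro B
  rw [transform_add, hu, hv]
  split_ifs <;> simp

theorem HasRankOneTransform.smul {v : Vert F D N → ℝ} {φ : Vert F D N → ℂ}
    (hv : HasRankOneTransform y v φ) (r : ℝ) :
    HasRankOneTransform y (r • v) fun B => r * φ B := by
  intro B
  rw [transform_smul, hv]
  split_ifs <;> simp

/-- The convolution theorem turns u ∘ v into a sum over C; the supports of u and v restrict it to
common neighbours of 0 and B, and E restricts B to rank one. -/
theorem HasRankOneTransform.norton (hD : 0 < D) (hN : D < N) {u v : Vert F D N → ℝ}
    {φ ψ : Vert F D N → ℂ} (hu : HasRankOneTransform y u φ) (hv : HasRankOneTransform y v ψ) :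
    HasRankOneTransform y ((Fintype.card (Vert F D N) : ℝ) • norton u v)
      fun B => ∑ C ∈ rankOneNbrs B, φ C * ψ (B - C) := by
  intro B
  rw [transform_smul, NortonBilinear.norton, transform_idem hD hN]
  split_ifs with hB
  · have h := transform_mul y u v B
    rw [Complex.ofReal_natCast, h, ← Finset.sum_subset (Finset.subset_univ (rankOneNbrs B))]
    · refine Finset.sum_congr rfl fun C hC => ?_
      rw [mem_rankOneNbrs] at hC
      rw [hu, hv, if_pos hC.1, if_pos hC.2]
    · intro C _ hC
      rw [mem_rankOneNbrs, not_and_or] at hC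
      rw [hu, hv]
      rcases hC with h | h <;> simp [h]
  · exact mul_zero _

theorem hasRankOneTransform_Ehat (hD : 0 < D) (hN : D < N) (x y : Vert F D N) :
    HasRankOneTransform y (Ehat x) fun B => chi B (x - y) := by
  intro B
  rw [Ehat, transform_idem hD hN, transform_single]

theorem hasRankOneTransform_Ehat_add (hD : 0 < D) (hN : D < N) (x y : Vert F D N) :
    HasRankOneTransform y (Ehat x + Ehat y) fun B => chi B (x - y) + 1 := by
  refine ((hasRankOneTransform_Ehat hD hN x y).add (hasRankOneTransform_Ehat hD hN y y)).congr ?_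
  intro a b _ _
  simp only [sub_self, chi_zero_right]

theorem hasRankOneTransform_Ehat_sub (hD : 0 < D) (hN : D < N) (x y : Vert F D N) :
    HasRankOneTransform y (Ehat x - Ehat y) fun B => chi B (x - y) + -1 := by
  intro B
  rw [transform_sub, hasRankOneTransform_Ehat hD hN x y B, hasRankOneTransform_Ehat hD hN y y B]
  simp only [sub_self, chi_zero_right]
  split_ifs <;> ring

theorem transform_hat_part (j : Fin 6) (B : Vert F D N) :
    transform y (hat (part x y j)) B = chi B (x - y) * partSum x y j B := by
  have h : ∀ Ω : Finset (Vert F D N), transform y (hat Ω) B = ∑ z ∈ Ω, chi B (z - y) := by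
    intro Ω
    induction Ω using Finset.induction_on with
    | empty => simp [hat, transform]
    | insert z Ω hz ih =>
      have h2 : hat (insert z Ω) = Pi.single z 1 + hat Ω := Finset.sum_insert hz
      rw [h2, transform_add, ih, transform_single, Finset.sum_insert hz]
  rw [h, partSum, Finset.mul_sum]
  refine Finset.sum_congr rfl fun z _ => ?_
  rw [← chi_add_right, add_comm, sub_add_sub_cancel]

theorem hasRankOneTransform_EOcheck (hk : 2 ≤ k) (hkD : k < D) (hDN : 2 * D < N)
    (hw : (x - y).rank = k) (j : Fin 6) :
    HasRankOneTransform y (EOcheck x y j) (symFun (x - y) (partCoeff F D N k j)) := by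
  obtain ⟨f⟩ := nonempty_fullRankFactorization hw
  intro B
  rw [EOcheck, transform_idem (by omega) (by omega), transform_sub, transform_smul,
    transform_single, transform_hat_part]
  split_ifs with hB
  · obtain ⟨a, b, ha, hb, rfl⟩ := rank_eq_one_iff_exists.mp hB
    rw [← chi_mul_partSum_sub_lam hk hkD hDN f ha hb]
    ring
  · rfl

theorem symFun_add (w : Vert F D N) (r s : Fin 5 → ℝ) (B : Vert F D N) :
    symFun w (r + s) B = symFun w r B + symFun w s B := by
  simp only [symFun, Pi.add_apply]
  push_cast
  ring

theorem symFun_smul (w : Vert F D N) (c : ℝ) (r : Fin 5 → ℝ) (B : Vert F D N) :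
    symFun w (c • r) B = c * symFun w r B := by
  simp only [symFun, Pi.smul_apply, smul_eq_mul]
  push_cast
  ring

theorem exists_hasRankOneTransform_of_mem_symPart (hk : 2 ≤ k) (hkD : k < D) (hDN : 2 * D < N)
    (hw : (x - y).rank = k) {v : Vert F D N → ℝ} (hv : v ∈ symPart x y) :
    ∃ r, HasRankOneTransform y v (symFun (x - y) r) := by
  induction hv using Submodule.span_induction with
  | mem v hv =>
    obtain ⟨j, rfl⟩ := hv
    exact ⟨_, hasRankOneTransform_EOcheck hk hkD hDN hw j⟩
  | zero => exact ⟨0, fun B => by simp [transform, symFun]⟩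
  | add u v _ _ hu hv =>
    obtain ⟨r, hr⟩ := hu
    obtain ⟨s, hs⟩ := hv
    exact ⟨r + s, (hr.add hs).congr fun a b _ _ => (symFun_add _ r s _).symm⟩
  | smul c v _ hv =>
    obtain ⟨r, hr⟩ := hv
    exact ⟨c • r, (hr.smul c).congr fun a b _ _ => (symFun_smul _ c r _).symm⟩

/-- With this spanning property, membership in Sym(S) only requires the shape of the transform, not
an explicit combination of the E O_j^∨. -/
theorem exists_sum_smul_partCoeff (D N k : ℕ) (r : Fin 5 → ℝ) :
    ∃ c : Fin 6 → ℝ, ∑ j, c j • partCoeff F D N k j = r := by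
  have hq := one_lt_card_real F
  have hq0 : (Fintype.card F : ℝ) ≠ 0 := by linarith
  have hs : (Fintype.card F : ℝ) ^ (k - 1) ≠ 0 := pow_ne_zero _ hq0
  have hA : (Fintype.card F : ℝ) ^ D ≠ 0 := pow_ne_zero _ hq0
  have hB : (Fintype.card F : ℝ) ^ (N - D) ≠ 0 := pow_ne_zero _ hq0
  simp only [partCoeff]
  generalize (Fintype.card F : ℝ) ^ (k - 1) = s at *
  generalize (Fintype.card F : ℝ) ^ D = A at *
  generalize (Fintype.card F : ℝ) ^ (N - D) = B at *
  generalize (Fintype.card F : ℝ) = q at *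
  -- The first two vectors match coordinates 0 and 1, and the third is not needed. Among the last
  -- three, fourth + sixth is (0, 0, -As, 0, 0) and fifth + sixth is (0, 0, 0, -Bs, 0), so t, u, v
  -- solve a triangular system for coordinates 4, 2, 3.
  let t := (r 4 - s * r 1) / (q * s * s)
  let u := (r 2 + r 4) / (A * s)
  let v := (r 3 + s * r 1 - t * (B * s - q * s * s)) / (B * s)
  refine ⟨![r 0 / s, -(r 0 + r 1) / s, 0, t - u, -v, -u - v], ?_⟩
  ext i
  simp only [Fin.sum_univ_six, Pi.add_apply, Pi.smul_apply, smul_eq_mul]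
  fin_cases i
  · simp
    field_simp
  · simp
    field_simp
    ring
  · simp [t, u]
    field_simp
    ring
  · simp [t, u, v]
    field_simp
    ring
  · simp [t, u, v]
    field_simp
    ring

theorem HasRankOneTransform.mem_symPart (hk : 2 ≤ k) (hkD : k < D) (hDN : 2 * D < N)
    (hw : (x - y).rank = k) {v : Vert F D N → ℝ} {r : Fin 5 → ℝ}
    (hv : HasRankOneTransform y v (symFun (x - y) r)) : v ∈ symPart x y := by
  obtain ⟨c, rfl⟩ := exists_sum_smul_partCoeff (F := F) D N k r
  have h : ∀ J : Finset (Fin 6), HasRankOneTransform y (∑ j ∈ J, c j • EOcheck x y j)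
      (symFun (x - y) (∑ j ∈ J, c j • partCoeff F D N k j)) := by
    intro J
    induction J using Finset.induction_on with
    | empty => intro B; simp [transform, symFun]
    | insert j J hj ih =>
      rw [Finset.sum_insert hj, Finset.sum_insert hj]
      refine (((hasRankOneTransform_EOcheck hk hkD hDN hw j).smul (c j)).add ih).congr ?_
      intro a b _ _
      rw [symFun_add, symFun_smul]
  rw [hv.eq (h Finset.univ) fun a b _ _ => rfl]
  exact Submodule.sum_mem _ fun j _ =>
    Submodule.smul_mem _ _ (Submodule.subset_span (Set.mem_range_self j))

variable (F D N) in
theorem card_vert_ne_zero : (Fintype.card (Vert F D N) : ℝ) ≠ 0 :=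
  Nat.cast_ne_zero.mpr Fintype.card_ne_zero

theorem norton_comm (u v : Vert F D N → ℝ) : norton u v = norton v u := by
  rw [norton, norton, mul_comm]

theorem norton_smul_left (c : ℝ) (u v : Vert F D N → ℝ) : norton (c • u) v = c • norton u v := by
  rw [norton, norton, smul_mul_assoc, mulVec_smul]

theorem norton_smul_right (c : ℝ) (u v : Vert F D N → ℝ) : norton u (c • v) = c • norton u v := by
  rw [norton, norton, mul_smul_comm, mulVec_smul]

theorem card_smul_norton_Ehat_sub (hk : 2 ≤ k) (hkD : k < D) (hDN : 2 * D < N)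
    (hw : (x - y).rank = k) {v : Vert F D N → ℝ} {r : Fin 5 → ℝ}
    (hv : HasRankOneTransform y v (symFun (x - y) r)) :
    (Fintype.card (Vert F D N) : ℝ) • norton v (Ehat x - Ehat y) =
      symEig F (Fin D) (Fin (N - D)) k r • (Ehat x - Ehat y) := by
  have hD : 0 < D := by omega
  have hN : D < N := by omega
  have h := hasRankOneTransform_Ehat_sub hD hN x y
  refine (hv.norton hD hN h).eq (h.smul _) fun a b ha hb => ?_
  rw [← hw]
  exact sum_rankOneNbrs_symFun_mul_chi_sub_one (x - y) r ha hb

theorem norton_Ehat_sub (hk : 2 ≤ k) (hkD : k < D) (hDN : 2 * D < N)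
    (hw : (x - y).rank = k) {v : Vert F D N → ℝ} {r : Fin 5 → ℝ}
    (hv : HasRankOneTransform y v (symFun (x - y) r)) :
    norton v (Ehat x - Ehat y) =
      (symEig F (Fin D) (Fin (N - D)) k r / Fintype.card (Vert F D N)) • (Ehat x - Ehat y) := by
  rw [div_eq_inv_mul, mul_smul, ← card_smul_norton_Ehat_sub hk hkD hDN hw hv,
    inv_smul_smul₀ (card_vert_ne_zero F D N)]

theorem mem_symPart_of_card_smul_mem {v : Vert F D N → ℝ}
    (h : (Fintype.card (Vert F D N) : ℝ) • v ∈ symPart x y) : v ∈ symPart x y :=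
  (Submodule.smul_mem_iff _ (card_vert_ne_zero F D N)).mp h

theorem norton_Ehat_sub_self_mem (hk : 2 ≤ k) (hkD : k < D) (hDN : 2 * D < N)
    (hw : (x - y).rank = k) :
    norton (Ehat x - Ehat y) (Ehat x - Ehat y) ∈ symPart x y := by
  have hD : 0 < D := by omega
  have hN : D < N := by omega
  have h := hasRankOneTransform_Ehat_sub hD hN x y
  exact mem_symPart_of_card_smul_mem (((h.norton hD hN h).congr fun a b ha hb =>
    sum_rankOneNbrs_chi_sub_one_mul (x - y) ha hb).mem_symPart hk hkD hDN hw)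

theorem norton_Ehat_add_mem (hk : 2 ≤ k) (hkD : k < D) (hDN : 2 * D < N)
    (hw : (x - y).rank = k) {v : Vert F D N → ℝ} (hv : v ∈ symPart x y) :
    norton (Ehat x + Ehat y) v ∈ symPart x y := by
  have hD : 0 < D := by omega
  have hN : D < N := by omega
  have h := hasRankOneTransform_Ehat_add hD hN x y
  obtain ⟨r, hr⟩ := exists_hasRankOneTransform_of_mem_symPart hk hkD hDN hw hv
  rw [norton_comm]
  exact mem_symPart_of_card_smul_mem (((hr.norton hD hN h).congr fun a b ha hb =>
    sum_rankOneNbrs_symFun_mul_chi_add_one (x - y) r ha hb).mem_symPart hk hkD hDN hw)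

theorem symEig_partCoeff (hk : 1 ≤ k) (j : Fin 6) :
    symEig F (Fin D) (Fin (N - D)) k (partCoeff F D N k j) =
      let q : ℝ := Fintype.card F
      ![q ^ (k - 1) * (q ^ D + q ^ (N - D) - 2 * q ^ (k - 1) - q),
        -(2 * q ^ (k - 1) * (q ^ (k - 1) - 1)),
        -((q - 2) * q ^ (k - 1) * (2 * q ^ (k - 1) - 1)),
        (q ^ D - 2 * q ^ k) * (q ^ (N - D) - q ^ k) / q,
        (q ^ D - q ^ k) * (q ^ (N - D) - 2 * q ^ k) / q,
        -(2 * (q ^ D - q ^ k) * (q ^ (N - D) - q ^ k) / q)] j := by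
  have hq := one_lt_card_real F
  have hq0 : (Fintype.card F : ℝ) ≠ 0 := by linarith
  have hs : (Fintype.card F : ℝ) ^ (k - 1) ≠ 0 := pow_ne_zero _ hq0
  have hkk : (Fintype.card F : ℝ) ^ k = Fintype.card F * (Fintype.card F : ℝ) ^ (k - 1) := by
    rw [← pow_succ', Nat.sub_add_cancel hk]
  simp only [symEig, partCoeff, Fintype.card_fin, hkk]
  generalize (Fintype.card F : ℝ) ^ (k - 1) = s at *
  generalize (Fintype.card F : ℝ) ^ D = A at *
  generalize (Fintype.card F : ℝ) ^ (N - D) = B at *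
  generalize (Fintype.card F : ℝ) = q at *
  fin_cases j <;> simp <;> field_simp <;> ring

end Products

end NortonBilinear

theorem proposition11p14 {F : Type*} [Field F] [Fintype F] [DecidableEq F]
    (q D N k : ℕ) (hq : Fintype.card F = q) (hq2 : q ≠ 2) (hD : 6 ≤ 2 * D) (hN : 2 * D < N)
    (x y : Matrix (Fin D) (Fin (N - D)) F)
    (hk : (graph F D N).dist x y = k) (hk2 : 2 ≤ k) (hkD : k ≤ D - 1) :
    (∀ j : Fin 6,
      norton (EOcheck x y j)
          (Ehat x - Ehat y) =
        (![(q : ℝ) ^ (k - 1) * ((q : ℝ) ^ D + (q : ℝ) ^ (N - D) - 2 * (q : ℝ) ^ (k - 1) - q) /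
              (q : ℝ) ^ (D * (N - D)),
            -(2 * (q : ℝ) ^ (k - 1) * ((q : ℝ) ^ (k - 1) - 1) / (q : ℝ) ^ (D * (N - D))),
            -(((q : ℝ) - 2) * (q : ℝ) ^ (k - 1) * (2 * (q : ℝ) ^ (k - 1) - 1) /
              (q : ℝ) ^ (D * (N - D))),
            ((q : ℝ) ^ D - 2 * (q : ℝ) ^ k) * ((q : ℝ) ^ (N - D) - (q : ℝ) ^ k) /
              (q * (q : ℝ) ^ (D * (N - D))),
            ((q : ℝ) ^ D - (q : ℝ) ^ k) * ((q : ℝ) ^ (N - D) - 2 * (q : ℝ) ^ k) /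
              (q * (q : ℝ) ^ (D * (N - D))),
            -(2 * ((q : ℝ) ^ D - (q : ℝ) ^ k) * ((q : ℝ) ^ (N - D) - (q : ℝ) ^ k) /
              (q * (q : ℝ) ^ (D * (N - D))))] : Fin 6 → ℝ) j •
          (Ehat x - Ehat y)) ∧
    (∀ u ∈ symPart x y, ∀ v ∈ asymPart x y,
      norton u v ∈ asymPart x y) ∧
    (∀ u ∈ asymPart x y, ∀ v ∈ asymPart x y,
      norton u v ∈ symPart x y) ∧
    (∀ v ∈ symPart x y,
      norton (Ehat x + Ehat y) v ∈
        symPart x y) := by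
  have hkD' : k < D := by omega
  have hk1 : 1 ≤ k := by omega
  have hw : (x - y).rank = k := by rw [← dist_eq_rank_sub, hk]
  have hX : (Fintype.card (Vert F D N) : ℝ) = (q : ℝ) ^ (D * (N - D)) := by
    have h : Fintype.card (Vert F D N) = Fintype.card (Fin D → Fin (N - D) → F) :=
      Fintype.card_congr Matrix.of.symm
    rw [h, Fintype.card_fun, Fintype.card_fun, Fintype.card_fin, Fintype.card_fin, ← hq,
      ← pow_mul, mul_comm D]
    push_cast
    rfl
  refine ⟨fun j => ?_, fun u hu v hv => ?_, fun u hu v hv => ?_, fun v hv =>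
    norton_Ehat_add_mem hk2 hkD' hN hw hv⟩
  · rw [norton_Ehat_sub hk2 hkD' hN hw (hasRankOneTransform_EOcheck hk2 hkD' hN hw j),
      symEig_partCoeff hk1, hX, hq]
    congr 1
    fin_cases j <;> simp [neg_div, div_div]
  · obtain ⟨r, hr⟩ := exists_hasRankOneTransform_of_mem_symPart hk2 hkD' hN hw hu
    obtain ⟨c, rfl⟩ := Submodule.mem_span_singleton.mp hv
    rw [norton_smul_right, norton_Ehat_sub hk2 hkD' hN hw hr]
    exact Submodule.smul_mem _ _ (Submodule.smul_mem _ _ (Submodule.mem_span_singleton_self _))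
  · obtain ⟨c, rfl⟩ := Submodule.mem_span_singleton.mp hu
    obtain ⟨d, rfl⟩ := Submodule.mem_span_singleton.mp hv
    rw [norton_smul_left, norton_smul_right]
    exact Submodule.smul_mem _ _ (Submodule.smul_mem _ _
      (norton_Ehat_sub_self_mem hk2 hkD' hN hw))
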